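/- **Theorem.** There is a polynomial-time algorithm which, for every fair division instance with a secretive agent, indivisible goods and nonnegative, monotone, submodular valuations given by value oracles, computes a secretive $\frac{1}{19}$-$\mathrm{MMS}$ allocation. In detail: an instance consists of $n\ge 0$ agents $1,\dots,n$ and one further, secretive, agent; a set $G=[m]$ of $m\ge 0$ indivisible goods; and functions $v_a:2^{G}\to\mathbb{R}_{\ge 0}$, $a\in[n]$, that are monotone ($v_a(S)\le v_a(T)$ for $S\subseteq T$) and submodular ($v_a(S\cup T)+v_a(S\cap T)\le v_a(S)+v_a(T)$). Let $\Pi_{n+1}(G)$ be the set of ordered partitions $(A_1,\dots,A_{n+1})$ of $G$ into $n+1$ pairwise disjoint, possibly empty bundles with union $G$, and let $$\mu_a=\max_{(A_1,\dots,A_{n+1})\in\Pi_{n+1}(G)}\ \min_{1\le j\le n+1} v_a(A_j)$$ be the maximin share of agent $a$. The computational model is a random access machine with value oracles. It stores natural numbers and reals in two-dimensional arrays with natural-number indices (indirect addressing is allowed). A program is a fixed finite text, independent of the instance, built by sequencing, conditionals and while-loops from assignments and oracle queries. Expressions use natural-number constants, the real constant $0$, array entries, addition and subtraction (truncated at $0$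 on natural numbers); tests are Boolean combinations of comparisons $\le$. There is no multiplication, division, rounding or conversion between reals and natural numbers. A query, given an agent $a$ and the indicator vector of a set $S\subseteq G$ stored in an array row, returns the number $v_a(S)$. Each assignment, oracle query and evaluation of the test of a conditional or loop counts as one step. The input consists of $n$ and $m$; the valuations are accessible only by queries. Then there are one program and one polynomial $p$ such that on every such instance the program halts after at most $p(n+m)$ steps and outputs a partition $(P_1,\dots,P_{n+1})\in\Pi_{n+1}(G)$ together with, for every $k\in[n+1]$ (the index of the bundle that the secretive agent takes), a bijection $\pi_k:[n]\to[n+1]\setminus\{k\}$ such that $$v_a\bigl(P_{\pi_k(a)}\bigr)\ \ge\ \tfrac{1}{19}\,\mu_a\qquad\text{for all } k\in[n+1]\text{ and all } a\in[n].$$ -/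

import Mathlib

namespace SecretiveMMS

/-! ## Fair division of indivisible goods with a secretive agent -/

/-- Submodularity of a set function. -/
def IsSubmodular {G : Type*} [DecidableEq G] (v : Finset G → ℝ) : Prop :=
  ∀ S T : Finset G, v (S ∪ T) + v (S ∩ T) ≤ v S + v T

/-- `P` is an ordered partition of the goods into bundles indexed by `ι`; bundles may be empty. -/
structure IsPartition {ι G : Type*} (P : ι → Finset G) : Prop where
  disjoint : ∀ i j : ι, i ≠ j → Disjoint (P i) (P j)
  cover : ∀ g : G, ∃ j : ι, g ∈ P j

/-- The maximin share for `N` bundles: the maximum, over all partitions of the goods into `N`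
bundles, of the minimum value of a bundle. For `0 < N` and finite `G` both the supremum and the
infimum range over finite nonempty families of reals, hence are a maximum and a minimum. -/
noncomputable def maximinShare {G : Type*} (N : ℕ) (v : Finset G → ℝ) : ℝ :=
  ⨆ P : {P : Fin N → Finset G // IsPartition P}, ⨅ j : Fin N, v (P.1 j)

/-- There are `n + 1` agents: `n` agents with valuations `v a`, and one secretive agent.
`P` is a partition of the goods into `n + 1` bundles and, for every bundle `P k` that the secretive
agent might take, `π k` is a bijection from the other agents onto the remaining bundles which gives
each of them at least an `α` fraction of her maximin share. -/
structure IsSecretiveMMS {n m : ℕ} (α : ℝ) (v : Fin n → Finset (Fin m) → ℝ)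
    (P : Fin (n + 1) → Finset (Fin m)) (π : Fin (n + 1) → Fin n → Fin (n + 1)) : Prop where
  partition : IsPartition P
  bijOn : ∀ k : Fin (n + 1), Set.BijOn (π k) Set.univ {k}ᶜ
  fair : ∀ (k : Fin (n + 1)) (a : Fin n), α * maximinShare (n + 1) (v a) ≤ v a (P (π k a))

/-! ## Oracle random access machine

The memory consists of two-dimensional arrays, each named by a number: arrays of natural
numbers (addresses, counters, flags) and arrays of reals (values). The only arithmetic operations
are addition and subtraction, and the only tests are comparisons (and their Boolean combinations);
there is no multiplication, no rounding and no conversion between the two sorts. Valuations are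
accessed only through value queries. -/

/-- Memory contents: `nat k i j` and `val k i j` are the cells `(i, j)` of the arrays named `k`. -/
structure State where
  nat : ℕ → ℕ → ℕ → ℕ
  val : ℕ → ℕ → ℕ → ℝ

/-- Overwrite cell `(i, j)` of the array named `k`. -/
def setCell {α : Type*} (M : ℕ → ℕ → ℕ → α) (k i j : ℕ) (x : α) : ℕ → ℕ → ℕ → α :=
  fun k' i' j' => if k' = k ∧ i' = i ∧ j' = j then x else M k' i' j'

/-- Expressions for natural numbers; `sub` is truncated subtraction. -/
inductive NatExp where
  | const (c : ℕ)
  | get (k : ℕ) (i j : NatExp)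
  | add (e f : NatExp)
  | sub (e f : NatExp)

/-- Expressions for reals. -/
inductive ValExp where
  | zero
  | get (k : ℕ) (i j : NatExp)
  | add (e f : ValExp)
  | sub (e f : ValExp)

/-- Tests. -/
inductive Test where
  | natLe (e f : NatExp)
  | valLe (e f : ValExp)
  | neg (b : Test)
  | conj (b c : Test)

/-- Programs. `setNat k i j e` and `setVal k i j e` assign to cell `(i, j)` of the array `k`;
`query k i j a l r` stores in the cell `(i, j)` of the value array `k` the value that agent `a` has
for the set of goods whose indicator is row `r` of the natural number array `l`. -/
inductive Program where
  | skip
  | setNat (k : ℕ) (i j : NatExp) (e : NatExp)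
  | setVal (k : ℕ) (i j : NatExp) (e : ValExp)
  | query (k : ℕ) (i j : NatExp) (a : NatExp) (l : ℕ) (r : NatExp)
  | seq (c d : Program)
  | cond (b : Test) (c d : Program)
  | loop (b : Test) (c : Program)

def NatExp.eval (s : State) : NatExp → ℕ
  | .const c => c
  | .get k i j => s.nat k (i.eval s) (j.eval s)
  | .add e f => e.eval s + f.eval s
  | .sub e f => e.eval s - f.eval s

noncomputable def ValExp.eval (s : State) : ValExp → ℝ
  | .zero => 0
  | .get k i j => s.val k (i.eval s) (j.eval s)
  | .add e f => e.eval s + f.eval s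
  | .sub e f => e.eval s - f.eval s

def Test.Holds (s : State) : Test → Prop
  | .natLe e f => e.eval s ≤ f.eval s
  | .valLe e f => e.eval s ≤ f.eval s
  | .neg b => ¬ b.Holds s
  | .conj b c => b.Holds s ∧ c.Holds s

/-- The set of goods whose indicator is stored in row `r` of the natural number array `l`. -/
def State.goods (s : State) (m l r : ℕ) : Finset (Fin m) :=
  Finset.univ.filter fun g => s.nat l r g ≠ 0

/-- The answer of the value oracle; a query about a nonexistent agent returns `0`. -/
def oracle {n m : ℕ} (v : Fin n → Finset (Fin m) → ℝ) (a : ℕ) (S : Finset (Fin m)) : ℝ :=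
  if h : a < n then v ⟨a, h⟩ S else 0

/-- `Exec v c s t s'`: with oracle `v`, the program `c` started in memory `s` halts after exactly
`t` steps with memory `s'`. Every assignment, every oracle query and every evaluation of a test of a
conditional or of a loop is one step. -/
inductive Exec {n m : ℕ} (v : Fin n → Finset (Fin m) → ℝ) :
    Program → State → ℕ → State → Prop where
  | skip (s : State) : Exec v .skip s 1 s
  | setNat (s : State) (k : ℕ) (i j e : NatExp) :
      Exec v (.setNat k i j e) s 1
        ⟨setCell s.nat k (i.eval s) (j.eval s) (e.eval s), s.val⟩
  | setVal (s : State) (k : ℕ) (i j : NatExp) (e : ValExp) :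
      Exec v (.setVal k i j e) s 1
        ⟨s.nat, setCell s.val k (i.eval s) (j.eval s) (e.eval s)⟩
  | query (s : State) (k : ℕ) (i j a : NatExp) (l : ℕ) (r : NatExp) :
      Exec v (.query k i j a l r) s 1
        ⟨s.nat, setCell s.val k (i.eval s) (j.eval s)
          (oracle v (a.eval s) (s.goods m l (r.eval s)))⟩
  | seq {c d : Program} {s s' s'' : State} {t t' : ℕ} :
      Exec v c s t s' → Exec v d s' t' s'' → Exec v (.seq c d) s (t + t') s''
  | cond_true {b : Test} {c d : Program} {s s' : State} {t : ℕ} :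
      b.Holds s → Exec v c s t s' → Exec v (.cond b c d) s (t + 1) s'
  | cond_false {b : Test} {c d : Program} {s s' : State} {t : ℕ} :
      ¬ b.Holds s → Exec v d s t s' → Exec v (.cond b c d) s (t + 1) s'
  | loop_true {b : Test} {c : Program} {s s' s'' : State} {t t' : ℕ} :
      b.Holds s → Exec v c s t s' → Exec v (.loop b c) s' t' s'' →
        Exec v (.loop b c) s (t + t' + 1) s''
  | loop_false {b : Test} {c : Program} {s : State} :
      ¬ b.Holds s → Exec v (.loop b c) s 1 s

/-- Initial memory: the numbers `n` (of non-secretive agents) and `m` (of goods) are in the cells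
`(0, 0)` and `(0, 1)` of the natural number array `0`; everything else is zero. -/
def initial (n m : ℕ) : State where
  nat := setCell (setCell (fun _ _ _ => 0) 0 0 0 n) 0 0 1 m
  val := fun _ _ _ => 0

/-- The memory `s` holds the output `(P, π)`: cell `(g, 0)` of the natural number array `1` is the
index of the bundle which contains the good `g`, and cell `(k, a)` of the natural number array `2` is
the index of the bundle that agent `a` gets when the secretive agent takes bundle `k`. -/
def Outputs {n m : ℕ} (s : State) (P : Fin (n + 1) → Finset (Fin m))
    (π : Fin (n + 1) → Fin n → Fin (n + 1)) : Prop :=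
  (∀ (j : Fin (n + 1)) (g : Fin m), g ∈ P j ↔ s.nat 1 g 0 = j) ∧
    ∀ (k : Fin (n + 1)) (a : Fin n), s.nat 2 k a = π k a

end SecretiveMMS

/-!
An agent `a` has an estimate `M a`, an upper bound for her maximin share. A good is *big* for her
if its value is at least `M a / 19`. Given the estimates, the algorithm attempts to construct the
allocation in two stages.

The first stage builds a tree of bundles. Its root is the central bundle `n`, and its other nodes
are the bundles of the agents that are *attached*. If an unattached agent `a` finds two goods big,
one in no bundle and one in a bundle of the tree, then the former becomes her bundle, which is
made a child of the latter. If there is no such agent, then a good in no bundle that is big for an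
unattached agent is put into the central bundle. When the secretive agent takes a bundle of the
tree, each agent on the path from there to the root moves to the parent of her bundle, which also
contains a good that is big for her. These matchings are computed along the way,
`MatchInv.attach`. The stage ends when no agent is *live*, that is, no unattached agent finds an
unused good big. Counting the agents that have stopped being live shows that few goods have been
used by then, and that few of them are big for an unattached agent: this is the invariant
`CountInv`.

In the second stage, the `ρ` unattached agents distribute the remaining goods in a round robin by
marginal values. Each of them fills two bags, one for her own bundle and one for the central
bundle. So when the secretive agent takes her bundle, she moves to the central one, and otherwise
she keeps her bundle. By `RRInv.final`, the marginal values over a bag `B` of all goods that were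
distributed sum up to at most `2 * ρ * (v B + θ)`, where `θ = M a / 19` bounds the value of each
of these goods. Together with the counts of the first stage this gives the bound `3 * v B + 4 * θ`
for the maximin share, `maximinShare_le_of_marg`. Hence, if a bag is worth less than `M a / 19`,
then the maximin share is less than `7 / 19 * M a`.

The estimates are multiples of a unit `x a`, which is the value of the `(n + 1)`-st best good (or
of the empty bundle); the maximin share lies between `x a` and `(m + 1) * x a`. The first estimate
is `(m + 1) * x a`. If an attempt fails for agent `a`, then her estimate is lowered by one unit;
it remains an upper bound by `lower_estimate`. There are at most `n * (m + 1)` failures, and a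
successful attempt gives each agent at least `M a / 19`. No multiplication or division of values
is needed.

The algorithm is written in a structured language in which all loops are bounded by sums of `n`,
`m` and `1`. Its programs run in polynomial time, and they compute state transformations that are
defined by recursion on the program, `Cmd.exec`. The correctness proof is about the latter.
-/

namespace SecretiveMMS

/-! ### A structured language with bounded loops -/

/-- Overwrite a cell of an array of natural numbers. -/
def State.setN (s : State) (k i j x : ℕ) : State := ⟨setCell s.nat k i j x, s.val⟩

/-- Overwrite a cell of an array of reals. -/
noncomputable def State.setV (s : State) (k i j : ℕ) (x : ℝ) : State :=
  ⟨s.nat, setCell s.val k i j x⟩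

@[simp] lemma State.setN_nat (s : State) (k i j x k' i' j' : ℕ) :
    (s.setN k i j x).nat k' i' j' = if k' = k ∧ i' = i ∧ j' = j then x else s.nat k' i' j' := rfl

@[simp] lemma State.setN_val (s : State) (k i j x : ℕ) : (s.setN k i j x).val = s.val := rfl

@[simp] lemma State.setV_nat (s : State) (k i j : ℕ) (x : ℝ) : (s.setV k i j x).nat = s.nat := rfl

@[simp] lemma State.setV_val (s : State) (k i j : ℕ) (x : ℝ) (k' i' j' : ℕ) :
    (s.setV k i j x).val k' i' j' = if k' = k ∧ i' = i ∧ j' = j then x else s.val k' i' j' := rfl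

lemma State.setN_nat_ne (s : State) {k k' : ℕ} (i j x : ℕ) (h : k' ≠ k) :
    (s.setN k i j x).nat k' = s.nat k' := by
  funext i' j'; simp [h]

/-- Loop bounds: sums of `n`, `m` and `1`. They depend on the input only, so the number of
iterations of a loop is known when the loop is entered. -/
inductive Bnd where
  | vn
  | vm
  | one
  | add (b c : Bnd)

/-- The value of a loop bound. -/
@[simp] def Bnd.eval (n m : ℕ) : Bnd → ℕ
  | .vn => n
  | .vm => m
  | .one => 1
  | .add b c => b.eval n m + c.eval n m

/-- The expression that evaluates a loop bound, from the input cells `(0, 0)` and `(0, 1)` of the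
natural number array `0`. -/
def Bnd.exp : Bnd → NatExp
  | .vn => .get 0 (.const 0) (.const 0)
  | .vm => .get 0 (.const 0) (.const 1)
  | .one => .const 1
  | .add b c => .add b.exp c.exp

/-- A polynomial in `n + m` that bounds a loop bound. -/
noncomputable def Bnd.poly : Bnd → Polynomial ℕ
  | .vn => .X
  | .vm => .X
  | .one => 1
  | .add b c => b.poly + c.poly

lemma Bnd.eval_le (n m : ℕ) (b : Bnd) : b.eval n m ≤ b.poly.eval (n + m) := by
  induction b with
  | vn => simp [Bnd.poly]
  | vm => simp [Bnd.poly]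
  | one => simp [Bnd.poly]
  | add b c hb hc => simp only [Bnd.poly, Bnd.eval, Polynomial.eval_add]; omega

lemma Bnd.exp_eval {n m : ℕ} {s : State} (hn : s.nat 0 0 0 = n) (hm : s.nat 0 0 1 = m) (b : Bnd) :
    b.exp.eval s = b.eval n m := by
  induction b with
  | vn => simpa [Bnd.exp, NatExp.eval] using hn
  | vm => simpa [Bnd.exp, NatExp.eval] using hm
  | one => rfl
  | add b c hb hc => simp only [Bnd.exp, NatExp.eval, Bnd.eval, hb, hc]

/-- Programs all of whose loops are bounded: `iter k b c` executes `c` with the cell `(0, 0)` of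
the natural number array `k` running through `0, …, b - 1`; at the end the cell holds `b`. -/
inductive Cmd where
  | skip
  | setNat (k : ℕ) (i j : NatExp) (e : NatExp)
  | setVal (k : ℕ) (i j : NatExp) (e : ValExp)
  | query (k : ℕ) (i j : NatExp) (a : NatExp) (l : ℕ) (r : NatExp)
  | seq (c d : Cmd)
  | cond (b : Test) (c d : Cmd)
  | iter (k : ℕ) (b : Bnd) (c : Cmd)

/-- The strict inequality `e < f`. -/
def natLt (e f : NatExp) : Test := .neg (.natLe f e)

/-- The machine program of a structured program. -/
def Cmd.compile : Cmd → Program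
  | .skip => .skip
  | .setNat k i j e => .setNat k i j e
  | .setVal k i j e => .setVal k i j e
  | .query k i j a l r => .query k i j a l r
  | .seq c d => .seq c.compile d.compile
  | .cond b c d => .cond b c.compile d.compile
  | .iter k b c =>
      .seq (.setNat k (.const 0) (.const 0) (.const 0))
        (.loop (natLt (.get k (.const 0) (.const 0)) b.exp)
          (.seq c.compile (.setNat k (.const 0) (.const 0)
            (.add (.get k (.const 0) (.const 0)) (.const 1)))))

/-- The state after `f 0`, …, `f (i - 1)` have been applied in turn. -/
def loopState (f : ℕ → State → State) : ℕ → State → State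
  | 0, s => s
  | i + 1, s => f i (loopState f i s)

open Classical in
/-- The state transformation that a structured program computes. -/
noncomputable def Cmd.run {n m : ℕ} (v : Fin n → Finset (Fin m) → ℝ) : Cmd → State → State
  | .skip, s => s
  | .setNat k i j e, s => s.setN k (i.eval s) (j.eval s) (e.eval s)
  | .setVal k i j e, s => s.setV k (i.eval s) (j.eval s) (e.eval s)
  | .query k i j a l r, s =>
      s.setV k (i.eval s) (j.eval s) (oracle v (a.eval s) (s.goods m l (r.eval s)))
  | .seq c d, s => d.run v (c.run v s)
  | .cond b c d, s => if b.Holds s then c.run v s else d.run v s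
  | .iter k b c, s =>
      (loopState (fun i s' => c.run v (s'.setN k 0 0 i)) (b.eval n m) s).setN k 0 0 (b.eval n m)

/-- The natural number arrays that a program may change. -/
def Cmd.writesN : Cmd → List ℕ
  | .setNat k _ _ _ => [k]
  | .seq c d => c.writesN ++ d.writesN
  | .cond _ c d => c.writesN ++ d.writesN
  | .iter k _ c => k :: c.writesN
  | _ => []

/-- The real arrays that a program may change. -/
def Cmd.writesV : Cmd → List ℕ
  | .setVal k _ _ _ => [k]
  | .query k _ _ _ _ _ => [k]
  | .seq c d => c.writesV ++ d.writesV
  | .cond _ c d => c.writesV ++ d.writesV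
  | .iter _ _ c => c.writesV
  | _ => []

/-- The body of a loop does not change the loop counter. -/
def Cmd.wf : Cmd → Bool
  | .seq c d => c.wf && d.wf
  | .cond _ c d => c.wf && d.wf
  | .iter k _ c => !c.writesN.contains k && c.wf
  | _ => true

/-- A bound on the running time, a polynomial in `n + m`. -/
noncomputable def Cmd.time : Cmd → Polynomial ℕ
  | .seq c d => c.time + d.time
  | .cond _ c d => c.time + d.time + 1
  | .iter _ b c => b.poly * (c.time + 2) + 2
  | _ => 1

section
variable {n m : ℕ} (v : Fin n → Finset (Fin m) → ℝ)

/-- Invariant rule for the iteration of state transformations. -/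
lemma loopState_induct {f : ℕ → State → State} {s : State} (I : ℕ → State → Prop) (N : ℕ)
    (h0 : I 0 s) (hs : ∀ i < N, ∀ s', I i s' → I (i + 1) (f i s')) : I N (loopState f N s) := by
  have key : ∀ i ≤ N, I i (loopState f i s) := by
    intro i
    induction i with
    | zero => intro _; exact h0
    | succ i ih => intro hi; exact hs i hi _ (ih (by omega))
  exact key N le_rfl

/-- Invariant rule for bounded loops. -/
lemma Cmd.run_iter {k : ℕ} {b : Bnd} {c : Cmd} {s : State} {N : ℕ} (hN : b.eval n m = N)
    (I : ℕ → State → Prop) (Q : State → Prop) (h0 : I 0 s)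
    (hs : ∀ i < N, ∀ s', I i s' → I (i + 1) (c.run v (s'.setN k 0 0 i)))
    (hQ : ∀ s', I N s' → Q (s'.setN k 0 0 N)) : Q ((Cmd.iter k b c).run v s) := by
  simp only [Cmd.run, hN]
  exact hQ _ (loopState_induct I N h0 hs)

lemma Cmd.run_nat (c : Cmd) (s : State) {k : ℕ} (h : c.writesN.contains k = false) :
    (c.run v s).nat k = s.nat k := by
  induction c generalizing s with
  | skip => rfl
  | setNat k' i j e =>
    simp only [Cmd.writesN, List.contains_cons, List.contains_nil, Bool.or_false,
      beq_eq_false_iff_ne] at h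
    exact State.setN_nat_ne s _ _ _ h
  | setVal k' i j e => rfl
  | query k' i j a l r => rfl
  | seq c d hc hd =>
    simp only [Cmd.writesN, List.contains_eq_mem, List.mem_append, decide_eq_false_iff_not,
      not_or] at h hc hd
    rw [Cmd.run, hd _ h.2, hc _ h.1]
  | cond b c d hc hd =>
    simp only [Cmd.writesN, List.contains_eq_mem, List.mem_append, decide_eq_false_iff_not,
      not_or] at h hc hd
    rw [Cmd.run]
    split_ifs
    · exact hc _ h.1
    · exact hd _ h.2
  | iter k' b c hc =>
    simp only [Cmd.writesN, List.contains_eq_mem, List.mem_cons, decide_eq_false_iff_not,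
      not_or] at h hc
    refine Cmd.run_iter v rfl (fun _ s' => s'.nat k = s.nat k) (fun s' => s'.nat k = s.nat k)
      rfl ?_ ?_
    · intro i _ s' hs'
      rw [hc _ h.2, State.setN_nat_ne _ _ _ _ h.1, hs']
    · intro s' hs'
      rw [State.setN_nat_ne _ _ _ _ h.1, hs']

lemma Cmd.run_val (c : Cmd) (s : State) {k : ℕ} (h : c.writesV.contains k = false) :
    (c.run v s).val k = s.val k := by
  induction c generalizing s with
  | skip => rfl
  | setNat k' i j e => rfl
  | setVal k' i j e =>
    simp only [Cmd.writesV, List.contains_cons, List.contains_nil, Bool.or_false,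
      beq_eq_false_iff_ne] at h
    funext i' j'
    simp [Cmd.run, h]
  | query k' i j a l r =>
    simp only [Cmd.writesV, List.contains_cons, List.contains_nil, Bool.or_false,
      beq_eq_false_iff_ne] at h
    funext i' j'
    simp [Cmd.run, h]
  | seq c d hc hd =>
    simp only [Cmd.writesV, List.contains_eq_mem, List.mem_append, decide_eq_false_iff_not,
      not_or] at h hc hd
    rw [Cmd.run, hd _ h.2, hc _ h.1]
  | cond b c d hc hd =>
    simp only [Cmd.writesV, List.contains_eq_mem, List.mem_append, decide_eq_false_iff_not,
      not_or] at h hc hd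
    rw [Cmd.run]
    split_ifs
    · exact hc _ h.1
    · exact hd _ h.2
  | iter k' b c hc =>
    simp only [Cmd.writesV] at h hc
    refine Cmd.run_iter v rfl (fun _ s' => s'.val k = s.val k) (fun s' => s'.val k = s.val k)
      rfl ?_ ?_
    · intro i _ s' hs'
      rw [hc _ h, State.setN_val, hs']
    · intro s' hs'
      rw [State.setN_val, hs']

/-- A structured program that leaves the input alone runs in polynomial time and computes the
state transformation `Cmd.run`. -/
theorem Cmd.exec (c : Cmd) (hwf : c.wf = true) (h0 : c.writesN.contains 0 = false) (s : State)
    (hn : s.nat 0 0 0 = n) (hm : s.nat 0 0 1 = m) :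
    ∃ t ≤ c.time.eval (n + m), Exec v c.compile s t (c.run v s) := by
  induction c generalizing s with
  | skip => exact ⟨1, by simp [Cmd.time], .skip s⟩
  | setNat k i j e => exact ⟨1, by simp [Cmd.time], .setNat s k i j e⟩
  | setVal k i j e => exact ⟨1, by simp [Cmd.time], .setVal s k i j e⟩
  | query k i j a l r => exact ⟨1, by simp [Cmd.time], .query s k i j a l r⟩
  | seq c d hc hd =>
    simp only [Cmd.wf, Bool.and_eq_true] at hwf
    simp only [Cmd.writesN, List.contains_eq_mem, List.mem_append, decide_eq_false_iff_not,
      not_or] at h0 hc hd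
    have hz : (c.run v s).nat 0 = s.nat 0 := Cmd.run_nat v c s (by simpa using h0.1)
    obtain ⟨t, ht, h⟩ := hc hwf.1 h0.1 s hn hm
    obtain ⟨t', ht', h'⟩ := hd hwf.2 h0.2 (c.run v s) (by rw [hz, hn]) (by rw [hz, hm])
    refine ⟨t + t', ?_, .seq h h'⟩
    simp only [Cmd.time, Polynomial.eval_add]
    omega
  | cond b c d hc hd =>
    simp only [Cmd.wf, Bool.and_eq_true] at hwf
    simp only [Cmd.writesN, List.contains_eq_mem, List.mem_append, decide_eq_false_iff_not,
      not_or] at h0 hc hd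
    obtain ⟨t, ht, h⟩ := hc hwf.1 h0.1 s hn hm
    obtain ⟨t', ht', h'⟩ := hd hwf.2 h0.2 s hn hm
    simp only [Cmd.time, Cmd.run, Polynomial.eval_add, Polynomial.eval_one]
    split_ifs with hb
    · exact ⟨t + 1, by omega, .cond_true hb h⟩
    · exact ⟨t' + 1, by omega, .cond_false hb h'⟩
  | iter k b c hc =>
    simp only [Cmd.wf, Bool.and_eq_true, Bool.not_eq_true'] at hwf
    simp only [Cmd.writesN, List.contains_eq_mem, List.mem_cons, decide_eq_false_iff_not,
      not_or] at h0 hc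
    set f : ℕ → State → State := fun i s' => c.run v (s'.setN k 0 0 i) with hf
    set T := c.time.eval (n + m)
    have hz : ∀ i, (loopState f i s).nat 0 = s.nat 0 := by
      intro i
      refine loopState_induct (fun _ s' => s'.nat 0 = s.nat 0) i rfl ?_
      intro j _ s' hs'
      rw [hf]
      simp only
      rw [Cmd.run_nat v c _ (by simpa using h0.2), State.setN_nat_ne _ _ _ _ h0.1, hs']
    have hb : ∀ i j : ℕ, b.exp.eval ((loopState f i s).setN k 0 0 j) = b.eval n m := by
      intro i j
      refine Bnd.exp_eval ?_ ?_ b <;> rw [State.setN_nat_ne _ _ _ _ h0.1, hz] <;> assumption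
    -- the machine loop, entered when `r` of its iterations are left
    have key : ∀ r i : ℕ, i + r = b.eval n m →
        ∃ t ≤ r * (T + 2) + 1, Exec v (.loop (natLt (.get k (.const 0) (.const 0)) b.exp)
          (.seq c.compile (.setNat k (.const 0) (.const 0)
            (.add (.get k (.const 0) (.const 0)) (.const 1))))) ((loopState f i s).setN k 0 0 i) t
          ((Cmd.iter k b c).run v s) := by
      intro r
      induction r with
      | zero =>
        intro i hi
        have hi' : i = b.eval n m := by omega
        refine ⟨1, by omega, ?_⟩
        simp only [Cmd.run]
        rw [← hi']
        refine .loop_false ?_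
        simp [natLt, Test.Holds, hb, NatExp.eval, hi']
      | succ r ih =>
        intro i hi
        obtain ⟨t', ht', h'⟩ := ih (i + 1) (by omega)
        obtain ⟨t, ht, h⟩ := hc hwf.2 h0.2 ((loopState f i s).setN k 0 0 i)
          (by rw [State.setN_nat_ne _ _ _ _ h0.1, hz, hn])
          (by rw [State.setN_nat_ne _ _ _ _ h0.1, hz, hm])
        refine ⟨t + 1 + t' + 1, ?_, ?_⟩
        · have : t ≤ T := ht
          rw [Nat.succ_mul]
          omega
        · refine .loop_true ?_ (.seq h (.setNat _ _ _ _ _)) ?_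
          · simp only [natLt, Test.Holds, hb, NatExp.eval, State.setN_nat, and_self, if_true]
            omega
          · have hk : (c.run v ((loopState f i s).setN k 0 0 i)).nat k 0 0 = i := by
              rw [Cmd.run_nat v c _ hwf.1]
              simp
            simp only [NatExp.eval, hk]
            exact h'
    obtain ⟨t, ht, h⟩ := key (b.eval n m) 0 (by omega)
    refine ⟨1 + t, ?_, .seq (.setNat _ _ _ _ _) h⟩
    have := Bnd.eval_le n m b
    have h2 : b.eval n m * (T + 2) ≤ b.poly.eval (n + m) * (T + 2) := Nat.mul_le_mul_right _ this
    simp only [Cmd.time, Polynomial.eval_add, Polynomial.eval_mul, Polynomial.eval_ofNat]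
    change _ ≤ b.poly.eval (n + m) * (T + 2) + 2
    omega

end

/-! ### Maximin shares of submodular valuations -/

section Valuations
variable {n m : ℕ} {v : Finset (Fin m) → ℝ}

/-- The marginal value of the good `g` over the bundle `B`. -/
def marg (v : Finset (Fin m) → ℝ) (g : Fin m) (B : Finset (Fin m)) : ℝ := v (insert g B) - v B

lemma marg_nonneg (hmono : Monotone v) (g : Fin m) (B : Finset (Fin m)) : 0 ≤ marg v g B :=
  sub_nonneg.2 (hmono (Finset.subset_insert g B))

lemma marg_self {g : Fin m} {B : Finset (Fin m)} (h : g ∈ B) : marg v g B = 0 := by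
  simp [marg, Finset.insert_eq_of_mem h]

lemma marg_anti (hmono : Monotone v) (hsub : IsSubmodular v) (g : Fin m)
    {B B' : Finset (Fin m)} (h : B ⊆ B') : marg v g B' ≤ marg v g B := by
  by_cases hg : g ∈ B'
  · rw [marg_self hg]
    exact marg_nonneg hmono g B
  · have h1 := hsub (insert g B) B'
    have h2 : insert g B ∪ B' = insert g B' := by
      rw [Finset.insert_union, Finset.union_eq_right.2 h]
    have h3 : insert g B ∩ B' = B := by
      rw [Finset.insert_inter_of_notMem hg, Finset.inter_eq_left.2 h]
    rw [h2, h3] at h1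
    simp only [marg]
    linarith

lemma marg_le_singleton (hnn : ∀ S, 0 ≤ v S) (hmono : Monotone v) (hsub : IsSubmodular v)
    (g : Fin m) (B : Finset (Fin m)) : marg v g B ≤ v {g} := by
  have h1 := marg_anti hmono hsub g (Finset.empty_subset B)
  have h2 := hnn ∅
  simp only [marg, insert_empty_eq] at *
  linarith

lemma union_sub_le_sum_marg (hmono : Monotone v) (hsub : IsSubmodular v)
    (S B : Finset (Fin m)) : v (S ∪ B) - v B ≤ ∑ g ∈ S, marg v g B := by
  induction S using Finset.induction_on with
  | empty => simp
  | insert g S hg ih =>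
    rw [Finset.sum_insert hg, Finset.insert_union]
    have := marg_anti hmono hsub g (Finset.subset_union_right : B ⊆ S ∪ B)
    simp only [marg] at *
    linarith

lemma maximinShare_le {N : ℕ} (hN : 0 < N) {c : ℝ}
    (h : ∀ P : Fin N → Finset (Fin m), IsPartition P → ∃ j, v (P j) ≤ c) :
    maximinShare N v ≤ c := by
  have : Nonempty {P : Fin N → Finset (Fin m) // IsPartition P} := by
    refine ⟨⟨fun j => if j = ⟨0, hN⟩ then Finset.univ else ∅, ?_, ?_⟩⟩
    · intro i j hij
      by_cases hi : i = ⟨0, hN⟩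
      · have : j ≠ ⟨0, hN⟩ := fun hj => hij (hi.trans hj.symm)
        simp [this]
      · simp [hi]
    · intro g
      exact ⟨⟨0, hN⟩, by simp⟩
  refine ciSup_le fun P => ?_
  obtain ⟨j, hj⟩ := h P.1 P.2
  exact (ciInf_le (Set.finite_range _).bddBelow j).trans hj

lemma le_maximinShare {N : ℕ} (hN : 0 < N) {c : ℝ} {P : Fin N → Finset (Fin m)}
    (hP : IsPartition P) (h : ∀ j, c ≤ v (P j)) : c ≤ maximinShare N v := by
  have : Nonempty (Fin N) := ⟨⟨0, hN⟩⟩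
  exact le_ciSup_of_le (Set.finite_range _).bddAbove ⟨P, hP⟩ (le_ciInf h)

/-- The estimate behind the round robin. `U` is the set of goods handed out beforehand, `B` a bag
filled from the remaining goods. Few bundles of a partition meet the goods of value at least `θ`;
the others keep most of their value outside `U`, and if `B` were worth little, then their marginal
values over `B` would exceed the bound `h3`. -/
lemma maximinShare_le_of_marg (hnn : ∀ S, 0 ≤ v S) (hmono : Monotone v) (hsub : IsSubmodular v)
    {θ : ℝ} {U B : Finset (Fin m)} (hsmall : ∀ g ∉ U, v {g} < θ) {ρ : ℕ} (hρ : 0 < ρ)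
    (h1 : (U.filter fun g => θ ≤ v {g}).card + ρ ≤ n + 1)
    (h2 : U.card + (U.filter fun g => θ ≤ v {g}).card ≤ 2 * n + 2)
    (h3 : ∑ g ∈ Uᶜ, marg v g B ≤ 2 * ρ * (v B + θ)) (hθ : 0 ≤ θ) :
    maximinShare (n + 1) v ≤ 3 * v B + 4 * θ := by
  refine maximinShare_le n.succ_pos fun P hP => ?_
  by_contra! hlt
  set big := U.filter fun g => θ ≤ v {g} with hbig
  set J : Finset (Fin (n + 1)) := Finset.univ.filter fun j => ∀ g ∈ P j, v {g} < θ with hJ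
  -- distinct bundles outside `J` contain distinct goods of value at least `θ`
  have hJc : Jᶜ.card ≤ big.card := by
    -- the summand `Unit` provides a default value, as there may be no goods
    have hex : ∀ j : Fin (n + 1), ∃ g : Fin m ⊕ Unit, j ∈ Jᶜ →
        ∃ g', g = Sum.inl g' ∧ g' ∈ P j ∧ g' ∈ big := by
      intro j
      by_cases hj : j ∈ Jᶜ
      · simp only [hJ, Finset.mem_compl, Finset.mem_filter, Finset.mem_univ, true_and, not_forall,
          not_lt] at hj
        obtain ⟨g, hg, hg'⟩ := hj
        refine ⟨Sum.inl g, fun _ => ⟨g, rfl, hg, ?_⟩⟩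
        rw [hbig, Finset.mem_filter]
        refine ⟨?_, hg'⟩
        by_contra hU
        exact absurd (hsmall g hU) (not_lt.2 hg')
      · exact ⟨Sum.inr (), fun h => absurd h hj⟩
    choose f hf using hex
    have : Jᶜ.card ≤ (big.map ⟨Sum.inl, Sum.inl_injective⟩ : Finset (Fin m ⊕ Unit)).card := by
      refine Finset.card_le_card_of_injOn f ?_ ?_
      · intro j hj
        obtain ⟨g', h, -, hg'⟩ := hf j hj
        simp only [Finset.coe_map, Function.Embedding.coeFn_mk, Set.mem_image, Finset.mem_coe]
        exact ⟨g', hg', h.symm⟩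
      · intro i hi j hj hij
        obtain ⟨g, hg, hgi, -⟩ := hf i hi
        obtain ⟨g', hg', hgj, -⟩ := hf j hj
        rw [hg, hg'] at hij
        obtain rfl := Sum.inl_injective hij
        by_contra hne
        exact Finset.disjoint_left.1 (hP.disjoint i j hne) hgi hgj
    simpa using this
  have hJn : n + 1 ≤ J.card + big.card := by
    have := Finset.card_add_card_compl J
    rw [Fintype.card_fin] at this
    omega
  have hdisj : ∀ F : Fin (n + 1) → Finset (Fin m), (∀ j, F j ⊆ P j) →
      Set.PairwiseDisjoint (↑J) F := by
    intro F hF i _ j _ hij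
    exact Finset.disjoint_of_subset_left (hF i)
      (Finset.disjoint_of_subset_right (hF j) (hP.disjoint i j hij))
  -- hence the bundles in `J` contain at most two goods of `U` on average
  have hcard : ∑ j ∈ J, (P j ∩ U).card + big.card ≤ U.card := by
    rw [← Finset.card_biUnion (fun i hi j hj hij =>
      hdisj (fun j => P j ∩ U) (fun j => Finset.inter_subset_left) hi hj hij)]
    rw [← Finset.card_union_of_disjoint]
    · refine Finset.card_le_card (Finset.union_subset ?_ (Finset.filter_subset _ _))
      exact Finset.biUnion_subset.2 fun j _ => Finset.inter_subset_right
    · rw [Finset.disjoint_left]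
      intro g hg hg'
      obtain ⟨j, hj, hgj⟩ := Finset.mem_biUnion.1 hg
      exact absurd ((Finset.mem_filter.1 hj).2 g (Finset.mem_inter.1 hgj).1)
        (not_lt.2 (Finset.mem_filter.1 hg').2)
  -- comparing upper and lower bounds for the total marginal value over `B` of the rest of `J`
  have hmarg : ∑ j ∈ J, ∑ g ∈ P j \ U, marg v g B ≤ 2 * ρ * (v B + θ) := by
    rw [← Finset.sum_biUnion (hdisj (fun j => P j \ U) (fun j => Finset.sdiff_subset))]
    refine le_trans (Finset.sum_le_sum_of_subset_of_nonneg ?_ ?_) h3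
    · refine Finset.biUnion_subset.2 fun j _ g hg => ?_
      simpa using (Finset.mem_sdiff.1 hg).2
    · intro g _ _
      exact marg_nonneg hmono g B
  have hone : ∀ j ∈ J, 2 * v B + 4 * θ - (P j ∩ U).card * θ < ∑ g ∈ P j \ U, marg v g B := by
    intro j hj
    have e1 := union_sub_le_sum_marg hmono hsub (P j \ U) B
    have e2 := union_sub_le_sum_marg hmono hsub (P j ∩ U) (P j \ U)
    have e3 : ∑ g ∈ P j ∩ U, marg v g (P j \ U) ≤ (P j ∩ U).card * θ := by
      rw [← nsmul_eq_mul]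
      refine Finset.sum_le_card_nsmul _ _ _ fun g hg => ?_
      exact (marg_le_singleton hnn hmono hsub g _).trans
        ((Finset.mem_filter.1 hj).2 g (Finset.mem_inter.1 hg).1).le
    have e4 : P j ∩ U ∪ P j \ U = P j := by
      rw [Finset.union_comm, Finset.sdiff_union_inter]
    rw [e4] at e2
    have e5 : v (P j \ U) ≤ v (P j \ U ∪ B) := hmono Finset.subset_union_left
    have e6 := hlt j
    linarith
  have hJpos : 0 < J.card := by omega
  have hsum := (Finset.sum_lt_sum_of_nonempty (Finset.card_pos.1 hJpos) hone).trans_le hmarg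
  rw [Finset.sum_sub_distrib, ← Finset.sum_mul, Finset.sum_const, nsmul_eq_mul] at hsum
  have c1 : ((∑ j ∈ J, (P j ∩ U).card : ℕ) : ℝ) ≤ 2 * J.card := by
    have : ∑ j ∈ J, (P j ∩ U).card ≤ 2 * J.card := by omega
    exact_mod_cast this
  have c2 : (ρ : ℝ) ≤ J.card := by
    have : ρ ≤ J.card := by omega
    exact_mod_cast this
  push_cast at c1
  have hB := hnn B
  have d1 := mul_le_mul_of_nonneg_right c1 hθ
  have d2 := mul_le_mul_of_nonneg_right c2 (add_nonneg hB hθ)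
  nlinarith

open Classical in
/-- If `n + 1` goods are worth `x` each, then so is the maximin share. -/
lemma le_maximinShare_of_card (hmono : Monotone v) {x : ℝ}
    (h : n + 1 ≤ (Finset.univ.filter fun g : Fin m => x ≤ v {g}).card) :
    x ≤ maximinShare (n + 1) v := by
  obtain ⟨S, hS, hSc⟩ := Finset.exists_subset_card_eq h
  let e : Fin (n + 1) ≃ S := (S.equivFinOfCardEq hSc).symm
  let f : Fin m → Fin (n + 1) := fun g => if hg : g ∈ S then e.symm ⟨g, hg⟩ else 0
  refine le_maximinShare (P := fun j => Finset.univ.filter fun g => f g = j) n.succ_pos ⟨?_, ?_⟩ ?_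
  · intro i j hij
    rw [Finset.disjoint_left]
    intro g hg hg'
    exact hij ((Finset.mem_filter.1 hg).2.symm.trans (Finset.mem_filter.1 hg').2)
  · exact fun g => ⟨f g, by simp⟩
  · intro j
    have h1 : x ≤ v {(e j : Fin m)} := (Finset.mem_filter.1 (hS (e j).2)).2
    refine h1.trans (hmono ?_)
    rw [Finset.singleton_subset_iff, Finset.mem_filter]
    exact ⟨Finset.mem_univ _, by simp [f]⟩

/-- If `x` is at least the value of every good that has `n + 1` goods above it, then the goods of
value greater than `x` do not reach every bundle of a partition. -/
lemma maximinShare_le_mul (hmono : Monotone v) (hsub : IsSubmodular v) {x : ℝ} (hx : v ∅ ≤ x)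
    (hx0 : 0 ≤ x) (hnn : ∀ S, 0 ≤ v S)
    (h : ∀ g : Fin m, n + 1 ≤ (Finset.univ.filter fun g' : Fin m => v {g} ≤ v {g'}).card →
      v {g} ≤ x) :
    maximinShare (n + 1) v ≤ (m + 1) * x := by
  refine maximinShare_le n.succ_pos fun P hP => ?_
  by_contra! hlt
  have hex : ∀ j, ∃ g ∈ P j, x < v {g} := by
    intro j
    by_contra! hall
    have h1 := union_sub_le_sum_marg hmono hsub (P j) ∅
    rw [Finset.union_empty] at h1
    have h2 : ∑ g ∈ P j, marg v g ∅ ≤ (P j).card * x := by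
      rw [← nsmul_eq_mul]
      exact Finset.sum_le_card_nsmul _ _ _ fun g hg =>
        (marg_le_singleton hnn hmono hsub g _).trans (hall g hg)
    have h3 : ((P j).card : ℝ) ≤ m := by
      exact_mod_cast (Finset.card_le_univ (P j)).trans_eq (Fintype.card_fin m)
    have h4 := mul_le_mul_of_nonneg_right h3 hx0
    have h5 := hlt j
    linarith
  choose f hf hfx using hex
  have hinj : Function.Injective f := by
    intro i j hij
    by_contra hne
    exact Finset.disjoint_left.1 (hP.disjoint i j hne) (hf i) (hij ▸ hf j)
  obtain ⟨j, -, hj⟩ := Finset.exists_min_image (Finset.univ : Finset (Fin (n + 1)))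
    (fun j => v {f j}) Finset.univ_nonempty
  refine absurd (h (f j) ?_) (not_le.2 (hfx j))
  calc n + 1 = (Finset.univ.image f).card := by
        rw [Finset.card_image_of_injective _ hinj, Finset.card_univ, Fintype.card_fin]
    _ ≤ _ := by
        refine Finset.card_le_card fun g hg => ?_
        obtain ⟨i, -, rfl⟩ := Finset.mem_image.1 hg
        simpa using hj i (Finset.mem_univ i)

end Valuations

/-! ### Handing out big goods -/

section BigGoods
variable {n m : ℕ}

open Classical in
/-- The goods that have been put into a bundle; `n + 1` marks a good that has not. -/
noncomputable def usedGoods (n m : ℕ) (bun : ℕ → ℕ) : Finset (Fin m) :=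
  Finset.univ.filter fun g => bun g ≠ n + 1

open Classical in
/-- The goods in bundles that are big for agent `a`. -/
noncomputable def usedBig (n m : ℕ) (bun : ℕ → ℕ) (big : ℕ → ℕ → Prop) (a : ℕ) :
    Finset (Fin m) :=
  Finset.univ.filter fun g => bun g ≠ n + 1 ∧ big a g

open Classical in
/-- The agents that have been attached to the tree of bundles. -/
noncomputable def attached (n : ℕ) (att : ℕ → ℕ) : Finset (Fin n) :=
  Finset.univ.filter fun a => att a ≠ 0

/-- An agent is live if she is not attached and some good not yet in a bundle is big for her. -/
def Live (n m : ℕ) (bun att : ℕ → ℕ) (big : ℕ → ℕ → Prop) (a : ℕ) : Prop :=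
  att a = 0 ∧ ∃ g : Fin m, bun g = n + 1 ∧ big a g

open Classical in
/-- The agents that are not live. -/
noncomputable def dead (n m : ℕ) (bun att : ℕ → ℕ) (big : ℕ → ℕ → Prop) : Finset (Fin n) :=
  Finset.univ.filter fun a => ¬ Live n m bun att big a

/-- Agent `a` can be attached: she finds both `g`, which is in no bundle, and `h`, which is in a
bundle, big. -/
def Attachable (n : ℕ) (bun att : ℕ → ℕ) (big : ℕ → ℕ → Prop) (a g h : ℕ) : Prop :=
  att a = 0 ∧ bun g = n + 1 ∧ bun h ≠ n + 1 ∧ big a g ∧ big a h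

/-- No agent can be attached. -/
def Closed (n m : ℕ) (bun att : ℕ → ℕ) (big : ℕ → ℕ → Prop) : Prop :=
  ∀ (a : Fin n) (g h : Fin m), ¬ Attachable n bun att big a g h

/-- The number of goods in bundles is controlled by the number of agents that are not live, and an
unattached agent finds only few of them big. The sharper bounds for the closed state make
up for the next good that is put into the central bundle. -/
structure CountInv (n m : ℕ) (bun att : ℕ → ℕ) (big : ℕ → ℕ → Prop) : Prop where
  used : (usedGoods n m bun).card ≤ 2 * (dead n m bun att big).card + 1
  used_closed : Closed n m bun att big →
    (usedGoods n m bun).card ≤ 2 * (dead n m bun att big).card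
  few_big : ∀ a : Fin n, att a = 0 → (usedBig n m bun big a).Nonempty →
    (usedGoods n m bun).card + (usedBig n m bun big a).card ≤
      2 * (dead n m bun att big).card + 3
  few_big_closed : Closed n m bun att big → ∀ a : Fin n, att a = 0 →
    (usedBig n m bun big a).Nonempty →
    (usedGoods n m bun).card + (usedBig n m bun big a).card ≤
      2 * (dead n m bun att big).card + 2
  few_big_attached : ∀ a : Fin n, att a = 0 →
    (usedBig n m bun big a).card ≤ (attached n att).card + 1

variable {bun att : ℕ → ℕ} {big : ℕ → ℕ → Prop}

lemma CountInv.init (h1 : ∀ g < m, bun g = n + 1) : CountInv n m bun att big := by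
  have hU : usedGoods n m bun = ∅ := by
    simp only [usedGoods, Finset.filter_eq_empty_iff]
    intro g _
    simp [h1 g g.2]
  have hB : ∀ a, usedBig n m bun big a = ∅ := by
    intro a
    simp only [usedBig, Finset.filter_eq_empty_iff]
    intro g _
    simp [h1 g g.2]
  constructor <;> simp [hU, hB]

lemma usedGoods_update {g : Fin m} {k : ℕ} (hk : k ≠ n + 1) :
    usedGoods n m (Function.update bun g k) = insert g (usedGoods n m bun) := by
  ext x
  simp only [usedGoods, Finset.mem_filter, Finset.mem_univ, true_and, Finset.mem_insert]
  by_cases hx : x = g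
  · simp [hx, hk]
  · rw [Function.update_of_ne (fun h => hx (Fin.ext h))]
    simp [hx]

lemma card_usedGoods_update {g : Fin m} (hg : bun g = n + 1) {k : ℕ} (hk : k ≠ n + 1) :
    (usedGoods n m (Function.update bun g k)).card = (usedGoods n m bun).card + 1 := by
  rw [usedGoods_update hk, Finset.card_insert_of_notMem]
  simp [usedGoods, hg]

lemma card_usedBig_update {g : Fin m} (hg : bun g = n + 1) {k : ℕ} (hk : k ≠ n + 1) {a : ℕ}
    (hb : big a g) :
    (usedBig n m (Function.update bun g k) big a).card = (usedBig n m bun big a).card + 1 := by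
  have : usedBig n m (Function.update bun g k) big a = insert g (usedBig n m bun big a) := by
    ext x
    simp only [usedBig, Finset.mem_filter, Finset.mem_univ, true_and, Finset.mem_insert]
    by_cases hx : x = g
    · simp [hx, hk, hb]
    · rw [Function.update_of_ne (fun h => hx (Fin.ext h))]
      simp [hx]
  rw [this, Finset.card_insert_of_notMem]
  simp [usedBig, hg]

lemma usedBig_update_of_not {g : Fin m} {k : ℕ} {a : ℕ} (hb : ¬ big a g) :
    usedBig n m (Function.update bun g k) big a = usedBig n m bun big a := by
  ext x
  simp only [usedBig, Finset.mem_filter, Finset.mem_univ, true_and]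
  by_cases hx : x = g
  · simp [hx, hb]
  · rw [Function.update_of_ne (fun h => hx (Fin.ext h))]

/-- In the closed state, an unattached agent with a big good in a bundle finds no good
outside the bundles big. -/
lemma Closed.not_big (hc : Closed n m bun att big) {a : Fin n} (ha : att a = 0)
    (hne : (usedBig n m bun big a).Nonempty) {g : Fin m} (hg : bun g = n + 1) : ¬ big a g := by
  intro hb
  obtain ⟨h, hh⟩ := hne
  simp only [usedBig, Finset.mem_filter] at hh
  exact hc a g h ⟨ha, hg, hh.2.1, hb, hh.2.2⟩

lemma Closed.not_live (hc : Closed n m bun att big) {a : Fin n}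
    (hne : (usedBig n m bun big a).Nonempty) : ¬ Live n m bun att big a :=
  fun ⟨ha, _, hg, hb⟩ => hc.not_big ha hne hg hb

lemma Live.of_update {g : Fin m} {k : ℕ} (hk : k ≠ n + 1) {a b : ℕ} {x : ℕ} (hx : x ≠ 0)
    (h : Live n m (Function.update bun g k) (Function.update att a x) big b) :
    Live n m bun att big b ∧ b ≠ a := by
  obtain ⟨h1, g', h2, h3⟩ := h
  have hb : b ≠ a := by
    rintro rfl
    simp [hx] at h1
  rw [Function.update_of_ne hb] at h1
  refine ⟨⟨h1, g', ?_, h3⟩, hb⟩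
  by_cases hg : (g' : ℕ) = g
  · simp [hg, hk] at h2
  · rwa [Function.update_of_ne hg] at h2

/-- Attaching an agent preserves the counting invariant: one more good is in a bundle, and the agent
is no longer live. If the new state is closed, every other live agent that finds the good big stops
being live as well. -/
lemma CountInv.attach (hI : CountInv n m bun att big) {a : Fin n} {g h : Fin m}
    (hat : Attachable n bun att big a g h) {k : ℕ} (hk : k ≠ n + 1) :
    CountInv n m (Function.update bun g k) (Function.update att a 1) big := by
  obtain ⟨ha, hg, hh, hbg, hbh⟩ := hat
  set bun' := Function.update bun g k with hbun
  set att' := Function.update att a 1 with hatt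
  have hU := card_usedGoods_update (bun := bun) hg hk
  rw [← hbun] at hU
  have hlive : Live n m bun att big a := ⟨ha, g, hg, hbg⟩
  have hsub : insert a (dead n m bun att big) ⊆ dead n m bun' att' big := by
    intro b hb
    simp only [dead, Finset.mem_filter, Finset.mem_univ, true_and]
    intro hl
    obtain ⟨hl1, hl2⟩ := hl.of_update hk one_ne_zero
    rcases Finset.mem_insert.1 hb with rfl | hb
    · exact hl2 rfl
    · simp only [dead, Finset.mem_filter] at hb
      exact hb.2 hl1
  have had : a ∉ dead n m bun att big := by simp [dead, hlive]
  have hd : (dead n m bun att big).card + 1 ≤ (dead n m bun' att' big).card := by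
    rw [← Finset.card_insert_of_notMem had]
    exact Finset.card_le_card hsub
  -- a second agent that stops being live pays for a further good
  have hd2 : ∀ b : Fin n, b ≠ a → Live n m bun att big b → ¬ Live n m bun' att' big b →
      (dead n m bun att big).card + 2 ≤ (dead n m bun' att' big).card := by
    intro b hb h1 h2
    have hbd : b ∉ insert a (dead n m bun att big) := by simp [dead, h1, hb]
    calc _ = (insert b (insert a (dead n m bun att big))).card := by
          rw [Finset.card_insert_of_notMem hbd, Finset.card_insert_of_notMem had]
      _ ≤ _ := by
          refine Finset.card_le_card (Finset.insert_subset ?_ hsub)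
          simpa [dead] using h2
  have hX : (attached n att').card = (attached n att).card + 1 := by
    have : attached n att' = insert a (attached n att) := by
      ext b
      simp only [attached, Finset.mem_filter, Finset.mem_univ, true_and,
        Finset.mem_insert, hatt]
      by_cases hb : b = a
      · simp [hb]
      · rw [Function.update_of_ne (fun h => hb (Fin.ext h))]
        simp [hb]
    rw [this, Finset.card_insert_of_notMem]
    simp [attached, ha]
  have hne : ∀ b : Fin n, att' b = 0 → b ≠ a ∧ att b = 0 := by
    intro b hb
    have hba : b ≠ a := by
      rintro rfl
      simp [hatt] at hb
    rw [hatt, Function.update_of_ne (fun h => hba (Fin.ext h))] at hb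
    exact ⟨hba, hb⟩
  have hb1 : ∀ b : Fin n, big b g →
      (usedBig n m bun' big b).card = (usedBig n m bun big b).card + 1 :=
    fun b hb => card_usedBig_update hg hk hb
  have hb2 : ∀ b : Fin n, ¬ big b g → usedBig n m bun' big b = usedBig n m bun big b :=
    fun b hb => usedBig_update_of_not hb
  have h0 := hI.used
  refine ⟨by omega, fun _ => by omega, fun b hb hbn => ?_, fun hc b hb hbn => ?_, fun b hb => ?_⟩
  · obtain ⟨hba, hb0⟩ := hne b hb
    by_cases hbig : big b g
    · rw [hb1 b hbig]
      rcases (usedBig n m bun big b).eq_empty_or_nonempty with he | he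
      · rw [he, Finset.card_empty]
        omega
      · have := hI.few_big b hb0 he
        omega
    · rw [hb2 b hbig] at hbn ⊢
      have := hI.few_big b hb0 hbn
      omega
  · obtain ⟨hba, hb0⟩ := hne b hb
    by_cases hbig : big b g
    · have h2 := hd2 b hba ⟨hb0, g, hg, hbig⟩ (hc.not_live hbn)
      rw [hb1 b hbig]
      rcases (usedBig n m bun big b).eq_empty_or_nonempty with he | he
      · rw [he, Finset.card_empty]
        omega
      · have := hI.few_big b hb0 he
        omega
    · rw [hb2 b hbig] at hbn ⊢
      have := hI.few_big b hb0 hbn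
      omega
  · obtain ⟨hba, hb0⟩ := hne b hb
    have := hI.few_big_attached b hb0
    by_cases hbig : big b g
    · rw [hb1 b hbig]
      omega
    · rw [hb2 b hbig]
      omega

/-- In the closed state, putting a good into the central bundle preserves the counting
invariant: if the new state is closed, then the agent that finds the good big is no longer live. -/
lemma CountInv.center (hI : CountInv n m bun att big) (hcl : Closed n m bun att big) {a : Fin n}
    {g : Fin m} (ha : att a = 0) (hg : bun g = n + 1) (hbg : big a g) {k : ℕ} (hk : k ≠ n + 1) :
    CountInv n m (Function.update bun g k) att big := by
  set bun' := Function.update bun g k with hbun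
  have hU := card_usedGoods_update (bun := bun) hg hk
  rw [← hbun] at hU
  have hlive : Live n m bun att big a := ⟨ha, g, hg, hbg⟩
  have hsub : dead n m bun att big ⊆ dead n m bun' att big := by
    intro b hb
    simp only [dead, Finset.mem_filter, Finset.mem_univ, true_and] at hb ⊢
    rintro ⟨h1, g', h2, h3⟩
    refine hb ⟨h1, g', ?_, h3⟩
    by_cases hg' : (g' : ℕ) = g
    · simp [hbun, hg', hk] at h2
    · rwa [hbun, Function.update_of_ne hg'] at h2
  have hd := Finset.card_le_card hsub
  have hb1 : ∀ b : Fin n, big b g →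
      (usedBig n m bun' big b).card = (usedBig n m bun big b).card + 1 :=
    fun b hb => card_usedBig_update hg hk hb
  have hb2 : ∀ b : Fin n, ¬ big b g → usedBig n m bun' big b = usedBig n m bun big b :=
    fun b hb => usedBig_update_of_not hb
  have hd' : Closed n m bun' att big →
      (dead n m bun att big).card + 1 ≤ (dead n m bun' att big).card := by
    intro hc
    have had : a ∉ dead n m bun att big := by simp [dead, hlive]
    rw [← Finset.card_insert_of_notMem had]
    refine Finset.card_le_card (Finset.insert_subset ?_ hsub)
    simp only [dead, Finset.mem_filter, Finset.mem_univ, true_and]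
    refine hc.not_live (Finset.card_pos.1 ?_)
    rw [hb1 a hbg]
    omega
  have h0 := hI.used_closed hcl
  -- an agent that finds the new good big had no big good in a bundle before
  have hsplit : ∀ b : Fin n, att b = 0 → (usedBig n m bun' big b).Nonempty →
      ((usedBig n m bun big b).Nonempty ∧ usedBig n m bun' big b = usedBig n m bun big b) ∨
        (usedBig n m bun' big b).card = 1 := by
    intro b hb hbn
    by_cases hbig : big b g
    · right
      rw [hb1 b hbig]
      rcases (usedBig n m bun big b).eq_empty_or_nonempty with he | he
      · rw [he, Finset.card_empty]
      · exact absurd hbig (hcl.not_big hb he hg)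
    · left
      rw [hb2 b hbig] at hbn ⊢
      exact ⟨hbn, rfl⟩
  refine ⟨by omega, fun hc => ?_, fun b hb hbn => ?_, fun hc b hb hbn => ?_, fun b hb => ?_⟩
  · have := hd' hc
    omega
  · rcases hsplit b hb hbn with ⟨h1, h2⟩ | h1
    · have := hI.few_big_closed hcl b hb h1
      rw [h2]
      omega
    · omega
  · have := hd' hc
    rcases hsplit b hb hbn with ⟨h1, h2⟩ | h1
    · have := hI.few_big_closed hcl b hb h1
      rw [h2]
      omega
    · omega
  · have := hI.few_big_attached b hb
    rcases (usedBig n m bun' big b).eq_empty_or_nonempty with he | he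
    · simp [he]
    · rcases hsplit b hb he with ⟨h1, h2⟩ | h1
      · rw [h2]
        exact this
      · omega

/-- The counts in a state without live agents, as `maximinShare_le_of_marg` needs them. -/
lemma CountInv.final (hI : CountInv n m bun att big)
    (hnl : ∀ a : Fin n, ¬ Live n m bun att big a) {a : Fin n} (ha : att a = 0) :
    (usedGoods n m bun).card + (usedBig n m bun big a).card ≤ 2 * n + 2 ∧
      (usedBig n m bun big a).card ≤ (attached n att).card + 1 := by
  have hc : Closed n m bun att big := fun b g h ⟨h1, h2, _, h4, _⟩ => hnl b ⟨h1, g, h2, h4⟩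
  have hd : (dead n m bun att big).card ≤ n :=
    (Finset.card_le_univ _).trans_eq (Fintype.card_fin n)
  refine ⟨?_, hI.few_big_attached a ha⟩
  rcases (usedBig n m bun big a).eq_empty_or_nonempty with he | he
  · have := hI.used_closed hc
    rw [he, Finset.card_empty]
    omega
  · have := hI.few_big_closed hc a ha he
    omega

/-- `row` is a matching of the agents to the bundles other than `k`: unattached agents are matched
to their own bundle, attached ones to a bundle with a good that is big for them. -/
structure RowOK (n m : ℕ) (bun att : ℕ → ℕ) (big : ℕ → ℕ → Prop) (k : ℕ) (row : ℕ → ℕ) :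
    Prop where
  le : ∀ b < n, row b ≤ n
  ne : ∀ b < n, row b ≠ k
  inj : ∀ b < n, ∀ c < n, row b = row c → b = c
  unattached : ∀ b < n, att b = 0 → row b = b
  attached : ∀ b < n, att b ≠ 0 → ∃ g < m, bun g = row b ∧ big b g

/-- The invariant about the matchings `π k`. The bundles `k` with a matching other than the identity
are those of attached agents; bundle `n` is the centre. -/
structure MatchInv (n m : ℕ) (bun att : ℕ → ℕ) (big : ℕ → ℕ → Prop) (π : ℕ → ℕ → ℕ) : Prop where
  le : ∀ g < m, bun g ≤ n + 1
  owner : ∀ g < m, bun g < n → att (bun g) ≠ 0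
  row : ∀ k ≤ n, (k < n → att k ≠ 0) → RowOK n m bun att big k (π k)
  id : ∀ k ≤ n, (k < n → att k = 0) → ∀ b < n, π k b = b

lemma MatchInv.init {π : ℕ → ℕ → ℕ} (h1 : ∀ g < m, bun g = n + 1) (h2 : ∀ a < n, att a = 0)
    (h3 : ∀ k ≤ n, ∀ b < n, π k b = b) : MatchInv n m bun att big π := by
  refine ⟨fun g hg => (h1 g hg).le, fun g hg h => ?_, fun k hk h => ?_, fun k hk _ => h3 k hk⟩
  · have := h1 g hg
    omega
  · have hkn : k = n := by
      by_contra hne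
      have hlt : k < n := by omega
      exact h hlt (h2 k hlt)
    refine ⟨fun b hb => ?_, fun b hb => ?_, fun b hb c hc => ?_, fun b hb _ => h3 k hk b hb,
      fun b hb hatt => absurd (h2 b hb) hatt⟩
    · rw [h3 k hk b hb]
      omega
    · rw [h3 k hk b hb]
      omega
    · rw [h3 k hk b hb, h3 k hk c hc]
      exact fun h => h

/-- A good that joins a bundle does no harm. -/
lemma RowOK.update {k : ℕ} {row : ℕ → ℕ} (h : RowOK n m bun att big k row) {g : ℕ}
    (hg : bun g = n + 1) (y : ℕ) : RowOK n m (Function.update bun g y) att big k row := by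
  refine ⟨h.le, h.ne, h.inj, h.unattached, fun b hb hatt => ?_⟩
  obtain ⟨g', hg', h1, h2⟩ := h.attached b hb hatt
  refine ⟨g', hg', ?_, h2⟩
  rw [Function.update_of_ne, h1]
  rintro rfl
  have := h.le b hb
  omega

lemma MatchInv.center {π : ℕ → ℕ → ℕ} (hI : MatchInv n m bun att big π) {g : ℕ}
    (hg : bun g = n + 1) : MatchInv n m (Function.update bun g n) att big π := by
  refine ⟨fun g' hg' => ?_, fun g' hg' => ?_, fun k hk hatt => (hI.row k hk hatt).update hg n,
    hI.id⟩
  · by_cases h : g' = g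
    · simp [h]
    · rw [Function.update_of_ne h]
      exact hI.le g' hg'
  · by_cases h : g' = g
    · simp [h]
    · rw [Function.update_of_ne h]
      exact hI.owner g' hg'

/-- Attaching agent `a` to the bundle of `h` preserves the invariant: if the secretive agent takes
the new bundle of `a`, then `a` moves to the bundle of `h`, and the other agents act as if that
bundle had been taken. -/
lemma MatchInv.attach {π π' : ℕ → ℕ → ℕ} (hI : MatchInv n m bun att big π) {a g h : ℕ}
    (han : a < n) (hgm : g < m) (hhm : h < m) (hat : Attachable n bun att big a g h)
    (h1 : ∀ k ≤ n, k ≠ a → ∀ b < n, π' k b = π k b) (h2 : ∀ b < n, b ≠ a → π' a b = π (bun h) b)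
    (h3 : π' a a = bun h) :
    MatchInv n m (Function.update bun g a) (Function.update att a 1) big π' := by
  obtain ⟨ha, hg, hh, hbg, hbh⟩ := hat
  have hgh : h ≠ g := by
    rintro rfl
    exact hh hg
  have hp : bun h ≤ n := by
    have := hI.le h hhm
    omega
  have hpa : bun h ≠ a := by
    intro hp
    have := hI.owner h hhm (by omega)
    exact this (hp ▸ ha)
  -- a matching avoiding `k` in which `a` has her own bundle stays one after `a` is attached
  have hold : ∀ k row, RowOK n m bun att big k row →
      RowOK n m (Function.update bun g a) (Function.update att a 1) big k row := by
    intro k row hr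
    have hr' := hr.update hg a
    refine ⟨hr.le, hr.ne, hr.inj, fun b hb hb0 => ?_, fun b hb hb0 => ?_⟩
    · by_cases hba : b = a
      · simp [hba] at hb0
      · rw [Function.update_of_ne hba] at hb0
        exact hr.unattached b hb hb0
    · by_cases hba : b = a
      · rw [hba]
        exact ⟨g, hgm, by simp [hr.unattached a han ha], hbg⟩
      · rw [Function.update_of_ne hba] at hb0
        exact hr'.attached b hb hb0
  have hext : ∀ k row row', (∀ b < n, row' b = row b) →
      RowOK n m (Function.update bun g a) (Function.update att a 1) big k row →
      RowOK n m (Function.update bun g a) (Function.update att a 1) big k row' := by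
    intro k row row' he hr
    refine ⟨fun b hb => ?_, fun b hb => ?_, fun b hb c hc => ?_, fun b hb => ?_, fun b hb => ?_⟩
    · rw [he b hb]; exact hr.le b hb
    · rw [he b hb]; exact hr.ne b hb
    · rw [he b hb, he c hc]; exact hr.inj b hb c hc
    · rw [he b hb]; exact hr.unattached b hb
    · rw [he b hb]; exact hr.attached b hb
  have hrp : RowOK n m bun att big (bun h) (π (bun h)) := hI.row _ hp (hI.owner h hhm)
  have hnew : RowOK n m (Function.update bun g a) (Function.update att a 1) big a (π' a) := by
    have hr' := hold _ _ hrp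
    have haa : π (bun h) a = a := hrp.unattached a han ha
    refine ⟨fun b hb => ?_, fun b hb => ?_, fun b hb c hc => ?_, fun b hb hb0 => ?_,
      fun b hb hb0 => ?_⟩
    · by_cases hba : b = a
      · rw [hba, h3]; exact hp
      · rw [h2 b hb hba]; exact hr'.le b hb
    · by_cases hba : b = a
      · rw [hba, h3]; exact hpa
      · rw [h2 b hb hba]
        intro he
        exact hba (hrp.inj b hb a han (he.trans haa.symm))
    · by_cases hba : b = a <;> by_cases hca : c = a
      · intro _; rw [hba, hca]
      · rw [hba, h3, h2 c hc hca]
        intro he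
        exact absurd he.symm (hrp.ne c hc)
      · rw [hca, h3, h2 b hb hba]
        intro he
        exact absurd he (hrp.ne b hb)
      · rw [h2 b hb hba, h2 c hc hca]
        exact hrp.inj b hb c hc
    · by_cases hba : b = a
      · simp [hba] at hb0
      · rw [h2 b hb hba]
        exact hr'.unattached b hb hb0
    · by_cases hba : b = a
      · rw [hba, h3]
        exact ⟨h, hhm, by rw [Function.update_of_ne hgh], hbh⟩
      · rw [h2 b hb hba]
        exact hr'.attached b hb hb0
  refine ⟨fun g' hg' => ?_, fun g' hg' => ?_, fun k hk hatt => ?_, fun k hk hatt b hb => ?_⟩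
  · by_cases he : g' = g
    · simp [he]; omega
    · rw [Function.update_of_ne he]
      exact hI.le g' hg'
  · by_cases he : g' = g
    · simp [he]
    · rw [Function.update_of_ne he]
      intro hlt
      by_cases hba : bun g' = a
      · simp [hba]
      · rw [Function.update_of_ne hba]
        exact hI.owner g' hg' hlt
  · by_cases hka : k = a
    · rw [hka]; exact hnew
    · refine hext k (π k) _ (h1 k hk hka) (hold k _ (hI.row k hk fun hlt => ?_))
      have := hatt hlt
      rwa [Function.update_of_ne hka] at this
  · have hka : k ≠ a := by
      rintro rfl
      simp at hatt
      omega
    rw [h1 k hk hka b hb]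
    refine hI.id k hk (fun hlt => ?_) b hb
    have := hatt hlt
    rwa [Function.update_of_ne hka] at this

end BigGoods

/-! ### Round robin -/

section RoundRobin
variable {m : ℕ}

open Classical in
/-- The number of active players below `p`. -/
noncomputable def actBelow (act : ℕ → Prop) (p : ℕ) : ℝ :=
  ∑ q ∈ Finset.range p, if act q then 1 else 0

lemma actBelow_nonneg (act : ℕ → Prop) (p : ℕ) : 0 ≤ actBelow act p :=
  Finset.sum_nonneg fun q _ => by split_ifs <;> simp

lemma actBelow_succ {act : ℕ → Prop} {p : ℕ} (h : act p) :
    actBelow act (p + 1) = actBelow act p + 1 := by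
  rw [actBelow, actBelow, Finset.sum_range_succ]
  simp only [h, if_true]

lemma actBelow_succ_of_not {act : ℕ → Prop} {p : ℕ} (h : ¬ act p) :
    actBelow act (p + 1) = actBelow act p := by
  rw [actBelow, actBelow, Finset.sum_range_succ]
  simp only [h, if_false, add_zero]

/-- The number of turns of active players left until the player `p₀` has had her next turn, if `p`
is next to move. -/
noncomputable def credit (act : ℕ → Prop) (L p₀ p : ℕ) : ℝ :=
  (if p ≤ p₀ then 0 else actBelow act L) + actBelow act (p₀ + 1) - actBelow act p

/-- The state of a round robin of the players below `L` when it is the turn of player `p`.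
Player `p₀` has the bag `B p₀`, the goods `Q` are distributed, the goods in `W` are still available,
and `δ` is the marginal value of her latest pick: each good taken since then was worth at most `δ`
to her. -/
def RRInv (w : ℕ → Finset (Fin m) → ℝ) (θ : ℕ → ℝ) (act : ℕ → Prop) (L : ℕ) (Q : Finset (Fin m))
    (p : ℕ) (B : ℕ → Finset (Fin m)) (W : Finset (Fin m)) : Prop :=
  ∀ p₀ < L, act p₀ → ∃ δ : ℝ, 0 ≤ δ ∧ (∀ g ∈ W, marg (w p₀) g (B p₀) ≤ δ) ∧
    ∑ g ∈ Q \ W, marg (w p₀) g (B p₀) + credit act L p₀ p * δ ≤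
      actBelow act L * (w p₀ (B p₀) + θ p₀)

variable {w : ℕ → Finset (Fin m) → ℝ} {θ : ℕ → ℝ} {act : ℕ → Prop} {L : ℕ}
  {Q W : Finset (Fin m)} {B : ℕ → Finset (Fin m)} {p : ℕ}

lemma actBelow_mono {p q : ℕ} (h : p ≤ q) : actBelow act p ≤ actBelow act q := by
  refine Finset.sum_le_sum_of_subset_of_nonneg (by simpa using h) fun q _ _ => ?_
  split_ifs <;> simp

/-- At the beginning `δ` is the bound `θ` for the value of a single good. -/
lemma RRInv.init (hnn : ∀ p S, 0 ≤ w p S) (hmono : ∀ p, Monotone (w p))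
    (hsub : ∀ p, IsSubmodular (w p)) (hθ : ∀ p < L, act p → 0 ≤ θ p)
    (hB : ∀ p < L, act p → ∀ g ∈ Q, w p {g} ≤ θ p) : RRInv w θ act L Q 0 B Q := by
  intro p₀ hp ha
  refine ⟨θ p₀, hθ p₀ hp ha, fun g hg => ?_, ?_⟩
  · exact (marg_le_singleton (hnn p₀) (hmono p₀) (hsub p₀) g _).trans (hB p₀ hp ha g hg)
  · have h1 : actBelow act (p₀ + 1) ≤ actBelow act L := actBelow_mono hp
    have h2 := mul_le_mul_of_nonneg_right h1 (hθ p₀ hp ha)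
    have h3 := mul_nonneg (actBelow_nonneg act L) (hnn p₀ (B p₀))
    have h4 : actBelow act 0 = 0 := by simp [actBelow]
    simp only [Finset.sdiff_self, Finset.sum_empty, credit, zero_le, if_true, h4]
    linarith

/-- After the last player it is the turn of player `0` again. -/
lemma RRInv.round (h : RRInv w θ act L Q L B W) : RRInv w θ act L Q 0 B W := by
  intro p₀ hp ha
  obtain ⟨δ, h1, h2, h3⟩ := h p₀ hp ha
  refine ⟨δ, h1, h2, ?_⟩
  have h4 : actBelow act 0 = 0 := by simp [actBelow]
  simp only [credit, zero_le, if_true, if_neg (not_le.2 hp), h4] at h3 ⊢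
  linarith

lemma RRInv.inactive (h : RRInv w θ act L Q p B W) (hp : ¬ act p) :
    RRInv w θ act L Q (p + 1) B W := by
  intro p₀ hp₀ ha
  obtain ⟨δ, h1, h2, h3⟩ := h p₀ hp₀ ha
  refine ⟨δ, h1, h2, ?_⟩
  have hne : p₀ ≠ p := by
    rintro rfl
    exact hp ha
  have : (p + 1 ≤ p₀) ↔ (p ≤ p₀) := by omega
  simp only [credit, this, actBelow_succ_of_not hp] at h3 ⊢
  exact h3

/-- A player who finds no good left does nothing. -/
lemma RRInv.empty (h : RRInv w θ act L Q p B ∅) (hp : act p) :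
    RRInv w θ act L Q (p + 1) B ∅ := by
  intro p₀ hp₀ ha
  obtain ⟨δ, h1, h2, h3⟩ := h p₀ hp₀ ha
  by_cases hne : p₀ = p
  · subst hne
    refine ⟨0, le_rfl, by simp, ?_⟩
    simp only [credit, le_refl, if_true, actBelow_succ hp] at h3
    linarith
  · refine ⟨δ, h1, h2, ?_⟩
    have : (p + 1 ≤ p₀) ↔ (p ≤ p₀) := by omega
    simp only [credit, this, actBelow_succ hp] at h3 ⊢
    linarith

/-- A player picks the good of largest marginal value. Her own `δ` becomes that marginal value,
which the growth of her bag pays for once per active player; for any other player the good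
costs at most her `δ`, and uses up one unit of her credit. -/
lemma RRInv.pick (hmono : ∀ p, Monotone (w p)) (hsub : ∀ p, IsSubmodular (w p))
    (h : RRInv w θ act L Q p B W) (hp : act p) {g : Fin m} (hgW : g ∈ W) (hWQ : W ⊆ Q)
    (hmax : ∀ g' ∈ W, w p (insert g' (B p)) ≤ w p (insert g (B p))) :
    RRInv w θ act L Q (p + 1) (Function.update B p (insert g (B p))) (W.erase g) := by
  intro p₀ hp₀ ha
  obtain ⟨δ, h1, h2, h3⟩ := h p₀ hp₀ ha
  have hQW : Q \ W.erase g = insert g (Q \ W) := by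
    ext x
    simp only [Finset.mem_sdiff, Finset.mem_erase, Finset.mem_insert]
    by_cases hx : x = g
    · simp [hx, hWQ hgW]
    · simp [hx]
  have hgn : g ∉ Q \ W := by simp [hgW]
  rw [hQW, Finset.sum_insert hgn]
  by_cases hne : p₀ = p
  · subst hne
    simp only [Function.update_self]
    refine ⟨marg (w p₀) g (B p₀), marg_nonneg (hmono p₀) _ _, fun g' hg' => ?_, ?_⟩
    · refine (marg_anti (hmono p₀) (hsub p₀) g' (Finset.subset_insert g (B p₀))).trans ?_
      have := hmax g' (Finset.mem_of_mem_erase hg')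
      simp only [marg]
      linarith
    · rw [marg_self (Finset.mem_insert_self g (B p₀)), zero_add]
      have h4 : ∑ x ∈ Q \ W, marg (w p₀) x (insert g (B p₀)) ≤
          ∑ x ∈ Q \ W, marg (w p₀) x (B p₀) :=
        Finset.sum_le_sum fun x _ =>
          marg_anti (hmono p₀) (hsub p₀) x (Finset.subset_insert g (B p₀))
      have h5 : ¬ (p₀ + 1 ≤ p₀) := by omega
      simp only [credit, le_refl, if_true, h5, if_false, actBelow_succ hp] at h3 ⊢
      simp only [marg] at h4 h3 ⊢
      linarith
  · simp only [Function.update_of_ne hne]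
    refine ⟨δ, h1, fun g' hg' => h2 g' (Finset.mem_of_mem_erase hg'), ?_⟩
    have := h2 g hgW
    have h4 : (p + 1 ≤ p₀) ↔ (p ≤ p₀) := by omega
    simp only [credit, h4, actBelow_succ hp] at h3 ⊢
    linarith

lemma RRInv.final (h : RRInv w θ act L Q 0 B ∅) (hp : p < L) (ha : act p) :
    ∑ g ∈ Q, marg (w p) g (B p) ≤ actBelow act L * (w p (B p) + θ p) := by
  obtain ⟨δ, h1, -, h3⟩ := h p hp ha
  have h4 : actBelow act 0 = 0 := by simp [actBelow]
  simp only [Finset.sdiff_empty, credit, zero_le, if_true, h4] at h3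
  have := mul_nonneg (actBelow_nonneg act (p + 1)) h1
  linarith

end RoundRobin

/-! ### The algorithm

The natural number arrays hold
* `0`: the input;
* `1`: the bundle of each good, where bundle `a < n` belongs to agent `a`, bundle `n` is the central
  one, and `n + 1` marks a good that is in no bundle;
* `2`: the matchings, row `k` for the case that the secretive agent takes bundle `k`;
* `3`: the bags of the round robin as indicator vectors, where rows `a` and `n + a` belong to
  agent `a`;
* `4`: the argument of the queries for the empty bundle and single goods, in row `0`;
* `5`: the flags of the attached agents;
* `6`: the flag for success;
* `7`: the flag for the success of a search;
* `8`, `9`, `10`: the agent and the goods that a search has found;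
* `11`, `12`: the agent whose turn it is, and the bundle that receives her goods;
* `13`: a counter of goods;
* `14`: the bundle to which an agent gets attached;
* `20` to `27`: loop counters.

The real arrays hold
* `0`: the values of the single goods, row `a` for agent `a`;
* `1`: the estimates for the maximin shares;
* `2`: the units of which the estimates are multiples;
* `3`: the value of the best bag found by a search;
* `4`, `5`: the answers to queries. -/

/-- A numeral. -/
def num (c : ℕ) : NatExp := .const c

/-- The scalar variable kept in the cell `(0, 0)` of the natural number array `k`. -/
def var (k : ℕ) : NatExp := .get k (num 0) (num 0)

/-- The real scalar variable kept in the cell `(0, 0)` of the real array `k`. -/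
def rvar (k : ℕ) : ValExp := .get k (num 0) (num 0)

/-- The number `n` of agents. -/
def nExp : NatExp := .get 0 (num 0) (num 0)

/-- The equality `e = f`. -/
def natEq (e f : NatExp) : Test := .conj (.natLe e f) (.natLe f e)

/-- The multiple `k • e`, as an iterated sum. -/
def times : ℕ → ValExp → ValExp
  | 0, _ => .zero
  | k + 1, e => .add (times k e) e

/-- Sequential composition of structured programs. -/
infixr:60 " ;; " => Cmd.seq

@[simp] lemma num_eval (s : State) (c : ℕ) : (num c).eval s = c := rfl
@[simp] lemma var_eval (s : State) (k : ℕ) : (var k).eval s = s.nat k 0 0 := rfl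
@[simp] lemma nExp_eval (s : State) : nExp.eval s = s.nat 0 0 0 := rfl
@[simp] lemma get_eval (s : State) (k : ℕ) (i j : NatExp) :
    (NatExp.get k i j).eval s = s.nat k (i.eval s) (j.eval s) := rfl
@[simp] lemma add_eval (s : State) (e f : NatExp) :
    (NatExp.add e f).eval s = e.eval s + f.eval s := rfl
@[simp] lemma sub_eval (s : State) (e f : NatExp) :
    (NatExp.sub e f).eval s = e.eval s - f.eval s := rfl
@[simp] lemma rvar_eval (s : State) (k : ℕ) : (rvar k).eval s = s.val k 0 0 := rfl
@[simp] lemma vget_eval (s : State) (k : ℕ) (i j : NatExp) :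
    (ValExp.get k i j).eval s = s.val k (i.eval s) (j.eval s) := rfl
@[simp] lemma vadd_eval (s : State) (e f : ValExp) :
    (ValExp.add e f).eval s = e.eval s + f.eval s := rfl
@[simp] lemma vsub_eval (s : State) (e f : ValExp) :
    (ValExp.sub e f).eval s = e.eval s - f.eval s := rfl

@[simp] lemma times_eval (s : State) (k : ℕ) (e : ValExp) : (times k e).eval s = k * e.eval s := by
  induction k with
  | zero => simp [times, ValExp.eval]
  | succ k ih => simp only [times, ValExp.eval, ih]; push_cast; ring

@[simp] lemma natEq_holds (s : State) (e f : NatExp) :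
    (natEq e f).Holds s ↔ e.eval s = f.eval s := by
  simp only [natEq, Test.Holds]; omega
@[simp] lemma natLt_holds (s : State) (e f : NatExp) :
    (natLt e f).Holds s ↔ e.eval s < f.eval s := by
  simp only [natLt, Test.Holds]; omega
@[simp] lemma valLe_holds (s : State) (e f : ValExp) :
    (Test.valLe e f).Holds s ↔ e.eval s ≤ f.eval s := Iff.rfl
@[simp] lemma conj_holds (s : State) (b c : Test) :
    (Test.conj b c).Holds s ↔ b.Holds s ∧ c.Holds s := Iff.rfl
@[simp] lemma neg_holds (s : State) (b : Test) : (Test.neg b).Holds s ↔ ¬ b.Holds s := Iff.rfl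

/-- The good `g` is big for agent `a`: its value is at least a `1 / 19` fraction of the estimate
for the maximin share. -/
def bigTest (a g : NatExp) : Test := .valLe (.get 1 a (num 0)) (times 19 (.get 0 a g))

/-- Look for an agent that can be attached. -/
def findAttach : Cmd :=
  .setNat 7 (num 0) (num 0) (num 0) ;;
  .iter 20 .vn (.iter 21 .vm (.iter 22 .vm (.cond
    (.conj (natEq (.get 5 (var 20) (num 0)) (num 0))
      (.conj (natEq (.get 1 (var 21) (num 0)) (.add nExp (num 1)))
      (.conj (.neg (natEq (.get 1 (var 22) (num 0)) (.add nExp (num 1))))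
      (.conj (bigTest (var 20) (var 21)) (bigTest (var 20) (var 22))))))
    (.setNat 7 (num 0) (num 0) (num 1) ;; .setNat 8 (num 0) (num 0) (var 20) ;;
      .setNat 9 (num 0) (num 0) (var 21) ;; .setNat 10 (num 0) (num 0) (var 22))
    .skip)))

/-- Look for a live agent. -/
def findLive : Cmd :=
  .setNat 7 (num 0) (num 0) (num 0) ;;
  .iter 20 .vn (.iter 21 .vm (.cond
    (.conj (natEq (.get 5 (var 20) (num 0)) (num 0))
      (.conj (natEq (.get 1 (var 21) (num 0)) (.add nExp (num 1)))
      (bigTest (var 20) (var 21))))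
    (.setNat 7 (num 0) (num 0) (num 1) ;; .setNat 9 (num 0) (num 0) (var 21))
    .skip))

/-- Attach the agent that has been found. -/
def attachFound : Cmd :=
  .setNat 14 (num 0) (num 0) (.get 1 (var 10) (num 0)) ;;
  .setNat 1 (var 9) (num 0) (var 8) ;;
  .setNat 5 (var 8) (num 0) (num 1) ;;
  .iter 20 .vn (.setNat 2 (var 8) (var 20) (.get 2 (var 14) (var 20))) ;;
  .setNat 2 (var 8) (var 8) (var 14)

/-- Attach an agent if possible; otherwise put a good that is big for a live agent into the central
bundle. -/
def growTree : Cmd :=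
  findAttach ;;
  .cond (natEq (var 7) (num 1)) attachFound
    (findLive ;; .cond (natEq (var 7) (num 1)) (.setNat 1 (var 9) (num 0) nExp) .skip)

/-- Find the available good of largest marginal value for the current player, whose bag is the
row `var 23` of array `3`. -/
def findBest : Cmd :=
  .setNat 7 (num 0) (num 0) (num 0) ;;
  .iter 21 .vm (.cond (natEq (.get 1 (var 21) (num 0)) (.add nExp (num 1)))
    (.setNat 3 (var 23) (var 21) (num 1) ;;
      .query 4 (num 0) (num 0) (var 11) 3 (var 23) ;;
      .setNat 3 (var 23) (var 21) (num 0) ;;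
      .cond (.conj (natEq (var 7) (num 1)) (.valLe (rvar 4) (rvar 3))) .skip
        (.setNat 7 (num 0) (num 0) (num 1) ;; .setVal 3 (num 0) (num 0) (rvar 4) ;;
          .setNat 9 (num 0) (num 0) (var 21)))
    .skip)

/-- The turn of player `var 23`. There are `2 * n` players, since each agent fills two bags: as
player `a`, agent `a` puts goods into her own bundle, as player `n + a` into the central one. Agents
that are attached to the tree do not take part. -/
def turn : Cmd :=
  .cond (natLt (var 23) nExp)
    (.setNat 11 (num 0) (num 0) (var 23) ;; .setNat 12 (num 0) (num 0) (var 23))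
    (.setNat 11 (num 0) (num 0) (.sub (var 23) nExp) ;; .setNat 12 (num 0) (num 0) nExp) ;;
  .cond (natEq (.get 5 (var 11) (num 0)) (num 0))
    (findBest ;; .cond (natEq (var 7) (num 1))
      (.setNat 3 (var 23) (var 9) (num 1) ;; .setNat 1 (var 9) (num 0) (var 12)) .skip)
    .skip

/-- The round robin, with `m` rounds: enough for all goods if some player is active. -/
def roundRobin : Cmd := .iter 24 .vm (.iter 23 (.add .vn .vn) turn)

/-- Empty all bundles and bags, detach all agents, let all rows of the matchings be the identity,
and assume success. -/
def reset : Cmd :=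
  .iter 21 .vm (.setNat 1 (var 21) (num 0) (.add nExp (num 1)) ;;
    .iter 23 (.add .vn .vn) (.setNat 3 (var 23) (var 21) (num 0))) ;;
  .iter 20 .vn (.setNat 5 (var 20) (num 0) (num 0)) ;;
  .iter 22 (.add .vn .one) (.iter 20 .vn (.setNat 2 (var 22) (var 20) (var 20))) ;;
  .setNat 6 (num 0) (num 0) (num 1)

/-- Put the goods left over into the central bundle, and complete the matchings. -/
def finish : Cmd :=
  .iter 21 .vm (.cond (natEq (.get 1 (var 21) (num 0)) (.add nExp (num 1)))
    (.setNat 1 (var 21) (num 0) nExp) .skip) ;;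
  .iter 20 .vn (.cond (natEq (.get 5 (var 20) (num 0)) (num 0))
    (.setNat 2 (var 20) (var 20) nExp) .skip)

/-- Lower the estimates of the agents whose bags are not good enough. -/
def check : Cmd :=
  .iter 20 .vn (.cond (natEq (.get 5 (var 20) (num 0)) (num 0))
    (.query 4 (num 0) (num 0) (var 20) 3 (var 20) ;;
      .query 5 (num 0) (num 0) (var 20) 3 (.add nExp (var 20)) ;;
      .cond (.conj (.valLe (.get 1 (var 20) (num 0)) (times 19 (rvar 4)))
          (.valLe (.get 1 (var 20) (num 0)) (times 19 (rvar 5)))) .skip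
        (.setVal 1 (var 20) (num 0)
            (.sub (.get 1 (var 20) (num 0)) (.get 2 (var 20) (num 0))) ;;
          .setNat 6 (num 0) (num 0) (num 0)))
    .skip)

/-- An attempt to construct the allocation from the current estimates. Each pass of the loop puts
a good into a bundle while there are live agents, so `m` passes suffice. -/
def attempt : Cmd := reset ;; .iter 27 .vm growTree ;; roundRobin ;; finish ;; check

/-- Query the values of the empty bundle and of the single goods. -/
def querySingles : Cmd :=
  .iter 20 .vn (.query 2 (var 20) (num 0) (var 20) 4 (num 0) ;;
    .iter 21 .vm (.setNat 4 (num 0) (var 21) (num 1) ;;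
      .query 0 (var 20) (var 21) (var 20) 4 (num 0) ;;
      .setNat 4 (num 0) (var 21) (num 0)))

/-- Count the goods worth at least as much as the good `var 21` to agent `var 20`. -/
def countAbove : Cmd :=
  .setNat 13 (num 0) (num 0) (num 0) ;;
  .iter 22 .vm (.cond (.valLe (.get 0 (var 20) (var 21)) (.get 0 (var 20) (var 22)))
    (.setNat 13 (num 0) (num 0) (.add (var 13) (num 1))) .skip)

/-- Raise the entry of agent `var 20` in array `2` to the value of the good `var 21` if at least
`n + 1` goods are worth that much. -/
def raiseUnit : Cmd :=
  countAbove ;;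
  .cond (.conj (natLt nExp (var 13)) (.valLe (.get 2 (var 20) (num 0)) (.get 0 (var 20) (var 21))))
    (.setVal 2 (var 20) (num 0) (.get 0 (var 20) (var 21))) .skip

/-- Compute the units: the value of the `(n + 1)`-st best good, or of the empty bundle if there are
not that many goods. -/
def findUnits : Cmd := .iter 20 .vn (.iter 21 .vm raiseUnit)

/-- Set the estimates, which are zero, to `m + 1` units. -/
def initEstimates : Cmd :=
  .iter 20 .vn (.iter 21 (.add .vm .one)
    (.setVal 1 (var 20) (num 0) (.add (.get 1 (var 20) (num 0)) (.get 2 (var 20) (num 0)))))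

/-- Compute the single values, the units and the first estimates. -/
def setup : Cmd := querySingles ;; findUnits ;; initEstimates

/-- The algorithm: at most `n * (m + 1)` attempts fail, so `(n + 1) * (m + 1)` attempts are
enough. -/
def main : Cmd :=
  setup ;; .iter 25 (.add .vn .one) (.iter 26 (.add .vm .one)
    (.cond (natEq (var 6) (num 0)) attempt .skip))

lemma main_wf : main.wf = true := by decide

lemma main_writesN : main.writesN.contains 0 = false := by decide

/-! ### Correctness of the tree building -/

section
variable {n m : ℕ} (v : Fin n → Finset (Fin m) → ℝ)

/-- The states `s` and `s'` differ only in arrays that `c` may change. -/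
structure Frame (c : Cmd) (s s' : State) : Prop where
  nat : ∀ k, c.writesN.contains k = false → s'.nat k = s.nat k
  val : ∀ k, c.writesV.contains k = false → s'.val k = s.val k

lemma Cmd.frame (c : Cmd) (s : State) : Frame c s (c.run v s) :=
  ⟨fun _ h => c.run_nat v s h, fun _ h => c.run_val v s h⟩

lemma Frame.nat_set {c : Cmd} {s s' : State} {k i : ℕ} (hF : Frame c (s.setN k 0 0 i) s') {k' : ℕ}
    (h : c.writesN.contains k' = false) (hk : k' ≠ k) : s'.nat k' = s.nat k' := by
  rw [hF.nat k' h, State.setN_nat_ne _ _ _ _ hk]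

lemma Cmd.run_seq (c d : Cmd) (s : State) : (c ;; d).run v s = d.run v (c.run v s) := rfl

/-- Invariant rule for bounded loops, with the frame condition built in. -/
lemma Cmd.run_iter_frame {k : ℕ} {b : Bnd} {c : Cmd} {s : State} {N : ℕ} (hN : b.eval n m = N)
    (I : ℕ → State → Prop) (Q : State → Prop) (h0 : I 0 s)
    (hs : ∀ i < N, ∀ s', Frame (.iter k b c) s s' → I i s' →
      I (i + 1) (c.run v (s'.setN k 0 0 i)))
    (hQ : ∀ s', Frame (.iter k b c) s s' → I N s' → Q (s'.setN k 0 0 N)) :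
    Q ((Cmd.iter k b c).run v s) := by
  refine Cmd.run_iter v hN (fun i s' => Frame (.iter k b c) s s' ∧ I i s') Q
    ⟨⟨fun _ _ => rfl, fun _ _ => rfl⟩, h0⟩ ?_ (fun s' h => hQ s' h.1 h.2)
  rintro i hi s' ⟨hF, hI⟩
  refine ⟨⟨fun k' hk' => ?_, fun k' hk' => ?_⟩, hs i hi s' hF hI⟩
  · have hk2 := hk'
    simp only [Cmd.writesN, List.contains_eq_mem, List.mem_cons, decide_eq_false_iff_not,
      not_or] at hk2
    rw [c.run_nat v _ (by simpa using hk2.2), State.setN_nat_ne _ _ _ _ hk2.1, hF.nat k' hk']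
  · rw [c.run_val v _ hk', State.setN_val, hF.val k' hk']

/-- Rule for a loop that searches for an index: the flag `7` says whether something has been
found, `G` that it has been found and recorded, and `R i` that there is nothing to be found
at `i`. -/
lemma Cmd.run_iter_search {k : ℕ} {b : Bnd} {c : Cmd} {s : State} {N : ℕ} (hN : b.eval n m = N)
    (hk : k ≠ 7) (G : State → Prop) (R : ℕ → Prop) (hG : ∀ s' i, G s' → G (s'.setN k 0 0 i))
    (hs : ∀ i < N, ∀ s', Frame (.iter k b c) s s' → (G s' ∨ s'.nat 7 0 0 = 0) →
      (G s' → G (c.run v (s'.setN k 0 0 i))) ∧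
      (G (c.run v (s'.setN k 0 0 i)) ∨ (c.run v (s'.setN k 0 0 i)).nat 7 0 0 = 0 ∧ R i))
    (h0 : G s ∨ s.nat 7 0 0 = 0) :
    (G s → G ((Cmd.iter k b c).run v s)) ∧
    (G ((Cmd.iter k b c).run v s) ∨
      ((Cmd.iter k b c).run v s).nat 7 0 0 = 0 ∧ ∀ i < N, R i) := by
  refine Cmd.run_iter_frame v hN
    (fun i s' => (G s → G s') ∧ (G s' ∨ s'.nat 7 0 0 = 0 ∧ ∀ j < i, R j))
    (fun s' => (G s → G s') ∧ (G s' ∨ s'.nat 7 0 0 = 0 ∧ ∀ i < N, R i))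
    ⟨id, h0.imp_right fun h => ⟨h, by simp⟩⟩ ?_ ?_
  · rintro i hi s' hF ⟨h1, h2⟩
    obtain ⟨h3, h4⟩ := hs i hi s' hF (h2.imp_right And.left)
    refine ⟨fun h => h3 (h1 h), ?_⟩
    rcases h2 with h2 | ⟨h2, h5⟩
    · exact Or.inl (h3 h2)
    · refine h4.imp_right fun h => ⟨h.1, fun j hj => ?_⟩
      rcases Nat.lt_succ_iff_lt_or_eq.1 hj with h6 | rfl
      · exact h5 j h6
      · exact h.2
  · rintro s' - ⟨h1, h2⟩
    refine ⟨fun h => hG _ _ (h1 h), h2.imp (hG _ _) fun h => ⟨?_, h.2⟩⟩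
    rw [State.setN_nat_ne _ _ _ _ hk.symm]
    exact h.1

/-- The bundle of each good. -/
def State.bun (s : State) (g : ℕ) : ℕ := s.nat 1 g 0

/-- The flags of the attached agents. -/
def State.att (s : State) (a : ℕ) : ℕ := s.nat 5 a 0

/-- The good `g` is big for agent `a`. -/
def State.Big (s : State) (a g : ℕ) : Prop := s.val 1 a 0 ≤ 19 * s.val 0 a g

/-- The search finds an agent that can be attached, or there is none. -/
lemma findAttach_spec (s : State) (hn : s.nat 0 0 0 = n) :
    ((findAttach.run v s).nat 7 0 0 = 1 ∧ ∃ a < n, ∃ g < m, ∃ h < m,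
      (findAttach.run v s).nat 8 0 0 = a ∧ (findAttach.run v s).nat 9 0 0 = g ∧
      (findAttach.run v s).nat 10 0 0 = h ∧ Attachable n s.bun s.att s.Big a g h) ∨
    ((findAttach.run v s).nat 7 0 0 = 0 ∧
      ∀ a < n, ∀ g < m, ∀ h < m, ¬ Attachable n s.bun s.att s.Big a g h) := by
  set G : State → Prop := fun s' => s'.nat 7 0 0 = 1 ∧ ∃ a < n, ∃ g < m, ∃ h < m,
    s'.nat 8 0 0 = a ∧ s'.nat 9 0 0 = g ∧ s'.nat 10 0 0 = h ∧
    Attachable n s.bun s.att s.Big a g h with hGdef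
  have hG : ∀ k, 20 ≤ k → ∀ s' i, G s' → G (s'.setN k 0 0 i) := by
    intro k hk s' i h
    simp only [hGdef] at h ⊢
    rwa [State.setN_nat_ne _ _ _ _ (by omega), State.setN_nat_ne _ _ _ _ (by omega),
      State.setN_nat_ne _ _ _ _ (by omega), State.setN_nat_ne _ _ _ _ (by omega)]
  have hG' : ∀ k, 20 ≤ k → ∀ s' i, (G s' ∨ s'.nat 7 0 0 = 0) →
      (G (s'.setN k 0 0 i) ∨ (s'.setN k 0 0 i).nat 7 0 0 = 0) := by
    intro k hk s' i h
    refine h.imp (hG k hk s' i) fun h => ?_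
    rwa [State.setN_nat_ne _ _ _ _ (by omega)]
  rw [findAttach, Cmd.run]
  set s1 := (Cmd.setNat 7 (num 0) (num 0) (num 0)).run v s with hs1
  have h10 : ∀ k, k ≠ 7 → s1.nat k = s.nat k := fun k hk => State.setN_nat_ne _ _ _ _ hk
  refine (Cmd.run_iter_search v rfl (by omega) G
    (fun a => ∀ g < m, ∀ h < m, ¬ Attachable n s.bun s.att s.Big a g h)
    (hG 20 (by omega)) ?_ (Or.inr ?_)).2
  · intro a ha s2 hF2 h2
    refine And.imp_left (fun f h => f (hG 20 (by omega) _ _ h)) (Cmd.run_iter_search v rfl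
      (by omega) G (fun g => ∀ h < m, ¬ Attachable n s.bun s.att s.Big a g h)
      (hG 21 (by omega)) ?_ (hG' 20 (by omega) _ _ h2))
    intro g hg s3 hF3 h3
    refine And.imp_left (fun f h => f (hG 21 (by omega) _ _ h)) (Cmd.run_iter_search v rfl
      (by omega) G (fun h => ¬ Attachable n s.bun s.att s.Big a g h)
      (hG 22 (by omega)) ?_ (hG' 21 (by omega) _ _ h3))
    intro h hh s4 hF4 h4
    have e : ∀ k, k = 0 ∨ k = 1 ∨ k = 5 → s4.nat k = s.nat k := by
      rintro k (rfl | rfl | rfl) <;>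
        rw [hF4.nat_set (by decide) (by omega), hF3.nat_set (by decide) (by omega),
          hF2.nat _ (by decide), h10 _ (by omega)]
    have e0 := e 0 (by simp)
    have e1 := e 1 (by simp)
    have e5 := e 5 (by simp)
    have ev : s4.val = s.val := by
      funext k
      rw [hF4.val k rfl, State.setN_val, hF3.val k rfl, State.setN_val, hF2.val k rfl]
      rfl
    have e20 : s4.nat 20 0 0 = a := by
      rw [hF4.nat_set (by decide) (by omega), hF3.nat 20 (by decide)]
      simp
    have e21 : s4.nat 21 0 0 = g := by
      rw [hF4.nat 21 (by decide)]
      simp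
    simp only [Cmd.run]
    split_ifs with hc
    · have hat : Attachable n s.bun s.att s.Big a g h := by
        simpa [bigTest, e0, e1, e5, ev, e20, e21, hn, Attachable, State.bun, State.att, State.Big]
          using hc
      have hGn : G (((((s4.setN 22 0 0 h).setN 7 0 0 1).setN 8 0 0 a).setN 9 0 0 g).setN
          10 0 0 h) := by
        refine ⟨by simp, a, ha, g, hg, h, hh, ?_, ?_, ?_, hat⟩ <;> simp
      simp only [num_eval, var_eval, State.setN_nat]
      norm_num [e20, e21]
      exact ⟨fun _ => hGn, hGn⟩
    · have hat : ¬ Attachable n s.bun s.att s.Big a g h := by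
        intro hat
        apply hc
        simpa [bigTest, e0, e1, e5, ev, e20, e21, hn, Attachable, State.bun, State.att, State.Big]
          using hat
      refine ⟨hG 22 (by omega) _ _, h4.imp (hG 22 (by omega) _ _) fun h0 => ⟨?_, hat⟩⟩
      rw [State.setN_nat_ne _ _ _ _ (by omega)]
      exact h0
  · simp [hs1, Cmd.run]

lemma findLive_spec (s : State) (hn : s.nat 0 0 0 = n) :
    ((findLive.run v s).nat 7 0 0 = 1 ∧ ∃ a < n, ∃ g < m, (findLive.run v s).nat 9 0 0 = g ∧
      s.att a = 0 ∧ s.bun g = n + 1 ∧ s.Big a g) ∨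
    ((findLive.run v s).nat 7 0 0 = 0 ∧
      ∀ a < n, ∀ g < m, ¬ (s.att a = 0 ∧ s.bun g = n + 1 ∧ s.Big a g)) := by
  set G : State → Prop := fun s' => s'.nat 7 0 0 = 1 ∧ ∃ a < n, ∃ g < m,
    s'.nat 9 0 0 = g ∧ s.att a = 0 ∧ s.bun g = n + 1 ∧ s.Big a g with hGdef
  have hG : ∀ k, 20 ≤ k → ∀ s' i, G s' → G (s'.setN k 0 0 i) := by
    intro k hk s' i h
    simp only [hGdef] at h ⊢
    rwa [State.setN_nat_ne _ _ _ _ (by omega), State.setN_nat_ne _ _ _ _ (by omega)]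
  have hG' : ∀ k, 20 ≤ k → ∀ s' i, (G s' ∨ s'.nat 7 0 0 = 0) →
      (G (s'.setN k 0 0 i) ∨ (s'.setN k 0 0 i).nat 7 0 0 = 0) := by
    intro k hk s' i h
    refine h.imp (hG k hk s' i) fun h => ?_
    rwa [State.setN_nat_ne _ _ _ _ (by omega)]
  rw [findLive, Cmd.run]
  set s1 := (Cmd.setNat 7 (num 0) (num 0) (num 0)).run v s with hs1
  have h10 : ∀ k, k ≠ 7 → s1.nat k = s.nat k := fun k hk => State.setN_nat_ne _ _ _ _ hk
  refine (Cmd.run_iter_search v rfl (by omega) G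
    (fun a => ∀ g < m, ¬ (s.att a = 0 ∧ s.bun g = n + 1 ∧ s.Big a g))
    (hG 20 (by omega)) ?_ (Or.inr ?_)).2
  · intro a ha s2 hF2 h2
    refine And.imp_left (fun f h => f (hG 20 (by omega) _ _ h)) (Cmd.run_iter_search v rfl
      (by omega) G (fun g => ¬ (s.att a = 0 ∧ s.bun g = n + 1 ∧ s.Big a g))
      (hG 21 (by omega)) ?_ (hG' 20 (by omega) _ _ h2))
    intro g hg s4 hF4 h4
    have e : ∀ k, k = 0 ∨ k = 1 ∨ k = 5 → s4.nat k = s.nat k := by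
      rintro k (rfl | rfl | rfl) <;>
        rw [hF4.nat_set (by decide) (by omega), hF2.nat _ (by decide), h10 _ (by omega)]
    have e0 := e 0 (by simp)
    have e1 := e 1 (by simp)
    have e5 := e 5 (by simp)
    have ev : s4.val = s.val := by
      funext k
      rw [hF4.val k rfl, State.setN_val, hF2.val k rfl]
      rfl
    have e20 : s4.nat 20 0 0 = a := by
      rw [hF4.nat 20 (by decide)]
      simp
    simp only [Cmd.run]
    split_ifs with hc
    · have hat : s.att a = 0 ∧ s.bun g = n + 1 ∧ s.Big a g := by
        simpa [bigTest, e0, e1, e5, ev, e20, hn, State.bun, State.att, State.Big] using hc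
      have hGn : G (((s4.setN 21 0 0 g).setN 7 0 0 1).setN 9 0 0 g) := by
        refine ⟨by simp, a, ha, g, hg, ?_, hat⟩
        simp
      simp only [num_eval, var_eval, State.setN_nat]
      norm_num [e20]
      exact ⟨fun _ => hGn, hGn⟩
    · have hat : ¬ (s.att a = 0 ∧ s.bun g = n + 1 ∧ s.Big a g) := by
        intro hat
        apply hc
        simpa [bigTest, e0, e1, e5, ev, e20, hn, State.bun, State.att, State.Big] using hat
      refine ⟨hG 21 (by omega) _ _, h4.imp (hG 21 (by omega) _ _) fun h0 => ⟨?_, hat⟩⟩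
      rw [State.setN_nat_ne _ _ _ _ (by omega)]
      exact h0
  · simp [hs1, Cmd.run]

lemma attachFound_spec (s : State) {a g h : ℕ} (h8 : s.nat 8 0 0 = a) (h9 : s.nat 9 0 0 = g)
    (h10 : s.nat 10 0 0 = h) (hpa : s.bun h ≠ a) :
    (attachFound.run v s).bun = Function.update s.bun g a ∧
    (attachFound.run v s).att = Function.update s.att a 1 ∧
    (∀ k, k ≠ a → ∀ b, (attachFound.run v s).nat 2 k b = s.nat 2 k b) ∧
    (∀ b < n, b ≠ a → (attachFound.run v s).nat 2 a b = s.nat 2 (s.bun h) b) ∧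
    (attachFound.run v s).nat 2 a a = s.bun h := by
  rw [attachFound, Cmd.run_seq, Cmd.run_seq, Cmd.run_seq, Cmd.run_seq]
  set s1 := (Cmd.setNat 14 (num 0) (num 0) (.get 1 (var 10) (num 0))).run v s with hs1
  set s2 := (Cmd.setNat 1 (var 9) (num 0) (var 8)).run v s1 with hs2
  set s3 := (Cmd.setNat 5 (var 8) (num 0) (num 1)).run v s2 with hs3
  have e8 : s3.nat 8 0 0 = a := by simp [hs3, hs2, hs1, Cmd.run, h8]
  have e14 : s3.nat 14 0 0 = s.bun h := by simp [hs3, hs2, hs1, Cmd.run, h10, State.bun]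
  have e2 : s3.nat 2 = s.nat 2 := by
    funext i j
    simp [hs3, hs2, hs1, Cmd.run]
  have e1 : s3.bun = Function.update s.bun g a := by
    funext x
    simp [hs3, hs2, hs1, Cmd.run, h8, h9, State.bun, Function.update_apply]
  have e5 : s3.att = Function.update s.att a 1 := by
    funext x
    simp [hs3, hs2, hs1, Cmd.run, h8, State.att, Function.update_apply]
  refine Cmd.run_iter_frame (k := 20) (b := .vn) v rfl
    (fun i s' => (∀ k, k ≠ a → ∀ b, s'.nat 2 k b = s.nat 2 k b) ∧
      ∀ b < i, s'.nat 2 a b = s.nat 2 (s.bun h) b) (fun s' =>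
      ((Cmd.setNat 2 (var 8) (var 8) (var 14)).run v s').bun = Function.update s.bun g a ∧
      ((Cmd.setNat 2 (var 8) (var 8) (var 14)).run v s').att = Function.update s.att a 1 ∧
      (∀ k, k ≠ a → ∀ b,
        ((Cmd.setNat 2 (var 8) (var 8) (var 14)).run v s').nat 2 k b = s.nat 2 k b) ∧
      (∀ b < n, b ≠ a →
        ((Cmd.setNat 2 (var 8) (var 8) (var 14)).run v s').nat 2 a b = s.nat 2 (s.bun h) b) ∧
      ((Cmd.setNat 2 (var 8) (var 8) (var 14)).run v s').nat 2 a a = s.bun h)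
    ⟨fun k _ b => by rw [e2], by simp⟩ ?_ ?_
  · rintro i hi s' hF ⟨h1, h2⟩
    have f8 : s'.nat 8 0 0 = a := by rw [hF.nat 8 (by decide), e8]
    have f14 : s'.nat 14 0 0 = s.bun h := by rw [hF.nat 14 (by decide), e14]
    constructor
    · intro k hk b
      simp [Cmd.run, f8, hk, h1 k hk]
    · intro b hb
      simp only [Cmd.run, var_eval, get_eval, State.setN_nat]
      norm_num [f8, f14]
      split_ifs with hbi
      · rw [h1 _ hpa, hbi]
      · exact h2 b (by omega)
  · rintro s' hF ⟨h1, h2⟩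
    have f8 : s'.nat 8 0 0 = a := by rw [hF.nat 8 (by decide), e8]
    have f14 : s'.nat 14 0 0 = s.bun h := by rw [hF.nat 14 (by decide), e14]
    refine ⟨?_, ?_, ?_, ?_, ?_⟩
    · rw [← e1]
      funext x
      simp [Cmd.run, State.bun, hF.nat 1 (by decide)]
    · rw [← e5]
      funext x
      simp [Cmd.run, State.att, hF.nat 5 (by decide)]
    · intro k hk b
      simp [Cmd.run, f8, hk, h1 k hk]
    · intro b hb hba
      simp [Cmd.run, f8, hba, h2 b hb]
    · simp [Cmd.run, f8, f14]

/-- What one step of the tree building does. -/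
lemma growTree_spec (s : State) (hn : s.nat 0 0 0 = n)
    (hM : MatchInv n m s.bun s.att s.Big (s.nat 2)) :
    (∃ a < n, ∃ g < m, ∃ h < m, Attachable n s.bun s.att s.Big a g h ∧
      (growTree.run v s).bun = Function.update s.bun g a ∧
      (growTree.run v s).att = Function.update s.att a 1 ∧
      (∀ k, k ≠ a → ∀ b, (growTree.run v s).nat 2 k b = s.nat 2 k b) ∧
      (∀ b < n, b ≠ a → (growTree.run v s).nat 2 a b = s.nat 2 (s.bun h) b) ∧
      (growTree.run v s).nat 2 a a = s.bun h) ∨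
    (Closed n m s.bun s.att s.Big ∧ (growTree.run v s).att = s.att ∧
      (growTree.run v s).nat 2 = s.nat 2 ∧
      ((∃ a < n, ∃ g < m, s.att a = 0 ∧ s.bun g = n + 1 ∧ s.Big a g ∧
        (growTree.run v s).bun = Function.update s.bun g n) ∨
      ((∀ a : Fin n, ¬ Live n m s.bun s.att s.Big a) ∧ (growTree.run v s).bun = s.bun))) := by
  have hF := findAttach.frame v s
  have hfa := findAttach_spec v s hn
  simp only [growTree, Cmd.run]
  set s1 := findAttach.run v s with hs1
  have f1 : s1.bun = s.bun := by funext x; simp only [State.bun, hF.nat 1 (by decide)]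
  have f5 : s1.att = s.att := by funext x; simp only [State.att, hF.nat 5 (by decide)]
  have f2 : s1.nat 2 = s.nat 2 := hF.nat 2 (by decide)
  have fB : s1.Big = s.Big := by
    funext a g
    simp only [State.Big, hF.val 0 (by decide), hF.val 1 (by decide)]
  rcases hfa with ⟨h7, a, ha, g, hg, h, hh, h8, h9, h10, hat⟩ | ⟨h7, hno⟩
  · left
    rw [if_pos (by simpa using h7)]
    have hpa : s1.bun h ≠ a := by
      rw [f1]
      intro hp
      refine hM.owner h hh (by omega) ?_
      rw [hp]
      exact hat.1
    obtain ⟨r1, r2, r3, r4, r5⟩ := attachFound_spec v s1 h8 h9 h10 hpa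
    rw [f1] at r1 r4 r5
    rw [f5] at r2
    rw [f2] at r3 r4
    exact ⟨a, ha, g, hg, h, hh, hat, r1, r2, r3, r4, r5⟩
  · right
    rw [if_neg (by simp [h7])]
    have hF2 := findLive.frame v s1
    have hfl := findLive_spec v s1 (by rw [hF.nat 0 (by decide), hn])
    set s2 := findLive.run v s1 with hs2
    have g1 : s2.bun = s.bun := by rw [← f1]; funext x; simp only [State.bun, hF2.nat 1 (by decide)]
    have g5 : s2.att = s.att := by rw [← f5]; funext x; simp only [State.att, hF2.nat 5 (by decide)]
    have g2 : s2.nat 2 = s.nat 2 := by rw [hF2.nat 2 (by decide), f2]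
    have g0 : s2.nat 0 0 0 = n := by rw [hF2.nat 0 (by decide), hF.nat 0 (by decide), hn]
    rw [f1, f5, fB] at hfl
    refine ⟨fun a g h => hno a a.2 g g.2 h h.2, ?_⟩
    rcases hfl with ⟨h7', a, ha, g, hg, h9, hl⟩ | ⟨h7', hno'⟩
    · rw [if_pos (by simpa using h7')]
      refine ⟨?_, ?_, Or.inl ⟨a, ha, g, hg, hl.1, hl.2.1, hl.2.2, ?_⟩⟩
      · rw [← g5]
        funext x
        simp [State.att]
      · rw [← g2]
        funext i j
        simp
      · rw [← g1]
        funext x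
        simp [State.bun, Function.update_apply, h9, g0]
    · rw [if_neg (by simp [h7'])]
      exact ⟨g5, g2, Or.inr ⟨fun a ⟨h1, g, h2, h3⟩ => hno' a a.2 g g.2 ⟨h1, h2, h3⟩, g1⟩⟩

end

section
variable {n m : ℕ} (v : Fin n → Finset (Fin m) → ℝ)

lemma reset_spec (s : State) (hn : s.nat 0 0 0 = n) :
    (∀ g < m, (reset.run v s).bun g = n + 1) ∧
    (∀ p < n + n, ∀ g < m, (reset.run v s).nat 3 p g = 0) ∧
    (∀ a < n, (reset.run v s).att a = 0) ∧
    (∀ k ≤ n, ∀ b < n, (reset.run v s).nat 2 k b = b) ∧ (reset.run v s).nat 6 0 0 = 1 := by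
  rw [reset, Cmd.run_seq, Cmd.run_seq, Cmd.run_seq]
  set c1 : Cmd := .iter 21 .vm (.setNat 1 (var 21) (num 0) (.add nExp (num 1)) ;;
    .iter 23 (.add .vn .vn) (.setNat 3 (var 23) (var 21) (num 0))) with hc1
  set c2 : Cmd := .iter 20 .vn (.setNat 5 (var 20) (num 0) (num 0)) with hc2
  set c3 : Cmd := .iter 22 (.add .vn .one) (.iter 20 .vn (.setNat 2 (var 22) (var 20) (var 20)))
    with hc3
  set s1 := c1.run v s with hs1
  set s2 := c2.run v s1 with hs2
  set s3 := c3.run v s2 with hs3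
  have h1 : (∀ g < m, s1.bun g = n + 1) ∧ ∀ g < m, ∀ p < n + n, s1.nat 3 p g = 0 := by
    refine Cmd.run_iter_frame v rfl
      (fun i s' => (∀ g < i, s'.bun g = n + 1) ∧ ∀ g < i, ∀ p < n + n, s'.nat 3 p g = 0)
      (fun s' => (∀ g < m, s'.bun g = n + 1) ∧ ∀ g < m, ∀ p < n + n, s'.nat 3 p g = 0)
      (by simp) ?_ ?_
    · rintro i - s' hF ⟨h1, h2⟩
      have hn' : s'.nat 0 0 0 = n := by rw [hF.nat 0 (by decide), hn]
      rw [Cmd.run_seq]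
      refine Cmd.run_iter_frame v rfl
        (fun j s'' => ∀ g < i + 1, ∀ p, g < i ∧ p < n + n ∨ g = i ∧ p < j → s''.nat 3 p g = 0)
        (fun s' => (∀ g < i + 1, s'.bun g = n + 1) ∧ ∀ g < i + 1, ∀ p < n + n, s'.nat 3 p g = 0)
        ?_ ?_ ?_
      · intro g _ p hp
        have : (s'.nat 3 p g) = 0 := h2 g (by omega) p (by omega)
        simpa [Cmd.run] using this
      · intro j _ s'' hF' h g hg p hp
        have h21 : s''.nat 21 0 0 = i := by
          rw [hF'.nat 21 (by decide)]
          simp [Cmd.run]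
        simp only [Cmd.run, var_eval, num_eval, State.setN_nat]
        norm_num [h21]
        intro h3
        exact h g hg p (by omega)
      · intro s'' hF' h
        constructor
        · intro g hg
          have : s''.bun g = n + 1 := by
            rw [State.bun, hF'.nat 1 (by decide)]
            simp only [Cmd.run, var_eval, num_eval, State.setN_nat, add_eval, nExp_eval]
            norm_num [hn']
            intro hgi
            exact h1 g (by omega)
          simpa [State.bun] using this
        · intro g hg p hp
          have := h g hg p (by simp only [Bnd.eval]; omega)
          simpa using this
    · rintro s' - ⟨h1, h2⟩
      exact ⟨by simpa [State.bun] using h1, by simpa using h2⟩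
  have h2 : ∀ a < n, s2.att a = 0 := by
    refine Cmd.run_iter_frame v rfl (fun i s' => ∀ a < i, s'.att a = 0)
      (fun s' => ∀ a < n, s'.att a = 0) (by simp) ?_ ?_
    · intro i _ s' _ h a ha
      simp only [State.att, Cmd.run, var_eval, num_eval, State.setN_nat]
      norm_num
      intro hai
      exact h a (by omega)
    · intro s' _ h
      simpa [State.att] using h
  have h3 : ∀ k < n + 1, ∀ b < n, s3.nat 2 k b = b := by
    refine Cmd.run_iter_frame v rfl (fun i s' => ∀ k < i, ∀ b < n, s'.nat 2 k b = b)
      (fun s' => ∀ k < n + 1, ∀ b < n, s'.nat 2 k b = b) (by simp) ?_ ?_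
    · intro i _ s' hF h
      refine Cmd.run_iter_frame v rfl
        (fun j s'' => ∀ k < i + 1, ∀ b, k < i ∧ b < n ∨ k = i ∧ b < j → s''.nat 2 k b = b)
        (fun s' => ∀ k < i + 1, ∀ b < n, s'.nat 2 k b = b) ?_ ?_ ?_
      · intro k _ b hb
        simpa using h k (by omega) b (by omega)
      · intro j _ s'' hF' h k hk b hb
        have h22 : s''.nat 22 0 0 = i := by
          rw [hF'.nat 22 (by decide)]
          simp
        simp only [Cmd.run, var_eval, State.setN_nat]
        norm_num [h22]
        split_ifs with h4
        · exact h4.2.symm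
        · exact h k hk b (by omega)
      · intro s'' hF' h k hk b hb
        simpa using h k hk b (by simp only [Bnd.eval]; omega)
    · intro s' _ h
      simpa using h
  have hF2 := c2.frame v s1
  have hF3 := c3.frame v s2
  refine ⟨fun g hg => ?_, fun p hp g hg => ?_, fun a ha => ?_, fun k hk b hb => ?_, ?_⟩
  · simp only [State.bun, Cmd.run]
    rw [State.setN_nat_ne _ _ _ _ (by omega), hF3.nat 1 (by decide), hF2.nat 1 (by decide)]
    exact h1.1 g hg
  · simp only [Cmd.run]
    rw [State.setN_nat_ne _ _ _ _ (by omega), hF3.nat 3 (by decide), hF2.nat 3 (by decide)]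
    exact h1.2 g hg p hp
  · simp only [State.att, Cmd.run]
    rw [State.setN_nat_ne _ _ _ _ (by omega), hF3.nat 5 (by decide)]
    exact h2 a ha
  · simp only [Cmd.run]
    rw [State.setN_nat_ne _ _ _ _ (by omega)]
    exact h3 k (by omega) b hb
  · simp [Cmd.run]

/-- The tree building ends in a state without live agents. -/
lemma buildTree_spec (s : State) (hn : s.nat 0 0 0 = n) (h1 : ∀ g < m, s.bun g = n + 1)
    (h2 : ∀ a < n, s.att a = 0) (h3 : ∀ k ≤ n, ∀ b < n, s.nat 2 k b = b) (s' : State)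
    (hs' : s' = (Cmd.iter 27 .vm growTree).run v s) :
    CountInv n m s'.bun s'.att s.Big ∧ MatchInv n m s'.bun s'.att s.Big (s'.nat 2) ∧
      ∀ a : Fin n, ¬ Live n m s'.bun s'.att s.Big a := by
  subst hs'
  refine Cmd.run_iter_frame (N := m) v rfl
    (fun i s' => CountInv n m s'.bun s'.att s.Big ∧ MatchInv n m s'.bun s'.att s.Big (s'.nat 2) ∧
      (i ≤ (usedGoods n m s'.bun).card ∨ ∀ a : Fin n, ¬ Live n m s'.bun s'.att s.Big a))
    (fun s' => CountInv n m s'.bun s'.att s.Big ∧ MatchInv n m s'.bun s'.att s.Big (s'.nat 2) ∧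
      ∀ a : Fin n, ¬ Live n m s'.bun s'.att s.Big a)
    ⟨CountInv.init h1, MatchInv.init h1 h2 h3, by simp⟩ ?_ ?_
  · rintro i - s0 hF ⟨hC, hM, hP⟩
    set s1 := s0.setN 27 0 0 i with hs1
    have e0 : s1.nat 0 0 0 = n := by
      rw [hs1, State.setN_nat_ne _ _ _ _ (by omega), hF.nat 0 (by decide), hn]
    have e1 : s1.bun = s0.bun := by funext x; simp [hs1, State.bun]
    have e5 : s1.att = s0.att := by funext x; simp [hs1, State.att]
    have e2 : s1.nat 2 = s0.nat 2 := State.setN_nat_ne _ _ _ _ (by omega)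
    have eB : s1.Big = s.Big := by
      funext a g
      simp only [State.Big, hs1, State.setN_val, hF.val 0 (by decide), hF.val 1 (by decide)]
    have hg := growTree_spec (m := m) v s1 e0 (by rw [e1, e5, e2, eB]; exact hM)
    rw [e1, e5, e2, eB] at hg
    set s2 := growTree.run v s1 with hs2
    rcases hg with ⟨a, ha, g, hg, h, hh, hat, r1, r2, r3, r4, r5⟩ |
      ⟨hcl, r2, r3, ⟨a, ha, g, hg, h4, h5, h6, r1⟩ | ⟨hno, r1⟩⟩
    · have hnl : i ≤ (usedGoods n m s0.bun).card :=
        hP.resolve_right fun h' => h' ⟨a, ha⟩ ⟨hat.1, ⟨g, hg⟩, hat.2.1, hat.2.2.2.1⟩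
      refine ⟨?_, ?_, Or.inl ?_⟩
      · rw [r1, r2]
        exact hC.attach (a := ⟨a, ha⟩) (g := ⟨g, hg⟩) (h := ⟨h, hh⟩) hat (k := a) (by omega)
      · rw [r1, r2]
        exact hM.attach ha hg hh hat (fun k _ hka b _ => r3 k hka b) r4 r5
      · rw [r1, card_usedGoods_update (g := ⟨g, hg⟩) hat.2.1 (k := a) (by omega)]
        omega
    · have hnl : i ≤ (usedGoods n m s0.bun).card :=
        hP.resolve_right fun h' => h' ⟨a, ha⟩ ⟨h4, ⟨g, hg⟩, h5, h6⟩
      refine ⟨?_, ?_, Or.inl ?_⟩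
      · rw [r1, r2]
        exact hC.center hcl (a := ⟨a, ha⟩) (g := ⟨g, hg⟩) h4 h5 h6 (k := n) (by omega)
      · rw [r1, r2, r3]
        exact hM.center h5
      · rw [r1, card_usedGoods_update (g := ⟨g, hg⟩) h5 (k := n) (by omega)]
        omega
    · rw [r1, r2, r3]
      exact ⟨hC, hM, Or.inr hno⟩
  · rintro s0 - ⟨hC, hM, hP⟩
    have e1 : (s0.setN 27 0 0 m).bun = s0.bun := by funext x; simp [State.bun]
    have e5 : (s0.setN 27 0 0 m).att = s0.att := by funext x; simp [State.att]
    have e2 : (s0.setN 27 0 0 m).nat 2 = s0.nat 2 := State.setN_nat_ne _ _ _ _ (by omega)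
    rw [e1, e5, e2]
    refine ⟨hC, hM, ?_⟩
    rcases hP with hP | hP
    · have hall : usedGoods n m s0.bun = Finset.univ :=
        (Finset.card_eq_iff_eq_univ _).1 (le_antisymm (Finset.card_le_univ _)
          (by rwa [Fintype.card_fin]))
      rintro a ⟨-, g, hg, -⟩
      have : g ∈ usedGoods n m s0.bun := by rw [hall]; exact Finset.mem_univ g
      simp [usedGoods, hg] at this
    · exact hP

end

/-! ### Correctness of the round robin -/

section
variable {n m : ℕ} (v : Fin n → Finset (Fin m) → ℝ)

/-- The agent on whose behalf player `p` of the round robin moves. -/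
def agentOf (n p : ℕ) : ℕ := if p < n then p else p - n

/-- The bundle that receives the goods of player `p`. -/
def targetOf (n p : ℕ) : ℕ := if p < n then p else n

lemma goods_setN (s : State) {l p : ℕ} (g : Fin m) {x : ℕ} (hx : x ≠ 0) :
    (s.setN l p g x).goods m l p = insert g (s.goods m l p) := by
  ext g'
  simp only [State.goods, Finset.mem_filter, Finset.mem_univ, true_and, Finset.mem_insert,
    State.setN_nat]
  by_cases h : g' = g
  · simp [h, hx]
  · have : (g' : ℕ) ≠ g := fun h' => h (Fin.ext h')
    simp [h, this]

/-- The search finds an available good of largest marginal value for the player, or there is no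
available good. The row of the player is restored. -/
lemma findBest_spec (s : State) (hn : s.nat 0 0 0 = n) {p a : ℕ} (hp : s.nat 23 0 0 = p)
    (ha : s.nat 11 0 0 = a) (hrow : ∀ g < m, s.bun g = n + 1 → s.nat 3 p g = 0) (s' : State)
    (hs' : s' = findBest.run v s) :
    s'.nat 3 = s.nat 3 ∧
    ((s'.nat 7 0 0 = 1 ∧ ∃ g : Fin m, s'.nat 9 0 0 = g ∧ s.bun g = n + 1 ∧
      ∀ g' : Fin m, s.bun g' = n + 1 → oracle v a (insert g' (s.goods m 3 p)) ≤
        oracle v a (insert g (s.goods m 3 p))) ∨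
    (s'.nat 7 0 0 = 0 ∧ ∀ g : Fin m, s.bun g ≠ n + 1)) := by
  subst hs'
  rw [findBest, Cmd.run_seq]
  set s1 := (Cmd.setNat 7 (num 0) (num 0) (num 0)).run v s with hs1
  have e10 : ∀ k, k ≠ 7 → s1.nat k = s.nat k := fun k hk => State.setN_nat_ne _ _ _ _ hk
  set G : ℕ → State → Prop := fun i s' => s'.nat 3 = s.nat 3 ∧
    ((s'.nat 7 0 0 = 1 ∧ ∃ g : Fin m, s'.nat 9 0 0 = g ∧ s.bun g = n + 1 ∧
      s'.val 3 0 0 = oracle v a (insert g (s.goods m 3 p)) ∧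
      ∀ g' : Fin m, (g' : ℕ) < i → s.bun g' = n + 1 → oracle v a (insert g' (s.goods m 3 p)) ≤
        oracle v a (insert g (s.goods m 3 p))) ∨
    (s'.nat 7 0 0 = 0 ∧ ∀ g : Fin m, (g : ℕ) < i → s.bun g ≠ n + 1)) with hG
  refine Cmd.run_iter_frame v rfl G
    (fun s' => s'.nat 3 = s.nat 3 ∧
      ((s'.nat 7 0 0 = 1 ∧ ∃ g : Fin m, s'.nat 9 0 0 = g ∧ s.bun g = n + 1 ∧
        ∀ g' : Fin m, s.bun g' = n + 1 → oracle v a (insert g' (s.goods m 3 p)) ≤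
          oracle v a (insert g (s.goods m 3 p))) ∨
      (s'.nat 7 0 0 = 0 ∧ ∀ g : Fin m, s.bun g ≠ n + 1)))
    ⟨e10 3 (by omega), Or.inr ⟨by simp [hs1, Cmd.run], by simp⟩⟩
    ?_ ?_
  · rintro i hi s2 hF ⟨h3, hI⟩
    have hi : i < m := hi
    have e0 : s2.nat 0 0 0 = n := by rw [hF.nat 0 (by decide), e10 0 (by omega), hn]
    have e1 : s2.nat 1 = s.nat 1 := by rw [hF.nat 1 (by decide), e10 1 (by omega)]
    have e23 : s2.nat 23 0 0 = p := by rw [hF.nat 23 (by decide), e10 23 (by omega), hp]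
    have e11 : s2.nat 11 0 0 = a := by rw [hF.nat 11 (by decide), e10 11 (by omega), ha]
    rw [Cmd.run]
    split_ifs with hb
    · have hbun : s.bun i = n + 1 := by simpa [e0, e1, State.bun] using hb
      set s3 := s2.setN 21 0 0 i with hs3
      rw [Cmd.run_seq, Cmd.run_seq, Cmd.run_seq]
      set s4 := (Cmd.setNat 3 (var 23) (var 21) (num 1)).run v s3 with hs4
      set s5 := (Cmd.query 4 (num 0) (num 0) (var 11) 3 (var 23)).run v s4 with hs5
      set s6 := (Cmd.setNat 3 (var 23) (var 21) (num 0)).run v s5 with hs6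
      have f4 : s4 = s3.setN 3 p i 1 := by simp [hs4, hs3, Cmd.run, e23]
      have fg : s4.goods m 3 p = insert ⟨i, hi⟩ (s.goods m 3 p) := by
        have := goods_setN s3 (l := 3) (p := p) (⟨i, hi⟩ : Fin m) one_ne_zero
        rw [f4, this]
        congr 1
        ext g
        simp [State.goods, hs3, h3]
      have f5 : s6.val 4 0 0 = oracle v a (insert ⟨i, hi⟩ (s.goods m 3 p)) := by
        rw [← fg]
        simp [hs6, hs5, Cmd.run, f4, hs3, e23, e11]
      have f6 : s6.nat 3 = s.nat 3 := by
        funext x y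
        simp only [hs6, hs5, Cmd.run, var_eval, num_eval, State.setV_nat, f4, hs3, State.setN_nat]
        norm_num [e23, h3]
        split_ifs with hxy
        · rw [hxy.1, hxy.2]
          exact (hrow i hi hbun).symm
        · rfl
      have f7 : s6.nat 7 = s2.nat 7 := by
        funext x y
        simp [hs6, hs5, Cmd.run, f4, hs3]
      have f9 : s6.nat 9 = s2.nat 9 := by
        funext x y
        simp [hs6, hs5, Cmd.run, f4, hs3]
      have f21 : s6.nat 21 0 0 = i := by
        simp [hs6, hs5, Cmd.run, f4, hs3]
      have fv : s6.val 3 0 0 = s2.val 3 0 0 := by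
        simp [hs6, hs5, Cmd.run, f4, hs3]
      rw [Cmd.run]
      split_ifs with hc
      · simp only [conj_holds, natEq_holds, var_eval, num_eval, valLe_holds, rvar_eval, f5, f7,
          fv] at hc
        refine ⟨f6, Or.inl ?_⟩
        rcases hI with ⟨h7, g, h9, hg, hv, hall⟩ | ⟨h7, -⟩
        · refine ⟨?_, g, ?_, hg, ?_, fun g' hg' hu => ?_⟩
          · simpa [Cmd.run, f7] using h7
          · simpa [Cmd.run, f9] using h9
          · simpa [Cmd.run, fv] using hv
          · rcases Nat.lt_succ_iff_lt_or_eq.1 hg' with h | h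
            · exact hall g' h hu
            · have : g' = ⟨i, hi⟩ := Fin.ext h
              rw [this, ← hv]
              exact hc.2
        · omega
      · simp only [conj_holds, natEq_holds, var_eval, num_eval, valLe_holds, rvar_eval, f5, f7,
          fv] at hc
        refine ⟨?_, Or.inl ⟨?_, ⟨i, hi⟩, ?_, hbun, ?_, fun g' hg' hu => ?_⟩⟩
        · rw [← f6]
          funext x y
          simp [Cmd.run]
        · simp [Cmd.run]
        · simp [Cmd.run, f21]
        · simp [Cmd.run, f5]
        · rcases Nat.lt_succ_iff_lt_or_eq.1 hg' with h | h
          · rcases hI with ⟨h7, g, h9, hg, hv, hall⟩ | ⟨h7, hno⟩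
            · refine (hall g' h hu).trans ?_
              rw [← hv]
              by_contra hlt
              exact hc ⟨h7, (not_le.1 hlt).le⟩
            · exact absurd hu (hno g' h)
          · have : g' = ⟨i, hi⟩ := Fin.ext h
            rw [this]
    · have hbun : s.bun i ≠ n + 1 := by simpa [e0, e1, State.bun] using hb
      refine ⟨?_, hI.imp ?_ ?_⟩
      · rw [← h3]
        funext x y
        simp [Cmd.run]
      · rintro ⟨h7, g, h9, hg, hv, hall⟩
        refine ⟨by simpa [Cmd.run] using h7, g, by simpa [Cmd.run] using h9, hg,
          by simpa [Cmd.run] using hv, fun g' hg' hu => ?_⟩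
        rcases Nat.lt_succ_iff_lt_or_eq.1 hg' with h | h
        · exact hall g' h hu
        · exact absurd (h ▸ hu) hbun
      · rintro ⟨h7, hno⟩
        refine ⟨by simpa [Cmd.run] using h7, fun g hg hu => ?_⟩
        rcases Nat.lt_succ_iff_lt_or_eq.1 hg with h | h
        · exact hno g h hu
        · exact hbun (h ▸ hu)
  · rintro s2 hF ⟨h3, hI⟩
    refine ⟨?_, hI.imp ?_ ?_⟩
    · rw [← h3]
      funext x y
      simp
    · rintro ⟨h7, g, h9, hg, -, hall⟩
      exact ⟨by simpa using h7, g, by simpa using h9, hg, fun g' hu => hall g' g'.2 hu⟩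
    · rintro ⟨h7, hno⟩
      exact ⟨by simpa using h7, fun g hu => hno g g.2 hu⟩

/-- In her turn, a player picks an available good of largest marginal value, unless she is inactive
or there is none. -/
lemma turn_spec (s : State) (hn : s.nat 0 0 0 = n) {p : ℕ} (hp : s.nat 23 0 0 = p)
    (hrow : ∀ g < m, s.bun g = n + 1 → s.nat 3 p g = 0) (s' : State) (hs' : s' = turn.run v s) :
    ((s.att (agentOf n p) ≠ 0 ∨ ∀ g : Fin m, s.bun g ≠ n + 1) ∧
      s'.bun = s.bun ∧ s'.nat 3 = s.nat 3) ∨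
    (s.att (agentOf n p) = 0 ∧ ∃ g : Fin m, s.bun g = n + 1 ∧
      (∀ g' : Fin m, s.bun g' = n + 1 →
        oracle v (agentOf n p) (insert g' (s.goods m 3 p)) ≤
          oracle v (agentOf n p) (insert g (s.goods m 3 p))) ∧
      s'.bun = Function.update s.bun g (targetOf n p) ∧
      s'.nat 3 = (s.setN 3 p g 1).nat 3) := by
  subst hs'
  rw [turn, Cmd.run_seq]
  set c1 : Cmd := .cond (natLt (var 23) nExp)
    (.setNat 11 (num 0) (num 0) (var 23) ;; .setNat 12 (num 0) (num 0) (var 23))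
    (.setNat 11 (num 0) (num 0) (.sub (var 23) nExp) ;; .setNat 12 (num 0) (num 0) nExp) with hc1
  have hF1 := c1.frame v s
  have h1 : (c1.run v s).nat 11 0 0 = agentOf n p ∧ (c1.run v s).nat 12 0 0 = targetOf n p := by
    simp only [hc1, Cmd.run, natLt_holds, var_eval, nExp_eval, hn, hp, agentOf, targetOf]
    split_ifs with h
    · simp [hp]
    · simp [hp, hn]
  set s1 := c1.run v s with hs1
  have e1 : s1.bun = s.bun := by funext x; simp only [State.bun, hF1.nat 1 (by decide)]
  have e5 : s1.att = s.att := by funext x; simp only [State.att, hF1.nat 5 (by decide)]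
  have e3 : s1.nat 3 = s.nat 3 := hF1.nat 3 (by decide)
  have e0 : s1.nat 0 0 0 = n := by rw [hF1.nat 0 (by decide), hn]
  have e23 : s1.nat 23 0 0 = p := by rw [hF1.nat 23 (by decide), hp]
  have eg : s1.goods m 3 p = s.goods m 3 p := by simp only [State.goods, e3]
  rw [Cmd.run]
  have hatt : (natEq (NatExp.get 5 (var 11) (num 0)) (num 0)).Holds s1 ↔
      s.att (agentOf n p) = 0 := by
    rw [← e5]
    simp [h1.1, State.att]
  split_ifs with hc
  · rw [hatt] at hc
    rw [Cmd.run_seq]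
    have hF2 := findBest.frame v s1
    obtain ⟨g3, hfb⟩ := findBest_spec v s1 e0 e23 h1.1 (by rw [e1, e3]; exact hrow) _ rfl
    rw [e1, eg] at hfb
    set s2 := findBest.run v s1 with hs2
    rw [e3] at g3
    have g1 : s2.bun = s.bun := by rw [← e1]; funext x; simp only [State.bun, hF2.nat 1 (by decide)]
    have g23 : s2.nat 23 0 0 = p := by rw [hF2.nat 23 (by decide), e23]
    have g12 : s2.nat 12 0 0 = targetOf n p := by rw [hF2.nat 12 (by decide), h1.2]
    rcases hfb with ⟨h7, g, h9, hg, hmax⟩ | ⟨h7, hno⟩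
    · right
      refine ⟨hc, g, hg, hmax, ?_⟩
      simp only [Cmd.run]
      rw [if_pos (by simpa using h7)]
      constructor
      · rw [← g1]
        funext x
        simp [State.bun, Function.update_apply, h9, g12]
      · funext x y
        simp [g23, h9, g3]
    · left
      simp only [Cmd.run]
      rw [if_neg (by simp [h7])]
      exact ⟨Or.inr hno, g1, g3⟩
  · rw [hatt] at hc
    exact Or.inl ⟨Or.inl hc, e1, e3⟩

end

section
variable {n m : ℕ} {v : Fin n → Finset (Fin m) → ℝ}

lemma oracle_of_lt (v : Fin n → Finset (Fin m) → ℝ) (a : Fin n) : oracle v a = v a := by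
  funext S
  simp [oracle]

lemma oracle_nonneg (hnn : ∀ a S, 0 ≤ v a S) (a : ℕ) (S : Finset (Fin m)) : 0 ≤ oracle v a S := by
  unfold oracle
  split_ifs
  · exact hnn _ _
  · exact le_rfl

lemma oracle_monotone (hmono : ∀ a, Monotone (v a)) (a : ℕ) : Monotone (oracle v a) := by
  intro S T hST
  unfold oracle
  split_ifs
  · exact hmono _ hST
  · exact le_rfl

lemma oracle_submodular (hsub : ∀ a, IsSubmodular (v a)) (a : ℕ) : IsSubmodular (oracle v a) := by
  intro S T
  unfold oracle
  split_ifs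
  · exact hsub _ S T
  · simp

/-- The invariant of the round robin in round `r` when player `p` moves. The tree has been built in
the state `s₀`. -/
structure RRState (v : Fin n → Finset (Fin m) → ℝ) (θ : ℕ → ℝ) (s₀ : State) (r p : ℕ)
    (s : State) : Prop where
  inv : RRInv (fun q => oracle v (agentOf n q)) θ (fun q => s₀.att (agentOf n q) = 0) (n + n)
    (usedGoods n m s₀.bun)ᶜ p (fun q => s.goods m 3 q) (usedGoods n m s.bun)ᶜ
  rows : ∀ q < n + n, ∀ g < m, s.nat 3 q g ≠ 0 → s.bun g = targetOf n q
  keep : ∀ g < m, s₀.bun g ≠ n + 1 → s.bun g = s₀.bun g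
  le : ∀ g < m, s.bun g ≤ n + 1
  /-- If there is an active player, then each round distributes a good while there are any. -/
  progress : ∀ q < n + n, s₀.att (agentOf n q) = 0 →
    (usedGoods n m s.bun)ᶜ = ∅ ∨
      (usedGoods n m s.bun)ᶜ.card + r + (if q < p then 1 else 0) ≤ m

lemma RRState.congr {θ : ℕ → ℝ} {s₀ s s' : State} {r p : ℕ} (h : RRState v θ s₀ r p s)
    (h1 : s'.bun = s.bun) (h3 : s'.nat 3 = s.nat 3) : RRState v θ s₀ r p s' := by
  have hg : ∀ q, s'.goods m 3 q = s.goods m 3 q := fun q => by simp only [State.goods, h3]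
  refine ⟨?_, ?_, ?_, ?_, ?_⟩
  · simp only [hg, h1]; exact h.inv
  · rw [h1, h3]; exact h.rows
  · rw [h1]; exact h.keep
  · rw [h1]; exact h.le
  · rw [h1]; exact h.progress

lemma targetOf_le (n p : ℕ) : targetOf n p ≤ n := by
  unfold targetOf
  split_ifs <;> omega

lemma RRState.step {θ : ℕ → ℝ} {s₀ s : State} {r p : ℕ} (hmono : ∀ a, Monotone (v a))
    (hsub : ∀ a, IsSubmodular (v a)) (h : RRState v θ s₀ r p s)
    (hn : s.nat 0 0 0 = n) (hp : s.nat 23 0 0 = p) (hpn : p < n + n) (hatt : s.att = s₀.att) :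
    RRState v θ s₀ r (p + 1) (turn.run v s) := by
  have hrow : ∀ g < m, s.bun g = n + 1 → s.nat 3 p g = 0 := by
    intro g hg hb
    by_contra hne
    have h1 := h.rows p hpn g hg hne
    have h2 := targetOf_le n p
    omega
  rcases turn_spec v s hn hp hrow _ rfl with ⟨hno, h1, h3⟩ | ⟨ha, g, hg, hmax, h1, h3⟩
  · refine RRState.congr (s := s) ⟨?_, h.rows, h.keep, h.le, fun q hq hqa => ?_⟩ h1 h3
    · by_cases hact : s₀.att (agentOf n p) = 0
      · have he : (usedGoods n m s.bun)ᶜ = ∅ := by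
          rcases hno with hno | hno
          · exact absurd hact (hatt ▸ hno)
          · simp [usedGoods, hno]
        have hi := h.inv
        rw [he] at hi ⊢
        exact hi.empty hact
      · exact h.inv.inactive hact
    · rcases hno with hno | hno
      · have hqp : q ≠ p := by
          rintro rfl
          exact hno (hatt ▸ hqa)
        have : (q < p + 1) ↔ (q < p) := by omega
        simp only [this]
        exact h.progress q hq hqa
      · left
        simp [usedGoods, hno]
  · have hk : targetOf n p ≠ n + 1 := by have := targetOf_le n p; omega
    have hW : (usedGoods n m (turn.run v s).bun)ᶜ = (usedGoods n m s.bun)ᶜ.erase g := by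
      rw [h1, usedGoods_update hk, Finset.compl_insert]
    have hgW : g ∈ (usedGoods n m s.bun)ᶜ := by simp [usedGoods, hg]
    have hB : (fun q => (turn.run v s).goods m 3 q) =
        Function.update (fun q => s.goods m 3 q) p (insert g (s.goods m 3 p)) := by
      funext q
      by_cases hq : q = p
      · subst hq
        rw [Function.update_self, ← goods_setN s g one_ne_zero]
        simp only [State.goods, h3]
      · rw [Function.update_of_ne hq]
        simp only [State.goods, h3, State.setN_nat]
        simp [hq]
    refine ⟨?_, fun q hq g' hg' hne => ?_, fun g' hg' hu => ?_, fun g' hg' => ?_,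
      fun q hq hqa => ?_⟩
    · rw [hB, hW]
      refine h.inv.pick (fun q => oracle_monotone hmono _) (fun q => oracle_submodular hsub _)
        (hatt ▸ ha) hgW ?_ ?_
      · intro x hx
        simp only [usedGoods, Finset.mem_compl, Finset.mem_filter, Finset.mem_univ, true_and,
          not_not] at hx ⊢
        by_contra hne
        exact hne ((h.keep x x.2 hne).symm.trans hx)
      · intro g' hg'
        refine hmax g' ?_
        simpa [usedGoods] using hg'
    · rw [h3] at hne
      rw [h1]
      by_cases hgg : g' = g
      · rw [hgg, Function.update_self]
        by_cases hqp : q = p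
        · rw [hqp]
        · simp only [State.setN_nat, hqp] at hne
          have h4 := h.rows q hq g' hg' (by simpa using hne)
          have h5 := targetOf_le n q
          rw [hgg] at h4
          omega
      · rw [Function.update_of_ne hgg]
        exact h.rows q hq g' hg' (by simpa [hgg] using hne)
    · rw [h1, Function.update_of_ne]
      · exact h.keep g' hg' hu
      · rintro rfl
        exact hu ((h.keep g g.2 hu).symm.trans hg)
    · rw [h1]
      by_cases hgg : g' = g
      · rw [hgg, Function.update_self]
        have := targetOf_le n p
        omega
      · rw [Function.update_of_ne hgg]
        exact h.le g' hg'
    · right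
      rw [hW, Finset.card_erase_of_mem hgW]
      have hpos := Finset.card_pos.2 ⟨g, hgW⟩
      rcases h.progress q hq hqa with he | he
      · rw [he] at hgW
        simp at hgW
      · split_ifs at he ⊢ <;> omega

/-- The bags end up in their target bundles, the tree is left alone, and the marginal values over
each bag of an active player are bounded in terms of its value. -/
lemma roundRobin_spec (s₀ : State) (θ : ℕ → ℝ) (hnn : ∀ a S, 0 ≤ v a S)
    (hmono : ∀ a, Monotone (v a)) (hsub : ∀ a, IsSubmodular (v a)) (hn : s₀.nat 0 0 0 = n)
    (hrow : ∀ p < n + n, ∀ g < m, s₀.nat 3 p g = 0) (hle : ∀ g < m, s₀.bun g ≤ n + 1)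
    (hθ : ∀ p < n + n, s₀.att (agentOf n p) = 0 → 0 ≤ θ p ∧
      ∀ g ∈ (usedGoods n m s₀.bun)ᶜ, oracle v (agentOf n p) {g} ≤ θ p) (s : State)
    (hs : s = roundRobin.run v s₀) :
    (∀ q < n + n, ∀ g < m, s.nat 3 q g ≠ 0 → s.bun g = targetOf n q) ∧
    (∀ g < m, s₀.bun g ≠ n + 1 → s.bun g = s₀.bun g) ∧ (∀ g < m, s.bun g ≤ n + 1) ∧
    ∀ p < n + n, s₀.att (agentOf n p) = 0 →
      ∑ g ∈ (usedGoods n m s₀.bun)ᶜ, marg (oracle v (agentOf n p)) g (s.goods m 3 p) ≤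
        actBelow (fun q => s₀.att (agentOf n q) = 0) (n + n) *
          (oracle v (agentOf n p) (s.goods m 3 p) + θ p) := by
  have hend : RRState v θ s₀ m 0 s := by
    subst hs
    have hbegin : RRState v θ s₀ 0 0 s₀ := by
      refine ⟨?_, ?_, fun _ _ _ => rfl, hle, fun q _ _ => Or.inr ?_⟩
      · exact RRInv.init (fun _ S => oracle_nonneg hnn _ S) (fun _ => oracle_monotone hmono _)
          (fun _ => oracle_submodular hsub _) (fun p hp ha => (hθ p hp ha).1)
          (fun p hp ha => (hθ p hp ha).2)
      · intro q hq g hg hne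
        exact absurd (hrow q hq g hg) hne
      · have := Finset.card_le_univ (usedGoods n m s₀.bun)ᶜ
        rw [Fintype.card_fin] at this
        simpa using this
    refine Cmd.run_iter_frame (N := m) v rfl (fun r s => RRState v θ s₀ r 0 s)
      (fun s => RRState v θ s₀ m 0 s) hbegin ?_ ?_
    · intro r _ s1 hF h
      refine Cmd.run_iter_frame (N := n + n) v rfl (fun p s => RRState v θ s₀ r p s)
        (fun s => RRState v θ s₀ (r + 1) 0 s) ?_ ?_ ?_
      · refine h.congr ?_ (State.setN_nat_ne _ _ _ _ (by omega))
        funext x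
        simp [State.bun]
      · intro p hp s2 hF2 h2
        refine RRState.step hmono hsub
          (h2.congr ?_ (State.setN_nat_ne _ _ _ _ (by omega))) ?_ ?_ hp ?_
        · funext x
          simp [State.bun]
        · rw [State.setN_nat_ne _ _ _ _ (by omega), hF2.nat_set (by decide) (by omega),
            hF.nat 0 (by decide), hn]
        · simp
        · funext x
          simp only [State.att]
          rw [State.setN_nat_ne _ _ _ _ (by omega), hF2.nat_set (by decide) (by omega),
            hF.nat 5 (by decide)]
      · intro s2 _ h2
        refine RRState.congr (s := s2)
          ⟨h2.inv.round, h2.rows, h2.keep, h2.le, fun q hq hqa => ?_⟩ ?_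
          (State.setN_nat_ne _ _ _ _ (by omega))
        · have := h2.progress q hq hqa
          rw [if_pos hq] at this
          simpa [add_assoc] using this
        · funext x
          simp [State.bun]
    · intro s1 _ h
      refine h.congr ?_ (State.setN_nat_ne _ _ _ _ (by omega))
      funext x
      simp [State.bun]
  refine ⟨hend.rows, hend.keep, hend.le, fun p hp ha => ?_⟩
  have hW : (usedGoods n m s.bun)ᶜ = ∅ := by
    rcases hend.progress p hp ha with h | h
    · exact h
    · rw [← Finset.card_eq_zero]
      omega
  have hi := hend.inv
  rw [hW] at hi
  exact hi.final hp ha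

end

/-! ### Correctness of the final check -/

section
variable {n m : ℕ} {v : Fin n → Finset (Fin m) → ℝ}

lemma finish_spec (v : Fin n → Finset (Fin m) → ℝ) (s : State) (hn : s.nat 0 0 0 = n) (s' : State)
    (hs' : s' = finish.run v s) :
    (∀ g < m, s'.bun g = if s.bun g = n + 1 then n else s.bun g) ∧
    ∀ k b, s'.nat 2 k b = if k < n ∧ b = k ∧ s.att k = 0 then n else s.nat 2 k b := by
  subst hs'
  rw [finish, Cmd.run_seq]
  set c1 : Cmd := .iter 21 .vm (.cond (natEq (.get 1 (var 21) (num 0)) (.add nExp (num 1)))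
    (.setNat 1 (var 21) (num 0) nExp) .skip) with hc1
  have hF1 := c1.frame v s
  have h1 : ∀ g, (c1.run v s).bun g = if g < m ∧ s.bun g = n + 1 then n else s.bun g := by
    refine Cmd.run_iter_frame (N := m) v rfl
      (fun i s' => ∀ g, s'.bun g = if g < i ∧ s.bun g = n + 1 then n else s.bun g)
      (fun s' => ∀ g, s'.bun g = if g < m ∧ s.bun g = n + 1 then n else s.bun g) (by simp) ?_ ?_
    · intro i hi s1 hF h g
      have e0 : s1.nat 0 0 0 = n := by rw [hF.nat 0 (by decide), hn]
      have hii := h i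
      have hg := h g
      simp only [lt_irrefl, false_and, if_false] at hii
      simp only [State.bun] at hg hii ⊢
      simp only [Cmd.run]
      by_cases hgi : g = i
      · subst hgi
        have hc : (natEq (.get 1 (var 21) (num 0)) (.add nExp (num 1))).Holds (s1.setN 21 0 0 g) ↔
            s.nat 1 g 0 = n + 1 := by
          simp [hii, e0]
        by_cases hb : s.nat 1 g 0 = n + 1
        · rw [if_pos (hc.2 hb)]
          simp [e0, hb]
        · rw [if_neg (mt hc.1 hb)]
          simp [hb, hii]
      · have hlt : (g < i + 1) ↔ (g < i) := by omega
        simp only [hlt]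
        refine Eq.trans ?_ hg
        split_ifs <;> simp [hgi]
    · intro s1 _ h
      simpa [State.bun] using h
  set s1 := c1.run v s with hs1
  set c2 : Cmd := .iter 20 .vn (.cond (natEq (.get 5 (var 20) (num 0)) (num 0))
    (.setNat 2 (var 20) (var 20) nExp) .skip) with hc2
  have hF2 := c2.frame v s1
  have h2 : ∀ k b, (c2.run v s1).nat 2 k b =
      if k < n ∧ b = k ∧ s.att k = 0 then n else s.nat 2 k b := by
    refine Cmd.run_iter_frame (N := n) v rfl
      (fun i s' => ∀ k b, s'.nat 2 k b = if k < i ∧ b = k ∧ s.att k = 0 then n else s.nat 2 k b)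
      (fun s' => ∀ k b, s'.nat 2 k b = if k < n ∧ b = k ∧ s.att k = 0 then n else s.nat 2 k b)
      (by simp [hF1.nat 2 (by decide)]) ?_ ?_
    · intro i hi s2 hF h k b
      have e0 : s2.nat 0 0 0 = n := by rw [hF.nat 0 (by decide), hF1.nat 0 (by decide), hn]
      have e5 : s2.nat 5 = s.nat 5 := by rw [hF.nat 5 (by decide), hF1.nat 5 (by decide)]
      have hii := h i i
      have hkb := h k b
      simp only [lt_irrefl, false_and, if_false] at hii
      simp only [State.att] at hkb ⊢
      simp only [Cmd.run]
      by_cases hki : k = i ∧ b = i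
      · obtain ⟨rfl, rfl⟩ := hki
        have hc : (natEq (.get 5 (var 20) (num 0)) (num 0)).Holds (s2.setN 20 0 0 b) ↔
            s.nat 5 b 0 = 0 := by
          simp [e5]
        by_cases hb : s.nat 5 b 0 = 0
        · rw [if_pos (hc.2 hb)]
          simp [e0, hb]
        · rw [if_neg (mt hc.1 hb)]
          simp [hb, hii]
      · have hlt : (k < i + 1 ∧ b = k ∧ s.nat 5 k 0 = 0) ↔ (k < i ∧ b = k ∧ s.nat 5 k 0 = 0) := by
          omega
        simp only [hlt]
        refine Eq.trans ?_ hkb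
        split_ifs <;> simp [hki]
    · intro s2 _ h
      simpa using h
  refine ⟨fun g hg => ?_, h2⟩
  simp only [State.bun, hF2.nat 1 (by decide)]
  have := h1 g
  simp only [hg, true_and, State.bun] at this
  exact this

/-- The bags of agent `a` are good enough. -/
def BagsOK (v : Fin n → Finset (Fin m) → ℝ) (s : State) (a : ℕ) : Prop :=
  s.val 1 a 0 ≤ 19 * oracle v a (s.goods m 3 a) ∧
    s.val 1 a 0 ≤ 19 * oracle v a (s.goods m 3 (n + a))

lemma check_spec (v : Fin n → Finset (Fin m) → ℝ) (s : State) (hn : s.nat 0 0 0 = n) (s' : State)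
    (hs' : s' = check.run v s) :
    (∀ a < n, s'.val 1 a 0 = s.val 1 a 0 ∨
      s.att a = 0 ∧ ¬ BagsOK v s a ∧ s'.val 1 a 0 = s.val 1 a 0 - s.val 2 a 0) ∧
    ((s'.nat 6 0 0 = s.nat 6 0 0 ∧
        ∀ a < n, s'.val 1 a 0 = s.val 1 a 0 ∧ (s.att a = 0 → BagsOK v s a)) ∨
      (s'.nat 6 0 0 = 0 ∧ ∃ a < n,
        s.att a = 0 ∧ ¬ BagsOK v s a ∧ s'.val 1 a 0 = s.val 1 a 0 - s.val 2 a 0)) := by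
  subst hs'
  refine Cmd.run_iter_frame (N := n) v rfl
    (fun i s' => (∀ a, i ≤ a → s'.val 1 a 0 = s.val 1 a 0) ∧
      (∀ a < i, s'.val 1 a 0 = s.val 1 a 0 ∨
        s.att a = 0 ∧ ¬ BagsOK v s a ∧ s'.val 1 a 0 = s.val 1 a 0 - s.val 2 a 0) ∧
      ((s'.nat 6 0 0 = s.nat 6 0 0 ∧
          ∀ a < i, s'.val 1 a 0 = s.val 1 a 0 ∧ (s.att a = 0 → BagsOK v s a)) ∨
        (s'.nat 6 0 0 = 0 ∧ ∃ a < i,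
          s.att a = 0 ∧ ¬ BagsOK v s a ∧ s'.val 1 a 0 = s.val 1 a 0 - s.val 2 a 0)))
    (fun s' => (∀ a < n, s'.val 1 a 0 = s.val 1 a 0 ∨
        s.att a = 0 ∧ ¬ BagsOK v s a ∧ s'.val 1 a 0 = s.val 1 a 0 - s.val 2 a 0) ∧
      ((s'.nat 6 0 0 = s.nat 6 0 0 ∧
          ∀ a < n, s'.val 1 a 0 = s.val 1 a 0 ∧ (s.att a = 0 → BagsOK v s a)) ∨
        (s'.nat 6 0 0 = 0 ∧ ∃ a < n,
          s.att a = 0 ∧ ¬ BagsOK v s a ∧ s'.val 1 a 0 = s.val 1 a 0 - s.val 2 a 0)))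
    (by simp) ?_ ?_
  · rintro i hi s1 hF ⟨hge, hlt, hfl⟩
    have e0 : s1.nat 0 0 0 = n := by rw [hF.nat 0 (by decide), hn]
    have e3 : s1.nat 3 = s.nat 3 := hF.nat 3 (by decide)
    have e5 : s1.nat 5 = s.nat 5 := hF.nat 5 (by decide)
    have e2 : s1.val 2 = s.val 2 := hF.val 2 (by decide)
    have hi1 : s1.val 1 i 0 = s.val 1 i 0 := hge i le_rfl
    set s2 := s1.setN 20 0 0 i with hs2
    rw [Cmd.run]
    -- one pass of the loop either leaves everything alone or lowers the estimate of agent `i`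
    have hsame : ∀ s3 : State, s3.nat 6 = s1.nat 6 → s3.val 1 = s1.val 1 →
        (s.att i = 0 → BagsOK v s i) →
        (∀ a, i + 1 ≤ a → s3.val 1 a 0 = s.val 1 a 0) ∧
        (∀ a < i + 1, s3.val 1 a 0 = s.val 1 a 0 ∨
          s.att a = 0 ∧ ¬ BagsOK v s a ∧ s3.val 1 a 0 = s.val 1 a 0 - s.val 2 a 0) ∧
        ((s3.nat 6 0 0 = s.nat 6 0 0 ∧
            ∀ a < i + 1, s3.val 1 a 0 = s.val 1 a 0 ∧ (s.att a = 0 → BagsOK v s a)) ∨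
          (s3.nat 6 0 0 = 0 ∧ ∃ a < i + 1,
            s.att a = 0 ∧ ¬ BagsOK v s a ∧ s3.val 1 a 0 = s.val 1 a 0 - s.val 2 a 0)) := by
      intro s3 h6 h1 hok
      rw [h6, h1]
      refine ⟨fun a ha => hge a (by omega), fun a ha => ?_, hfl.imp ?_ ?_⟩
      · rcases Nat.lt_succ_iff_lt_or_eq.1 ha with h | rfl
        · exact hlt a h
        · exact Or.inl hi1
      · rintro ⟨h, h'⟩
        refine ⟨h, fun a ha => ?_⟩
        rcases Nat.lt_succ_iff_lt_or_eq.1 ha with h | rfl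
        · exact h' a h
        · exact ⟨hi1, hok⟩
      · rintro ⟨h, a, ha, h'⟩
        exact ⟨h, a, by omega, h'⟩
    split_ifs with hc
    · have hatt : s.att i = 0 := by simpa [hs2, e5, State.att] using hc
      rw [Cmd.run_seq, Cmd.run_seq]
      set s3 := (Cmd.query 4 (num 0) (num 0) (var 20) 3 (var 20)).run v s2 with hs3
      set s4 := (Cmd.query 5 (num 0) (num 0) (var 20) 3 (.add nExp (var 20))).run v s3 with hs4
      have hg : ∀ q, s2.goods m 3 q = s.goods m 3 q := by
        intro q
        simp [State.goods, hs2, e3]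
      have hg' : ∀ q, s3.goods m 3 q = s.goods m 3 q := fun q => hg q
      have f4 : s4.val 4 0 0 = oracle v i (s.goods m 3 i) := by
        rw [← hg]
        simp [hs4, hs3, Cmd.run, hs2]
      have f5 : s4.val 5 0 0 = oracle v i (s.goods m 3 (n + i)) := by
        rw [← hg']
        simp [hs4, hs3, Cmd.run, hs2, e0]
      have f1 : s4.val 1 = s1.val 1 := by
        funext x y
        simp [hs4, hs3, Cmd.run, hs2]
      have f2 : s4.val 2 = s.val 2 := by
        rw [← e2]
        funext x y
        simp [hs4, hs3, Cmd.run, hs2]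
      have f20 : s4.nat 20 0 0 = i := by simp [hs4, hs3, Cmd.run, hs2]
      have f6 : s4.nat 6 = s1.nat 6 := by
        funext x y
        simp [hs4, hs3, Cmd.run, hs2]
      have hok : (Test.conj (.valLe (.get 1 (var 20) (num 0)) (times 19 (rvar 4)))
          (.valLe (.get 1 (var 20) (num 0)) (times 19 (rvar 5)))).Holds s4 ↔ BagsOK v s i := by
        simp [f4, f5, f1, f20, hi1, BagsOK]
      rw [Cmd.run]
      split_ifs with hb
      · rw [hok] at hb
        exact hsame _ f6 f1 fun _ => hb
      · rw [hok] at hb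
        set s5 := (Cmd.setVal 1 (var 20) (num 0)
            (.sub (.get 1 (var 20) (num 0)) (.get 2 (var 20) (num 0))) ;;
          .setNat 6 (num 0) (num 0) (num 0)).run v s4 with hs5
        have k1 : ∀ a, s5.val 1 a 0 =
            if a = i then s.val 1 i 0 - s.val 2 i 0 else s1.val 1 a 0 := by
          intro a
          simp [hs5, Cmd.run, f20, f1, f2, hi1]
        have k6 : s5.nat 6 0 0 = 0 := by simp [hs5, Cmd.run]
        refine ⟨fun a ha => ?_, fun a ha => ?_, Or.inr ⟨k6, i, by omega, hatt, hb, ?_⟩⟩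
        · rw [k1, if_neg (by omega)]
          exact hge a (by omega)
        · rw [k1]
          rcases Nat.lt_succ_iff_lt_or_eq.1 ha with h | rfl
          · rw [if_neg (by omega)]
            exact hlt a h
          · rw [if_pos rfl]
            exact Or.inr ⟨hatt, hb, rfl⟩
        · rw [k1, if_pos rfl]
    · have hatt : s.att i ≠ 0 := by simpa [hs2, e5, State.att] using hc
      refine hsame _ ?_ ?_ fun h => absurd h hatt
      · funext x y
        simp [Cmd.run, hs2]
      · rfl
  · rintro s1 - ⟨-, h2, h3⟩
    simpa using ⟨h2, h3⟩

end

/-! ### Correctness of an attempt -/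

section
variable {n m : ℕ} {v : Fin n → Finset (Fin m) → ℝ}

/-- Each of the agents that are not attached accounts for two active players. -/
lemma actBelow_agentOf (att : ℕ → ℕ) :
    actBelow (fun q => att (agentOf n q) = 0) (n + n) =
      2 * ((n - (attached n att).card : ℕ) : ℝ) := by
  have h1 : ∑ q ∈ Finset.range n, (if att q = 0 then 1 else 0 : ℝ) =
      ((n - (attached n att).card : ℕ) : ℝ) := by
    rw [Finset.sum_range, Finset.sum_boole]
    congr 1
    have h2 := Finset.card_add_card_compl (attached n att)
    rw [Fintype.card_fin] at h2
    have h3 : (Finset.univ.filter fun a : Fin n => att a = 0) = (attached n att)ᶜ := by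
      ext a
      simp [attached]
    rw [h3]
    omega
  rw [actBelow, Finset.sum_range_add, two_mul, ← h1]
  congr 1
  · refine Finset.sum_congr rfl fun q hq => ?_
    rw [Finset.mem_range] at hq
    simp [agentOf, hq]
  · refine Finset.sum_congr rfl fun q _ => ?_
    simp [agentOf]

/-- If a bag of an agent that is not attached is worth too little, then the estimate for her maximin
share is too large. -/
lemma maximinShare_lt (hnn : ∀ a S, 0 ≤ v a S) (hmono : ∀ a, Monotone (v a))
    (hsub : ∀ a, IsSubmodular (v a)) {bun att : ℕ → ℕ} {big : ℕ → ℕ → Prop} {a : Fin n} {M : ℝ}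
    (hM : 0 ≤ M) (hbig : ∀ g : Fin m, big a g ↔ M ≤ 19 * v a {g})
    (hC : CountInv n m bun att big) (hnl : ∀ a : Fin n, ¬ Live n m bun att big a)
    (ha : att a = 0) {B : Finset (Fin m)}
    (hB : ∑ g ∈ (usedGoods n m bun)ᶜ, marg (v a) g B ≤
      actBelow (fun q => att (agentOf n q) = 0) (n + n) * (v a B + M / 19))
    (hlt : 19 * v a B < M) : 19 * maximinShare (n + 1) (v a) < 7 * M := by
  obtain ⟨h1, h2⟩ := hC.final hnl ha
  have hfil : (usedGoods n m bun).filter (fun g => M / 19 ≤ v a {g}) = usedBig n m bun big a := by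
    ext g
    simp only [usedGoods, usedBig, Finset.mem_filter, Finset.mem_univ, true_and, hbig]
    rw [div_le_iff₀ (by norm_num), mul_comm]
  have hatt : (attached n att).card < n := by
    have : (attached n att).card < (Finset.univ : Finset (Fin n)).card :=
      Finset.card_lt_card (Finset.ssubset_univ_iff.2 fun h => by
        have := h ▸ Finset.mem_univ a
        simp [attached, ha] at this)
    simpa using this
  rw [actBelow_agentOf] at hB
  have := maximinShare_le_of_marg (n := n) (hnn a) (hmono a) (hsub a) (θ := M / 19)
    (U := usedGoods n m bun) (B := B) (ρ := n - (attached n att).card) ?_ (by omega)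
    (by rw [hfil]; omega) (by rw [hfil]; exact h1) hB (by positivity)
  · linarith
  · intro g hg
    by_contra hge
    refine hnl a ⟨ha, g, by simpa [usedGoods] using hg, (hbig g).2 ?_⟩
    linarith

/-- The state holds a partition and matchings in which every bundle of every agent meets her
estimate. -/
structure Success (v : Fin n → Finset (Fin m) → ℝ) (s : State) : Prop where
  le : ∀ g < m, s.bun g ≤ n
  row_le : ∀ k ≤ n, ∀ b < n, s.nat 2 k b ≤ n
  row_ne : ∀ k ≤ n, ∀ b < n, s.nat 2 k b ≠ k
  row_inj : ∀ k ≤ n, ∀ b < n, ∀ c < n, s.nat 2 k b = s.nat 2 k c → b = c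
  fair : ∀ k ≤ n, ∀ b : Fin n,
    s.val 1 b 0 ≤ 19 * v b (Finset.univ.filter fun g => s.bun g = s.nat 2 k b)

/-- An attempt either succeeds or lowers the estimates of agents for whom they are too large. -/
lemma attempt_spec (hnn : ∀ a S, 0 ≤ v a S) (hmono : ∀ a, Monotone (v a))
    (hsub : ∀ a, IsSubmodular (v a)) (s : State) (hn : s.nat 0 0 0 = n)
    (hsingle : ∀ (a : Fin n) (g : Fin m), s.val 0 a g = v a {g})
    (hM : ∀ a : Fin n, 0 ≤ s.val 1 a 0) (s' : State) (hs' : s' = attempt.run v s) :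
    (∀ a : Fin n, s'.val 1 a 0 = s.val 1 a 0 ∨
      19 * maximinShare (n + 1) (v a) < 7 * s.val 1 a 0 ∧
        s'.val 1 a 0 = s.val 1 a 0 - s.val 2 a 0) ∧
    ((s'.nat 6 0 0 = 1 ∧ Success v s') ∨
      (s'.nat 6 0 0 = 0 ∧ ∃ a : Fin n, 19 * maximinShare (n + 1) (v a) < 7 * s.val 1 a 0 ∧
        s'.val 1 a 0 = s.val 1 a 0 - s.val 2 a 0)) := by
  subst hs'
  rw [attempt, Cmd.run_seq, Cmd.run_seq, Cmd.run_seq, Cmd.run_seq]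
  have hF1 := reset.frame v s
  obtain ⟨a1, a2, a3, a4, a5⟩ := reset_spec v s hn
  set s1 := reset.run v s
  have n1 : s1.nat 0 0 0 = n := by rw [hF1.nat 0 (by decide), hn]
  have hF2 := (Cmd.iter 27 .vm growTree).frame v s1
  obtain ⟨hC, hP, hnl⟩ := buildTree_spec v s1 n1 a1 a3 a4 _ rfl
  set s2 := (Cmd.iter 27 .vm growTree).run v s1
  have n2 : s2.nat 0 0 0 = n := by rw [hF2.nat 0 (by decide), n1]
  have hbig : ∀ (a : Fin n) (g : Fin m), s1.Big a g ↔ s.val 1 a 0 ≤ 19 * v a {g} := by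
    intro a g
    rw [State.Big, hF1.val 0 (by decide), hF1.val 1 (by decide), hsingle]
  have hF3 := roundRobin.frame v s2
  have hag : ∀ p < n + n, agentOf n p < n := by
    intro p hp
    unfold agentOf
    split_ifs <;> omega
  obtain ⟨b1, b2, b3, b4⟩ := roundRobin_spec s2 (fun p => s.val 1 (agentOf n p) 0 / 19) hnn hmono
    hsub n2 (fun p hp g hg => by rw [hF2.nat 3 (by decide)]; exact a2 p hp g hg) hP.le
    (fun p hp ha => by
      have h1 := hM ⟨_, hag p hp⟩
      refine ⟨by positivity, fun g hg => ?_⟩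
      rw [oracle_of_lt v ⟨_, hag p hp⟩]
      by_contra hge
      refine hnl ⟨_, hag p hp⟩ ⟨ha, g, by simpa [usedGoods] using hg, (hbig _ g).2 ?_⟩
      simp only at hge ⊢
      linarith) _ rfl
  set s3 := roundRobin.run v s2
  have n3 : s3.nat 0 0 0 = n := by rw [hF3.nat 0 (by decide), n2]
  have hF4 := finish.frame v s3
  obtain ⟨c1, c2⟩ := finish_spec v s3 n3 _ rfl
  set s4 := finish.run v s3
  have n4 : s4.nat 0 0 0 = n := by rw [hF4.nat 0 (by decide), n3]
  have hF5 := check.frame v s4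
  obtain ⟨d1, d2⟩ := check_spec v s4 n4 _ rfl
  set s5 := check.run v s4
  have e3 : s4.nat 3 = s3.nat 3 := hF4.nat 3 (by decide)
  have e5 : s4.att = s2.att := by
    funext x
    simp only [State.att, hF4.nat 5 (by decide), hF3.nat 5 (by decide)]
  have e5' : s3.att = s2.att := by
    funext x
    simp only [State.att, hF3.nat 5 (by decide)]
  have eM : s4.val 1 = s.val 1 := by
    rw [hF4.val 1 (by decide), hF3.val 1 (by decide), hF2.val 1 (by decide), hF1.val 1 (by decide)]
  have eX : s4.val 2 = s.val 2 := by
    rw [hF4.val 2 (by decide), hF3.val 2 (by decide), hF2.val 2 (by decide), hF1.val 2 (by decide)]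
  have eg : ∀ q, s4.goods m 3 q = s3.goods m 3 q := fun q => by simp only [State.goods, e3]
  have hfail : ∀ a : Fin n, s4.att a = 0 → ¬ BagsOK v s4 a →
      19 * maximinShare (n + 1) (v a) < 7 * s.val 1 a 0 := by
    intro a ha hb
    rw [e5] at ha
    -- both bags of the agent satisfy the estimate of the round robin
    have key : ∀ p < n + n, agentOf n p = a → 19 * v a (s3.goods m 3 p) < s.val 1 a 0 →
        19 * maximinShare (n + 1) (v a) < 7 * s.val 1 a 0 := by
      intro p hp hpa hlt
      have := b4 p hp (by rw [hpa]; exact ha)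
      simp only [hpa, oracle_of_lt] at this
      exact maximinShare_lt hnn hmono hsub (hM a) (hbig a) hC hnl ha this hlt
    rw [BagsOK, not_and_or, not_le, not_le, eg, eg, oracle_of_lt, eM] at hb
    rcases hb with hb | hb
    · exact key a (by omega) (by simp [agentOf]) hb
    · exact key (n + a) (by omega) (by simp [agentOf]) hb
  refine ⟨fun a => ?_, ?_⟩
  · rcases d1 a a.2 with h | ⟨h1, h2, h3⟩
    · left
      rw [h, eM]
    · right
      rw [h3, eM, eX]
      exact ⟨hfail a h1 h2, rfl⟩
  · rcases d2 with ⟨h6, hok⟩ | ⟨h6, a, ha, h1, h2, h3⟩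
    swap
    · right
      refine ⟨h6, ⟨a, ha⟩, hfail ⟨a, ha⟩ h1 h2, ?_⟩
      simp only
      rw [h3, eM, eX]
    left
    refine ⟨?_, ?_⟩
    · rw [h6, hF4.nat 6 (by decide), hF3.nat 6 (by decide), hF2.nat 6 (by decide), a5]
    have ebun : s5.bun = s4.bun := by
      funext x
      simp only [State.bun, hF5.nat 1 (by decide)]
    have eπ : s5.nat 2 = s4.nat 2 := hF5.nat 2 (by decide)
    have eπ3 : s3.nat 2 = s2.nat 2 := hF3.nat 2 (by decide)
    have hbun : ∀ g < m, s2.bun g ≠ n + 1 → s5.bun g = s2.bun g := by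
      intro g hg hu
      rw [ebun, c1 g hg, b2 g hg hu, if_neg hu]
    have hbag : ∀ q < n + n, s3.goods m 3 q ⊆
        Finset.univ.filter fun g : Fin m => s5.bun g = targetOf n q := by
      intro q hq g hg
      have h1 := b1 q hq g g.2 (by simpa [State.goods] using hg)
      have h2 := targetOf_le n q
      simp only [Finset.mem_filter, Finset.mem_univ, true_and]
      rw [ebun, c1 g g.2, if_neg (by omega), h1]
    have hrowOK : ∀ k ≤ n, (k < n → s2.att k ≠ 0) → ∀ b, s5.nat 2 k b = s2.nat 2 k b := by
      intro k hk hatt b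
      rw [eπ, c2, eπ3, if_neg]
      rintro ⟨h1, -, h2⟩
      rw [e5'] at h2
      exact hatt h1 h2
    have hrowNew : ∀ k < n, s2.att k = 0 → ∀ b < n, s5.nat 2 k b = if b = k then n else b := by
      intro k hk hatt b hb
      rw [eπ, c2, eπ3, e5', hP.id k hk.le (fun _ => hatt) b hb]
      simp [hk, hatt]
    have hcase : ∀ k ≤ n, (k < n → s2.att k ≠ 0) ∨ (k < n ∧ s2.att k = 0) := by
      intro k hk
      by_cases h : k < n ∧ s2.att k = 0
      · exact Or.inr h
      · exact Or.inl fun h1 h2 => h ⟨h1, h2⟩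
    have hMs : ∀ b : Fin n, s5.val 1 b 0 = s.val 1 b 0 := fun b => by rw [(hok b b.2).1, eM]
    -- a bundle with a good that is big for an agent meets her estimate
    have hown : ∀ (b : Fin n) (j : ℕ), j ≤ n → (∃ g < m, s2.bun g = j ∧ s1.Big b g) →
        s5.val 1 b 0 ≤ 19 * v b (Finset.univ.filter fun g => s5.bun g = j) := by
      rintro b j hj ⟨g, hg, h1, h2⟩
      rw [hMs]
      refine ((hbig b ⟨g, hg⟩).1 h2).trans ?_
      have : v b {⟨g, hg⟩} ≤ v b (Finset.univ.filter fun g => s5.bun g = j) := by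
        refine hmono b ?_
        rw [Finset.singleton_subset_iff, Finset.mem_filter]
        refine ⟨Finset.mem_univ _, ?_⟩
        simp only
        rw [hbun g hg (by omega), h1]
      linarith
    -- her own bundle and the central one contain the two bags of an unattached agent
    have hrobin : ∀ b : Fin n, s2.att b = 0 → ∀ j : ℕ, j = b ∨ j = n →
        s5.val 1 b 0 ≤ 19 * v b (Finset.univ.filter fun g => s5.bun g = j) := by
      intro b hb j hj
      have h1 := (hok b b.2).2 (by rw [e5]; exact hb)
      rw [BagsOK, eg, eg, oracle_of_lt, eM, ← hMs b] at h1
      rcases hj with hj | hj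
      · rw [hj]
        have h2 := hbag b (by omega)
        rw [targetOf, if_pos b.2] at h2
        have := hmono b h2
        linarith [h1.1]
      · rw [hj]
        have h2 := hbag (n + b) (by omega)
        rw [targetOf, if_neg (by omega)] at h2
        have := hmono b h2
        linarith [h1.2]
    refine ⟨fun g hg => ?_, fun k hk b hb => ?_, fun k hk b hb => ?_, fun k hk b hb c hc => ?_,
      fun k hk b => ?_⟩
    · rw [ebun, c1 g hg]
      have := b3 g hg
      split_ifs <;> omega
    · rcases hcase k hk with h | ⟨h1, h2⟩
      · rw [hrowOK k hk h]
        exact (hP.row k hk h).le b hb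
      · rw [hrowNew k h1 h2 b hb]
        split_ifs <;> omega
    · rcases hcase k hk with h | ⟨h1, h2⟩
      · rw [hrowOK k hk h]
        exact (hP.row k hk h).ne b hb
      · rw [hrowNew k h1 h2 b hb]
        split_ifs <;> omega
    · rcases hcase k hk with h | ⟨h1, h2⟩
      · rw [hrowOK k hk h, hrowOK k hk h]
        exact (hP.row k hk h).inj b hb c hc
      · rw [hrowNew k h1 h2 b hb, hrowNew k h1 h2 c hc]
        split_ifs <;> omega
    · by_cases hb : s2.att b = 0
      · refine hrobin b hb _ ?_
        rcases hcase k hk with h | ⟨h1, h2⟩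
        · left
          rw [hrowOK k hk h]
          exact (hP.row k hk h).unattached b b.2 hb
        · rw [hrowNew k h1 h2 b b.2]
          split_ifs
          · exact Or.inr rfl
          · exact Or.inl rfl
      · rcases hcase k hk with h | ⟨h1, h2⟩
        · rw [hrowOK k hk h]
          exact hown b _ ((hP.row k hk h).le b b.2) ((hP.row k hk h).attached b b.2 hb)
        · have hbk : (b : ℕ) ≠ k := by
            rintro rfl
            exact hb h2
          -- the attached agent `b` keeps her own bundle, as if the centre had been taken
          have hrn : RowOK n m s2.bun s2.att s1.Big n (s2.nat 2 n) :=
            hP.row n le_rfl fun h => absurd h (lt_irrefl n)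
          have hid : s2.nat 2 n b = b := hP.id n le_rfl (fun h => absurd h (lt_irrefl n)) b b.2
          rw [hrowNew k h1 h2 b b.2, if_neg hbk]
          refine hown b b b.2.le ?_
          have := hrn.attached b b.2 hb
          rwa [hid] at this

end

/-! ### Correctness of the estimates -/

section
variable {n m : ℕ} {v : Fin n → Finset (Fin m) → ℝ}

open Classical in
/-- `x` is a lower bound for the maximin share that is off by a factor of at most `m + 1`: up to
the value of the empty bundle, it is the value of the `(n + 1)`-st best good. -/
structure IsShareUnit (n : ℕ) (w : Finset (Fin m) → ℝ) (x : ℝ) : Prop where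
  eq : x = w ∅ ∨ ∃ g : Fin m, x = w {g} ∧
    n + 1 ≤ (Finset.univ.filter fun h : Fin m => w {g} ≤ w {h}).card
  empty_le : w ∅ ≤ x
  le : ∀ g : Fin m, n + 1 ≤ (Finset.univ.filter fun h : Fin m => w {g} ≤ w {h}).card → w {g} ≤ x

/-- For the empty bundle, any partition shows this; `n + 1` goods that are worth `x` can go to
different bundles. -/
lemma IsShareUnit.le_maximinShare {w : Finset (Fin m) → ℝ} {x : ℝ} (h : IsShareUnit n w x)
    (hmono : Monotone w) : x ≤ maximinShare (n + 1) w := by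
  rcases h.eq with rfl | ⟨g, rfl, hg⟩
  · refine SecretiveMMS.le_maximinShare (P := fun j => if j = 0 then Finset.univ else ∅)
      n.succ_pos ⟨?_, ?_⟩ fun j => hmono (Finset.empty_subset _)
    · intro i j hij
      by_cases hi : i = 0
      · have : j ≠ 0 := fun hj => hij (hi.trans hj.symm)
        simp [this]
      · simp [hi]
    · exact fun g => ⟨0, by simp⟩
  · refine le_maximinShare_of_card hmono ?_
    convert hg

lemma IsShareUnit.maximinShare_le {w : Finset (Fin m) → ℝ} {x : ℝ} (h : IsShareUnit n w x)
    (hnn : ∀ S, 0 ≤ w S) (hmono : Monotone w) (hsub : IsSubmodular w) :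
    maximinShare (n + 1) w ≤ (m + 1) * x := by
  refine maximinShare_le_mul hmono hsub h.empty_le ((hnn ∅).trans h.empty_le) hnn fun g hg => ?_
  refine h.le g ?_
  convert hg

/-- The argument row of the queries starts and ends as the indicator of the empty bundle. -/
lemma querySingles_spec (v : Fin n → Finset (Fin m) → ℝ) (s : State) (h4 : ∀ g, s.nat 4 0 g = 0)
    (s' : State) (hs' : s' = querySingles.run v s) :
    (∀ (a : Fin n) (g : Fin m), s'.val 0 a g = v a {g}) ∧ ∀ a : Fin n, s'.val 2 a 0 = v a ∅ := by
  subst hs'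
  have h0 : ∀ s : State, (∀ g, s.nat 4 0 g = 0) → s.goods m 4 0 = ∅ := by
    intro s h
    simp [State.goods, h]
  refine Cmd.run_iter_frame (N := n) v rfl
    (fun i s' => (∀ g, s'.nat 4 0 g = 0) ∧
      (∀ a < i, ∀ g : Fin m, s'.val 0 a g = oracle v a {g}) ∧
      ∀ a < i, s'.val 2 a 0 = oracle v a ∅)
    (fun s' => (∀ (a : Fin n) (g : Fin m), s'.val 0 a g = v a {g}) ∧
      ∀ a : Fin n, s'.val 2 a 0 = v a ∅) ⟨h4, by simp, by simp⟩ ?_ ?_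
  · rintro i hi s1 - ⟨h1, h2, h3⟩
    rw [Cmd.run_seq]
    set s2 := (Cmd.query 2 (var 20) (num 0) (var 20) 4 (num 0)).run v (s1.setN 20 0 0 i) with hs2
    have e20 : s2.nat 20 0 0 = i := by simp [hs2, Cmd.run]
    have e4 : ∀ g, s2.nat 4 0 g = 0 := by simp [hs2, Cmd.run, h1]
    have e0 : s2.val 0 = s1.val 0 := by
      funext x y
      simp [hs2, Cmd.run]
    have e2 : ∀ a < i + 1, s2.val 2 a 0 = oracle v a ∅ := by
      intro a ha
      have hempty : (s1.setN 20 0 0 i).goods m 4 0 = ∅ := h0 _ (by simp [h1])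
      simp only [hs2, Cmd.run, var_eval, num_eval, State.setV_val, hempty]
      norm_num
      split_ifs with hai
      · rw [hai]
      · exact h3 a (by omega)
    refine Cmd.run_iter_frame (N := m) v rfl
      (fun j s' => (∀ g, s'.nat 4 0 g = 0) ∧
        ∀ a < i + 1, ∀ g : Fin m, a < i ∨ (g : ℕ) < j → s'.val 0 a g = oracle v a {g})
      (fun s' => (∀ g, s'.nat 4 0 g = 0) ∧
        (∀ a < i + 1, ∀ g : Fin m, s'.val 0 a g = oracle v a {g}) ∧
        ∀ a < i + 1, s'.val 2 a 0 = oracle v a ∅) ⟨e4, fun a ha g hg => ?_⟩ ?_ ?_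
    · rw [e0]
      exact h2 a (by omega) g
    · rintro j hj s3 hF ⟨k1, k2⟩
      have f20 : s3.nat 20 0 0 = i := by rw [hF.nat 20 (by decide), e20]
      have hg : (((s3.setN 21 0 0 j).setN 4 0 j 1).goods m 4 0) = {⟨j, hj⟩} := by
        have := goods_setN (s3.setN 21 0 0 j) (l := 4) (p := 0) (⟨j, hj⟩ : Fin m) one_ne_zero
        simp only at this
        rw [this, h0 _ (by simp [k1])]
        rfl
      constructor
      · intro g
        simp only [Cmd.run, var_eval, num_eval, State.setN_nat, State.setV_nat]
        norm_num
        intro hgj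
        rw [if_neg hgj]
        exact k1 g
      · intro a ha g hag
        simp only [Cmd.run, var_eval, num_eval, State.setN_nat, State.setN_val, State.setV_val]
        norm_num [f20, hg]
        split_ifs with hc
        · have : g = ⟨j, hj⟩ := Fin.ext hc.2
          rw [this, hc.1]
        · exact k2 a ha g (by omega)
    · rintro s3 hF ⟨k1, k2⟩
      refine ⟨by simpa using k1, fun a ha g => ?_, fun a ha => ?_⟩
      · exact k2 a ha g (Or.inr g.2)
      · rw [State.setN_val, hF.val 2 (by decide)]
        exact e2 a ha
  · rintro s1 - ⟨-, h2, h3⟩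
    refine ⟨fun a g => ?_, fun a => ?_⟩
    · rw [State.setN_val, h2 a a.2 g, oracle_of_lt]
    · rw [State.setN_val, h3 a a.2, oracle_of_lt]

open Classical in
lemma countAbove_spec (v : Fin n → Finset (Fin m) → ℝ) (s : State) {a g : ℕ}
    (h20 : s.nat 20 0 0 = a) (h21 : s.nat 21 0 0 = g) :
    (countAbove.run v s).nat 13 0 0 =
      (Finset.univ.filter fun h : Fin m => s.val 0 a g ≤ s.val 0 a h).card := by
  rw [Finset.card_filter, Fin.sum_univ_eq_sum_range
    (fun h => if s.val 0 a g ≤ s.val 0 a h then 1 else 0) m, countAbove, Cmd.run_seq]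
  set s1 := (Cmd.setNat 13 (num 0) (num 0) (num 0)).run v s with hs1
  refine Cmd.run_iter_frame (N := m) v rfl
    (fun i s' => s'.nat 13 0 0 =
      ∑ h ∈ Finset.range i, if s.val 0 a g ≤ s.val 0 a h then 1 else 0)
    (fun s' => s'.nat 13 0 0 =
      ∑ h ∈ Finset.range m, if s.val 0 a g ≤ s.val 0 a h then 1 else 0) ?_ ?_ ?_
  · simp [hs1, Cmd.run]
  · intro i _ s2 hF h
    have e20 : s2.nat 20 0 0 = a := by
      rw [hF.nat 20 (by decide)]
      simp [hs1, Cmd.run, h20]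
    have e21 : s2.nat 21 0 0 = g := by
      rw [hF.nat 21 (by decide)]
      simp [hs1, Cmd.run, h21]
    have e0 : s2.val 0 = s.val 0 := by rw [hF.val 0 (by decide)]; rfl
    rw [Finset.sum_range_succ, ← h, Cmd.run]
    have hc : (Test.valLe (.get 0 (var 20) (var 21)) (.get 0 (var 20) (var 22))).Holds
        (s2.setN 22 0 0 i) ↔ s.val 0 a g ≤ s.val 0 a i := by
      simp [e20, e21, e0]
    by_cases hb : s.val 0 a g ≤ s.val 0 a i
    · rw [if_pos (hc.2 hb), if_pos hb]
      simp [Cmd.run]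
    · rw [if_neg (mt hc.1 hb), if_neg hb]
      simp [Cmd.run]
  · intro s2 _ h
    simpa using h

open Classical in
lemma findUnits_spec (v : Fin n → Finset (Fin m) → ℝ) (s : State) (hn : s.nat 0 0 0 = n)
    (hsingle : ∀ (a : Fin n) (g : Fin m), s.val 0 a g = v a {g})
    (hempty : ∀ a : Fin n, s.val 2 a 0 = v a ∅) (s' : State) (hs' : s' = findUnits.run v s) :
    ∀ a : Fin n, IsShareUnit n (v a) (s'.val 2 a 0) := by
  subst hs'
  refine Cmd.run_iter_frame (N := n) v rfl
    (fun i s' => ∀ a : Fin n, ((a : ℕ) < i → IsShareUnit n (v a) (s'.val 2 a 0)) ∧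
      (i ≤ a → s'.val 2 a 0 = v a ∅))
    (fun s' => ∀ a : Fin n, IsShareUnit n (v a) (s'.val 2 a 0))
    (fun a => ⟨by simp, fun _ => hempty a⟩)
    ?_ ?_
  · intro i hi s1 hF h
    refine Cmd.run_iter_frame (N := m) v rfl
      (fun j s' => (∀ a, a ≠ i → s'.val 2 a 0 = s1.val 2 a 0) ∧
        (s'.val 2 i 0 = v ⟨i, hi⟩ ∅ ∨ ∃ g : Fin m, s'.val 2 i 0 = v ⟨i, hi⟩ {g} ∧
          n + 1 ≤ (Finset.univ.filter fun h : Fin m => v ⟨i, hi⟩ {g} ≤ v ⟨i, hi⟩ {h}).card) ∧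
        v ⟨i, hi⟩ ∅ ≤ s'.val 2 i 0 ∧ ∀ g : Fin m, (g : ℕ) < j →
          n + 1 ≤ (Finset.univ.filter fun h : Fin m => v ⟨i, hi⟩ {g} ≤ v ⟨i, hi⟩ {h}).card →
          v ⟨i, hi⟩ {g} ≤ s'.val 2 i 0)
      (fun s' => ∀ a : Fin n, ((a : ℕ) < i + 1 → IsShareUnit n (v a) (s'.val 2 a 0)) ∧
        (i + 1 ≤ a → s'.val 2 a 0 = v a ∅)) ?_ ?_ ?_
    · have h1 := (h ⟨i, hi⟩).2 le_rfl
      simp only at h1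
      refine ⟨fun _ _ => rfl, Or.inl h1, h1.ge, by simp⟩
    · rintro j hj s2 hF2 ⟨k1, k2, k3, k4⟩
      set s3 := s2.setN 21 0 0 j with hs3
      rw [raiseUnit, Cmd.run_seq]
      have e20 : s3.nat 20 0 0 = i := by
        rw [hs3, State.setN_nat_ne _ _ _ _ (by omega), hF2.nat 20 (by decide)]
        simp
      have e21 : s3.nat 21 0 0 = j := by simp [hs3]
      have hF3 := countAbove.frame v s3
      have hcnt := countAbove_spec v s3 e20 e21
      set s4 := countAbove.run v s3 with hs4
      have e0 : ∀ (g : Fin m), s3.val 0 i g = v ⟨i, hi⟩ {g} := by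
        intro g
        rw [hs3, State.setN_val, hF2.val 0 (by decide), State.setN_val, hF.val 0 (by decide)]
        exact hsingle ⟨i, hi⟩ g
      have e0j := e0 ⟨j, hj⟩
      simp only at e0j
      simp only [e0, e0j] at hcnt
      have f0 : s4.val 0 = s3.val 0 := hF3.val 0 (by decide)
      have f2 : s4.val 2 = s2.val 2 := by rw [hF3.val 2 (by decide), hs3, State.setN_val]
      have f20 : s4.nat 20 0 0 = i := by rw [hF3.nat 20 (by decide), e20]
      have f21 : s4.nat 21 0 0 = j := by rw [hF3.nat 21 (by decide), e21]
      have fn : s4.nat 0 0 0 = n := by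
        rw [hF3.nat 0 (by decide), hs3, State.setN_nat_ne _ _ _ _ (by omega),
          hF2.nat_set (by decide) (by omega), hF.nat 0 (by decide), hn]
      have hc : (Test.conj (natLt nExp (var 13)) (.valLe (.get 2 (var 20) (num 0))
          (.get 0 (var 20) (var 21)))).Holds s4 ↔
          n + 1 ≤ (Finset.univ.filter fun h : Fin m =>
            v ⟨i, hi⟩ {⟨j, hj⟩} ≤ v ⟨i, hi⟩ {h}).card ∧ s2.val 2 i 0 ≤ v ⟨i, hi⟩ {⟨j, hj⟩} := by
        simp only [conj_holds, natLt_holds, nExp_eval, var_eval, valLe_holds, vget_eval, num_eval,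
          fn, hcnt, f0, f2, f20, f21, e0j, Nat.lt_iff_add_one_le]
      rw [Cmd.run]
      by_cases hb : n + 1 ≤ (Finset.univ.filter fun h : Fin m =>
            v ⟨i, hi⟩ {⟨j, hj⟩} ≤ v ⟨i, hi⟩ {h}).card ∧ s2.val 2 i 0 ≤ v ⟨i, hi⟩ {⟨j, hj⟩}
      · rw [if_pos (hc.2 hb)]
        set s5 := (Cmd.setVal 2 (var 20) (num 0) (.get 0 (var 20) (var 21))).run v s4 with hs5
        have g2 : ∀ a, s5.val 2 a 0 = if a = i then v ⟨i, hi⟩ {⟨j, hj⟩} else s2.val 2 a 0 := by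
          intro a
          simp [hs5, Cmd.run, f20, f21, f0, f2, e0j]
        simp only [g2, if_true]
        refine ⟨fun a ha => ?_, Or.inr ⟨⟨j, hj⟩, rfl, hb.1⟩, k3.trans hb.2, fun g hg hgc => ?_⟩
        · rw [if_neg ha]
          exact k1 a ha
        · rcases Nat.lt_succ_iff_lt_or_eq.1 hg with h' | h'
          · exact (k4 g h' hgc).trans hb.2
          · have : g = ⟨j, hj⟩ := Fin.ext h'
            rw [this]
      · rw [if_neg (mt hc.1 hb)]
        simp only [Cmd.run, f2]
        refine ⟨k1, k2, k3, fun g hg hgc => ?_⟩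
        rcases Nat.lt_succ_iff_lt_or_eq.1 hg with h' | h'
        · exact k4 g h' hgc
        · have : g = ⟨j, hj⟩ := Fin.ext h'
          subst this
          by_contra hlt
          exact hb ⟨hgc, (not_le.1 hlt).le⟩
    · rintro s2 - ⟨k1, k2, k3, k4⟩ a
      simp only [State.setN_val]
      refine ⟨fun ha => ?_, fun ha => ?_⟩
      · by_cases hai : (a : ℕ) = i
        · have : a = ⟨i, hi⟩ := Fin.ext hai
          subst this
          exact ⟨k2, k3, fun g hg => k4 g g.2 hg⟩
        · rw [k1 a hai]
          exact (h a).1 (by omega)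
      · rw [k1 a (by omega)]
        exact (h a).2 (by omega)
  · intro s1 _ h a
    exact (h a).1 a.2

lemma initEstimates_spec (v : Fin n → Finset (Fin m) → ℝ) (s : State)
    (h1 : ∀ a, s.val 1 a 0 = 0) (s' : State) (hs' : s' = initEstimates.run v s) :
    ∀ a : Fin n, s'.val 1 a 0 = (m + 1 : ℕ) * s.val 2 a 0 := by
  subst hs'
  refine Cmd.run_iter_frame (N := n) v rfl
    (fun i s' => ∀ a, s'.val 1 a 0 = if a < i then (m + 1 : ℕ) * s.val 2 a 0 else 0)
    (fun s' => ∀ a : Fin n, s'.val 1 a 0 = (m + 1 : ℕ) * s.val 2 a 0) (by simpa using h1) ?_ ?_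
  · intro i _ s1 hF h
    refine Cmd.run_iter_frame (N := m + 1) v rfl
      (fun j s' => ∀ a, s'.val 1 a 0 = if a < i then (m + 1 : ℕ) * s.val 2 a 0 else
        if a = i then j * s.val 2 a 0 else 0)
      (fun s' => ∀ a, s'.val 1 a 0 = if a < i + 1 then (m + 1 : ℕ) * s.val 2 a 0 else 0) ?_ ?_ ?_
    · intro a
      simp [h a]
    · intro j _ s2 hF2 h2 a
      have e20 : s2.nat 20 0 0 = i := by
        rw [hF2.nat 20 (by decide)]
        simp
      have e2 : s2.val 2 = s.val 2 := by
        rw [hF2.val 2 (by decide), State.setN_val, hF.val 2 (by decide)]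
      have hi := h2 i
      simp only [lt_irrefl, if_false, if_true] at hi
      simp only [Cmd.run, var_eval, num_eval, State.setV_val, State.setN_nat, State.setN_val,
        vadd_eval, vget_eval]
      norm_num [e20, e2]
      by_cases hai : a = i
      · rw [if_pos hai, hi, hai]
        simp only [lt_irrefl, if_false, if_true]
        ring
      · rw [if_neg hai, h2 a]
        simp [hai]
    · intro s2 _ h2 a
      rw [State.setN_val, h2 a]
      by_cases hai : a = i
      · simp [hai]
      · have : (a < i + 1) ↔ (a < i) := by omega
        simp only [this, hai, if_false]
  · intro s1 _ h a
    rw [State.setN_val, h a, if_pos a.2]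

/-- A failed attempt shows that the estimate, a multiple of the unit, can be lowered by a unit:
the hypotheses give `19 / 7 < κ`, and then `7 / 19 * κ ≤ κ - 1`. -/
lemma lower_estimate {μ x : ℝ} {κ : ℕ} (h0 : 0 ≤ x) (hx : x ≤ μ) (h : 19 * μ < 7 * (κ * x)) :
    1 ≤ κ ∧ μ ≤ ((κ - 1 : ℕ) : ℝ) * x := by
  have hxpos : 0 < x := by
    rcases h0.eq_or_lt with h1 | h1
    · rw [← h1] at h hx
      linarith
    · exact h1
  have h3 : 3 ≤ κ := by
    by_contra hlt
    have h2 : (κ : ℝ) ≤ 2 := by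
      have : κ ≤ 2 := by omega
      exact_mod_cast this
    have := mul_le_mul_of_nonneg_right h2 h0
    linarith
  have h3' : (3 : ℝ) ≤ κ := by exact_mod_cast h3
  have h4 := mul_le_mul_of_nonneg_right h3' h0
  refine ⟨by omega, ?_⟩
  rw [Nat.cast_sub (by omega)]
  push_cast
  linarith

end

/-! ### Correctness of the main loop -/

section
variable {n m : ℕ} {v : Fin n → Finset (Fin m) → ℝ}

/-- The invariant of the main loop after `t` rounds: the estimates are multiples `κ a` of the units
and upper bounds for the maximin shares; as long as there has been no success, every round has
lowered the sum of the `κ a`. -/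
structure MainInv (v : Fin n → Finset (Fin m) → ℝ) (t : ℕ) (s : State) : Prop where
  input : s.nat 0 0 0 = n
  single : ∀ (a : Fin n) (g : Fin m), s.val 0 a g = v a {g}
  unit : ∀ a : Fin n, IsShareUnit n (v a) (s.val 2 a 0)
  estimate : ∃ κ : Fin n → ℕ, (∀ a : Fin n, s.val 1 a 0 = κ a * s.val 2 a 0 ∧
    maximinShare (n + 1) (v a) ≤ s.val 1 a 0) ∧
    ((s.nat 6 0 0 = 1 ∧ Success v s) ∨ (s.nat 6 0 0 = 0 ∧ ∑ a, κ a + t ≤ n * (m + 1)))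

lemma MainInv.setN {t : ℕ} {s : State} (h : MainInv v t s) {k : ℕ} (hk : 20 ≤ k) (i : ℕ) :
    MainInv v t (s.setN k 0 0 i) := by
  obtain ⟨h1, h2, h3, κ, h4, h5⟩ := h
  have e : ∀ k', k' < 20 → (s.setN k 0 0 i).nat k' = s.nat k' :=
    fun k' hk' => State.setN_nat_ne _ _ _ _ (by omega)
  refine ⟨by rw [e 0 (by omega), h1], h2, h3, κ, h4, ?_⟩
  rw [e 6 (by omega)]
  refine h5.imp_left (And.imp_right fun h => ?_)
  have eb : (s.setN k 0 0 i).bun = s.bun := by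
    funext x
    simp only [State.bun, e 1 (by omega)]
  refine ⟨?_, ?_, ?_, ?_, ?_⟩
  · rw [eb]; exact h.le
  · rw [e 2 (by omega)]; exact h.row_le
  · rw [e 2 (by omega)]; exact h.row_ne
  · rw [e 2 (by omega)]; exact h.row_inj
  · rw [e 2 (by omega), eb]; exact h.fair

/-- A round makes an attempt unless there has been a success. -/
lemma MainInv.step (hnn : ∀ a S, 0 ≤ v a S) (hmono : ∀ a, Monotone (v a))
    (hsub : ∀ a, IsSubmodular (v a)) {t : ℕ} {s : State} (h : MainInv v t s) :
    MainInv v (t + 1) ((Cmd.cond (natEq (var 6) (num 0)) attempt .skip).run v s) := by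
  obtain ⟨h1, h2, h3, κ, h4, h5⟩ := h
  rw [Cmd.run]
  rcases h5 with ⟨h5, h6⟩ | ⟨h5, h6⟩
  · rw [if_neg (by simp [h5])]
    exact ⟨h1, h2, h3, κ, h4, Or.inl ⟨h5, h6⟩⟩
  · rw [if_pos (by simpa using h5)]
    have hF := attempt.frame v s
    have hx : ∀ a : Fin n, 0 ≤ s.val 2 a 0 := fun a => (hnn a ∅).trans (h3 a).empty_le
    have hM : ∀ a : Fin n, 0 ≤ s.val 1 a 0 := by
      intro a
      rw [(h4 a).1]
      exact mul_nonneg (Nat.cast_nonneg _) (hx a)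
    obtain ⟨k1, k2⟩ := attempt_spec hnn hmono hsub s h1 h2 hM _ rfl
    set s' := attempt.run v s
    have e2 : s'.val 2 = s.val 2 := hF.val 2 (by decide)
    have hlow : ∀ a : Fin n, 19 * maximinShare (n + 1) (v a) < 7 * s.val 1 a 0 →
        s'.val 1 a 0 = s.val 1 a 0 - s.val 2 a 0 → ∃ κ' < κ a,
          s'.val 1 a 0 = κ' * s'.val 2 a 0 ∧ maximinShare (n + 1) (v a) ≤ s'.val 1 a 0 := by
      intro a hlt heq
      rw [(h4 a).1] at hlt
      obtain ⟨l1, l2⟩ := lower_estimate (hx a) ((h3 a).le_maximinShare (hmono a)) hlt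
      have l3 : s'.val 1 a 0 = ((κ a - 1 : ℕ) : ℝ) * s.val 2 a 0 := by
        rw [heq, (h4 a).1, Nat.cast_sub l1]
        push_cast
        ring
      exact ⟨κ a - 1, by omega, by rw [e2, l3], by rw [l3]; exact l2⟩
    have hex : ∀ a : Fin n, ∃ κ' ≤ κ a, s'.val 1 a 0 = κ' * s'.val 2 a 0 ∧
        maximinShare (n + 1) (v a) ≤ s'.val 1 a 0 ∧
        (19 * maximinShare (n + 1) (v a) < 7 * s.val 1 a 0 ∧
          s'.val 1 a 0 = s.val 1 a 0 - s.val 2 a 0 → κ' < κ a) := by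
      intro a
      by_cases hc : 19 * maximinShare (n + 1) (v a) < 7 * s.val 1 a 0 ∧
          s'.val 1 a 0 = s.val 1 a 0 - s.val 2 a 0
      · obtain ⟨κ', l1, l2, l3⟩ := hlow a hc.1 hc.2
        exact ⟨κ', l1.le, l2, l3, fun _ => l1⟩
      · have := (k1 a).resolve_right hc
        refine ⟨κ a, le_rfl, ?_, ?_, fun h => absurd h hc⟩
        · rw [this, e2]
          exact (h4 a).1
        · rw [this]
          exact (h4 a).2
    choose κ' l1 l2 l3 l4 using hex
    refine ⟨by rw [hF.nat 0 (by decide), h1], ?_, ?_, κ', fun a => ⟨l2 a, l3 a⟩, ?_⟩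
    · rw [hF.val 0 (by decide)]
      exact h2
    · rw [e2]
      exact h3
    · refine k2.imp_right ?_
      rintro ⟨h0, a, ha⟩
      refine ⟨h0, ?_⟩
      have : ∑ a, κ' a < ∑ a, κ a :=
        Finset.sum_lt_sum (fun a _ => l1 a) ⟨a, Finset.mem_univ a, l4 a ha⟩
      omega

lemma main_spec (hnn : ∀ a S, 0 ≤ v a S) (hmono : ∀ a, Monotone (v a))
    (hsub : ∀ a, IsSubmodular (v a)) (s : State) (hs : s = main.run v (initial n m)) :
    Success v s ∧ ∀ a : Fin n, maximinShare (n + 1) (v a) ≤ s.val 1 a 0 := by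
  have hend : MainInv v ((n + 1) * (m + 1)) s := by
    subst hs
    rw [main, Cmd.run_seq]
    have h0 : MainInv v 0 (setup.run v (initial n m)) := by
      have hin : (initial n m).nat 0 0 0 = n := by simp [initial, setCell]
      have h4 : ∀ g, (initial n m).nat 4 0 g = 0 := by simp [initial, setCell]
      have h6 : (initial n m).nat 6 0 0 = 0 := by simp [initial, setCell]
      rw [setup, Cmd.run_seq, Cmd.run_seq]
      have hF1 := querySingles.frame v (initial n m)
      obtain ⟨a1, a2⟩ := querySingles_spec v (initial n m) h4 _ rfl
      set s1 := querySingles.run v (initial n m)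
      have hF2 := findUnits.frame v s1
      have b1 := findUnits_spec v s1 (by rw [hF1.nat 0 (by decide), hin]) a1 a2 _ rfl
      set s2 := findUnits.run v s1
      have hF3 := initEstimates.frame v s2
      have c1 := initEstimates_spec v s2
        (by rw [hF2.val 1 (by decide), hF1.val 1 (by decide)]; exact fun _ => rfl) _ rfl
      set s3 := initEstimates.run v s2
      have e2 : s3.val 2 = s2.val 2 := hF3.val 2 (by decide)
      refine ⟨?_, ?_, ?_, fun _ => m + 1, fun a => ⟨?_, ?_⟩, Or.inr ⟨?_, ?_⟩⟩
      · rw [hF3.nat 0 (by decide), hF2.nat 0 (by decide), hF1.nat 0 (by decide), hin]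
      · rw [hF3.val 0 (by decide), hF2.val 0 (by decide)]
        exact a1
      · rw [e2]
        exact b1
      · rw [c1, e2]
      · rw [c1]
        push_cast
        exact (b1 a).maximinShare_le (hnn a) (hmono a) (hsub a)
      · rw [hF3.nat 6 (by decide), hF2.nat 6 (by decide), hF1.nat 6 (by decide), h6]
      · simp
    refine Cmd.run_iter_frame (N := n + 1) v rfl (fun i s => MainInv v (i * (m + 1)) s)
      (fun s => MainInv v ((n + 1) * (m + 1)) s) (by simpa using h0) ?_ ?_
    · intro i _ s1 _ h
      refine Cmd.run_iter_frame (N := m + 1) v rfl (fun j s => MainInv v (i * (m + 1) + j) s)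
        (fun s => MainInv v ((i + 1) * (m + 1)) s) (h.setN (by omega) i) ?_ ?_
      · intro j _ s2 _ h2
        exact (h2.setN (by omega) j).step hnn hmono hsub
      · intro s2 _ h2
        rw [Nat.succ_mul]
        exact h2.setN (by omega) _
    · intro s1 _ h
      exact h.setN (by omega) _
  obtain ⟨-, -, -, κ, h4, h5⟩ := hend
  refine ⟨?_, fun a => (h4 a).2⟩
  rcases h5 with h5 | ⟨-, h5⟩
  · exact h5.2
  · exfalso
    rw [Nat.succ_mul] at h5
    omega

/-- Reading off the partition and the matchings. -/
lemma Success.exists_output {s : State} (h : Success v s)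
    (hM : ∀ a : Fin n, maximinShare (n + 1) (v a) ≤ s.val 1 a 0) :
    ∃ (P : Fin (n + 1) → Finset (Fin m)) (π : Fin (n + 1) → Fin n → Fin (n + 1)),
      Outputs s P π ∧ IsSecretiveMMS (1 / 19) v P π := by
  refine ⟨fun j => Finset.univ.filter fun g => s.bun g = j,
    fun k a => ⟨s.nat 2 k a, Nat.lt_succ_of_le (h.row_le k (Nat.le_of_lt_succ k.2) a a.2)⟩,
    ⟨fun j g => by rw [Finset.mem_filter]; simp [State.bun], fun k a => rfl⟩,
    ⟨?_, ?_⟩, fun k => ?_, fun k a => ?_⟩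
  · intro i j hij
    rw [Finset.disjoint_left]
    intro g hg hg'
    exact hij (Fin.ext ((Finset.mem_filter.1 hg).2.symm.trans (Finset.mem_filter.1 hg').2))
  · exact fun g => ⟨⟨s.bun g, Nat.lt_succ_of_le (h.le g g.2)⟩, by simp⟩
  · have hk : (k : ℕ) ≤ n := Nat.le_of_lt_succ k.2
    set f : Fin n → Fin (n + 1) :=
      fun a => ⟨s.nat 2 k a, Nat.lt_succ_of_le (h.row_le k hk a a.2)⟩ with hf
    have hinj : Function.Injective f := by
      intro a b hab
      exact Fin.ext (h.row_inj k hk a a.2 b b.2 (Fin.ext_iff.1 hab))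
    have hne : ∀ a, f a ≠ k := fun a ha => h.row_ne k hk a a.2 (Fin.ext_iff.1 ha)
    have himg : Finset.univ.image f = Finset.univ.erase k := by
      refine Finset.eq_of_subset_of_card_le ?_ ?_
      · intro b hb
        obtain ⟨a, -, rfl⟩ := Finset.mem_image.1 hb
        exact Finset.mem_erase.2 ⟨hne a, Finset.mem_univ _⟩
      · rw [Finset.card_image_of_injective _ hinj, Finset.card_erase_of_mem (Finset.mem_univ k)]
        simp
    refine ⟨fun a _ => hne a, hinj.injOn, fun b hb => ?_⟩
    have : b ∈ Finset.univ.image f := by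
      rw [himg]
      exact Finset.mem_erase.2 ⟨hb, Finset.mem_univ b⟩
    obtain ⟨a, -, ha⟩ := Finset.mem_image.1 this
    exact ⟨a, Set.mem_univ a, ha⟩
  · have h1 := h.fair k (Nat.le_of_lt_succ k.2) a
    have h2 := hM a
    simp only
    linarith

end
end SecretiveMMS

theorem mainTheorem2 :
    ∃ (c : SecretiveMMS.Program) (p : Polynomial ℕ),
      ∀ (n m : ℕ) (v : Fin n → Finset (Fin m) → ℝ),
        (∀ (a : Fin n) (S : Finset (Fin m)), 0 ≤ v a S) →
        (∀ a : Fin n, Monotone (v a)) →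
        (∀ a : Fin n, SecretiveMMS.IsSubmodular (v a)) →
        ∃ (t : ℕ) (s : SecretiveMMS.State) (P : Fin (n + 1) → Finset (Fin m))
          (π : Fin (n + 1) → Fin n → Fin (n + 1)),
          SecretiveMMS.Exec v c (SecretiveMMS.initial n m) t s ∧
          t ≤ p.eval (n + m) ∧
          SecretiveMMS.Outputs s P π ∧
          SecretiveMMS.IsSecretiveMMS (1 / 19) v P π := by
  refine ⟨SecretiveMMS.main.compile, SecretiveMMS.main.time, fun n m v hnn hmono hsub => ?_⟩
  obtain ⟨t, ht, hexec⟩ := SecretiveMMS.main.exec v SecretiveMMS.main_wf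
    SecretiveMMS.main_writesN (SecretiveMMS.initial n m)
    (by simp [SecretiveMMS.initial, SecretiveMMS.setCell])
    (by simp [SecretiveMMS.initial, SecretiveMMS.setCell])
  obtain ⟨hS, hM⟩ := SecretiveMMS.main_spec hnn hmono hsub _ rfl
  obtain ⟨P, π, hout, hfair⟩ := hS.exists_output hM
  exact ⟨t, _, P, π, hexec, ht, hout, hfair⟩
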